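/- **Setting.** Let $M^3$ be a connected closed (compact, without boundary) smooth parallelizable 3-manifold with a fixed frame $L_1,L_2,L_3\in\Gamma(TM^3)$. Let $\Omega=[0,\infty)\times M^3$, let $\tau$ be the coordinate on $[0,\infty)$, $\partial_0=\partial/\partial\tau$, and $C^\infty=C^\infty(\Omega,\mathbb R)$. Vector fields on $M^3$ and functions in $C^\infty(M^3)$ are regarded as $\tau$-independent objects on $\Omega$. Let $C=\{(1,2,3),(2,3,1),(3,1,2)\}$. No summation convention is used. **The algebra $\mathcal E_\Phi$.** Let $W$ be the free $C^\infty$-module on symbols $\theta_0,\theta_1,\theta_2,\theta_3$, with the conformal inner product represented by $\langle\theta_a,\theta_b\rangle=\eta_{ab}$, $\eta=\mathrm{diag}(-1,1,1,1)$. Wedge signs are omitted in $\wedge W$. Let $\mathrm{CDer}(W)\subset\mathrm{Der}^0(\wedge W)$ be the Lie algebra of the degree zero $\mathbb R$-linear derivations $\delta$ of $\wedge W$ for which there is an $f\in C^\infty$ with $\delta\langle w,w'\rangle=\langle\delta w,w'\rangle+\langle w,\delta w'\rangle+f\langle w,w'\rangle$ for all $w,w'\in W$. It is free over $C^\infty$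 of rank $11$, with basis $\sigma_0,\sigma_1,\sigma_2,\sigma_3,\sigma_{23},\sigma_{31},\sigma_{12}$, which annihilate $C^\infty$, where $\sigma_0(\theta_a)=\theta_a$, $\sigma_{ab}(\theta_c)=\eta_{bc}\theta_a-\eta_{ac}\theta_b$, $\sigma_i=\sigma_{0i}$, together with the derivations $\partial_0,L_1,L_2,L_3$ of $C^\infty$, extended to annihilate $\theta_0,\dots,\theta_3$. The module $\mathcal L=\wedge W\otimes_{C^\infty}\mathrm{CDer}(W)$ is a graded Lie algebra with $$[\omega\delta,\omega'\delta']=\omega\omega'[\delta,\delta']+\omega\delta(\omega')\delta'-\delta'(\omega)\omega'\delta .$$ Let $\mathcal I^2\subset\mathcal L^2$ be the $C^\infty$-submodule generated by the elements $$\mathrm{Re}\Big[\sum_{m,n=1}^3 S_{mn}\,(\theta_0\theta_m+i\,\theta_{m'}\theta_{m''})(\sigma_n+i\,\sigma_{n'n''})\Big],\qquad (m,m',m''),(n,n',n'')\in C,$$ where $S$ runs over the symmetric traceless complex $3\times3$ matrices. Put $\mathcal I=(\wedge W)\mathcal I^2$ and $\mathcal E=\mathcal L/\mathcal I$; thus $\mathcal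 E^0=\mathcal L^0$ and $\mathcal E^1=\mathcal L^1$. Let $\Phi^0=0$, $\Phi^1=W$, $\Phi^2=\wedge^2W\oplus\wedge^4W$, the basis elements of $\Phi$ inherited from $\wedge W$ being underlined. For $w\in W$, $\varphi\in\Phi^1$ set $w\varphi=w\wedge\varphi\oplus w\wedge\varphi^*$, where $\varphi\mapsto\varphi^*$ is $C^\infty$-linear with $\theta_0^*=\theta_1\theta_2\theta_3$, $\theta_1^*=\theta_0\theta_2\theta_3$, $\theta_2^*=\theta_0\theta_3\theta_1$, $\theta_3^*=\theta_0\theta_1\theta_2$. On $\mathcal E_\Phi=\mathcal E\oplus\Phi$ the bracket $\mathcal E_\Phi^1\times\mathcal E_\Phi^1\to\mathcal E_\Phi^2$ is $\mathbb R$-bilinear and symmetric, given on $\mathcal E^1\times\mathcal E^1$ by the bracket of $\mathcal E$, on $\mathcal E^1\times\Phi^1$ by $[w\delta,\varphi]=w\,\delta(\varphi)\in\Phi^2$, and on $\Phi^1\times\Phi^1$ by polarization of $$[\varphi,\varphi]=\sum_{i,j,p,q=0}^3\Big(-6a^pa^q+\eta^{pq}\sum_{b,c=0}^3\eta_{bc}a^ba^c\Big)\eta^{ij}\,\theta_i\theta_p\sigma_{jq}\in\mathcal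 E^2,\qquad \varphi=\sum_i a^i\underline{\theta_i}.$$ **The algebra $\mathcal A$.** For $\alpha\in\mathbb N^3$ let $G_\alpha\mathcal E_\Phi$ be the $C^\infty$-span of the following elements and of $\theta_0$ times these elements; only homological degrees $\le2$ are listed. For each $(i,j,k)\in C$ let $e_i\in\mathbb N^3$ be the $i$-th unit vector. * $\alpha=(0,0,0)$: $\mathrm{Der}(C^\infty)$; $\sigma_0$; $\theta_0\sigma_0+\theta_i\sigma_i$ for $i=1,2,3$; $\underline{\theta_0}$; $\theta_2\theta_3\sigma_{23}+\theta_3\theta_1\sigma_{31}+\theta_1\theta_2\sigma_{12}+2\theta_0\theta_1\sigma_1+2\theta_0\theta_2\sigma_2+2\theta_0\theta_3\sigma_3$. * $\alpha=2e_i$: $-\theta_i\sigma_{jk}+\theta_j\sigma_{ki}+\theta_k\sigma_{ij}$. * $\alpha=e_j+e_k$: $\sigma_i$; $\sigma_{jk}$; $\theta_i\mathrm{Der}(C^\infty)$; $\theta_0\sigma_i+\theta_i\sigma_0$; $\theta_j\sigma_k+\theta_k\sigma_j$; $\theta_k\sigma_{ki}$; $\theta_j\sigma_{ij}$; $\underline{\theta_i}$;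 $\theta_0\theta_j\sigma_{ij}+\theta_i\theta_j\sigma_j$. * $\alpha=2e_i+e_j+e_k$: $\theta_j\sigma_k-\theta_k\sigma_j$; $\theta_j\theta_k\mathrm{Der}(C^\infty)$; $\underline{\theta_j\theta_k}$; $\theta_0\theta_j\sigma_k-\theta_0\theta_k\sigma_j-2\theta_j\theta_k\sigma_0$; $\theta_0\theta_j\sigma_k+\theta_0\theta_k\sigma_j-2\theta_i\theta_j\sigma_{ki}$. * $\alpha=(2,2,2)$: $\theta_0\theta_1\sigma_{23}+\theta_0\theta_2\sigma_{31}+\theta_0\theta_3\sigma_{12}-2\theta_2\theta_3\sigma_1-2\theta_3\theta_1\sigma_2-2\theta_1\theta_2\sigma_3$. * all other $\alpha$: none. Then $\mathcal E_\Phi=\bigoplus_\alpha G_\alpha\mathcal E_\Phi$. With $F_\alpha\mathcal E_\Phi=\bigoplus_{\beta\le\alpha}G_\beta\mathcal E_\Phi$ and three symbols $s=(s_1,s_2,s_3)$, the Rees algebra is the algebra of formal power series $\mathcal P=\{\sum_\alpha x_\alpha s^\alpha\mid x_\alpha\in F_\alpha\mathcal E_\Phi\}$, and $\mathcal A=\mathcal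 P/(s_1\mathcal P+s_2\mathcal P+s_3\mathcal P)$ is the associated graded algebra, with the induced bracket. Every element of $\mathcal A$ has a unique representative $\sum_\alpha x_\alpha s^\alpha$ with $x_\alpha\in G_\alpha\mathcal E_\Phi$, by which it is denoted. Let $\mathrm{MC}(\mathcal A)=\{x\in\mathcal A^1\mid[x,x]=0\}$. **Gauge.** Let $\mathcal A_{\text{special}}\subset\mathcal A^1$ be the $C^\infty$-span of $\underline{\theta_0}$ and of the following elements, for all $(i,j,k)\in C$: $\theta_0\sigma_0+\theta_i\sigma_i$; $s_i^2(-\theta_i\sigma_{jk}+\theta_j\sigma_{ki}+\theta_k\sigma_{ij})$; and $s_js_k$ times $\theta_iL_1$, $\theta_iL_2$, $\theta_iL_3$, $\theta_0\sigma_i+\theta_i\sigma_0$, $\theta_k\sigma_{ki}$, $\theta_j\sigma_{ij}$, $\underline{\theta_i}$. Set $\mathcal A_{\text{affine gauged}}=\theta_0\partial_0+\mathcal A_{\text{special}}$. For $x\in\mathcal A^1$, set $s_1=s_2=s_3=1$ in its representative; let $\sum_a\theta_aV_a$ with $V_a\in\mathrm{Der}(C^\infty)$ be the frame part of the resulting element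 of $\mathcal E^1_\Phi$, let $\sum_a w_a\theta_a\sigma_0$ be its $\sigma_0$ part and $\sum_a\phi_a\underline{\theta_a}$ its component in $\Phi^1$. Call $x$ *nondegenerate* if $V_0,\dots,V_3$ is a frame of $T\Omega$. Call a nondegenerate $x$ *exact* if the one-forms $\alpha,\beta$ on $\Omega$ with $\alpha(V_a)=w_a$ and $\beta(V_a)=\phi_a$ for $a=0,\dots,3$ are exact, that is, differentials of functions in $C^\infty$. Let $\mathrm{MC}(\mathcal A)_{\text{gauged}}$ be the set of all nondegenerate and exact elements of $\mathrm{MC}(\mathcal A)\cap\mathcal A_{\text{affine gauged}}$. **Tuples and constraints.** Consider tuples $$(D_1,D_2,D_3,p_1,p_2,p_3,p_0,\zeta,\chi)$$ where $D_1,D_2,D_3\in\Gamma(TM^3)$ constitute a frame and $p_1,p_2,p_3,p_0,\zeta,\chi\in C^\infty(M^3)$. Define the structure functions $c_{ij}^k\in C^\infty(M^3)$ by $[D_i,D_j]=\sum_kc_{ij}^kD_k$. The constraint equations are $$0=3p_0^2-p_2p_3-p_3p_1-p_1p_2,$$ $$0=-\tfrac12D_i(p_j+p_k)-\tfrac12c_{ij}^j(p_i-p_j)+\tfrac12c_{ki}^k(p_i-p_k)+p_iD_i(\zeta)+3p_0D_i(\chi)\qquad\text{for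 all }(i,j,k)\in C.$$ **Lemma 4.** For every such tuple, with $\mathfrak s_i=s_ie^{-p_i\tau}$, the element $$\begin{aligned}\theta_0\partial_0+p_0\underline{\theta_0}+\sum_{(i,j,k)\in C}\Big(&p_i(\theta_0\sigma_0+\theta_i\sigma_i)+\tfrac12\mathfrak s_i^2c_{jk}^i(\theta_i\sigma_{jk}-\theta_j\sigma_{ki}-\theta_k\sigma_{ij})+\mathfrak s_j\mathfrak s_k\theta_iD_i\\ &-\mathfrak s_j\mathfrak s_k\big(D_i(\zeta)-\tau D_i(p_1+p_2+p_3)\big)(\theta_0\sigma_i+\theta_i\sigma_0)\\ &+\mathfrak s_j\mathfrak s_k\big(D_i(\zeta)+c_{ki}^k-\tau D_i(p_k)\big)\theta_k\sigma_{ki}\\ &-\mathfrak s_j\mathfrak s_k\big(D_i(\zeta)-c_{ij}^j-\tau D_i(p_j)\big)\theta_j\sigma_{ij}\\ &+\mathfrak s_j\mathfrak s_k\big(D_i(\chi)+\tau D_i(p_0)\big)\underline{\theta_i}\Big)\end{aligned}$$ of $\mathcal A^1$ is in $\mathrm{MC}(\mathcal A)_{\text{gauged}}$ if and only if the constraint equations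 hold. Every element of $\mathrm{MC}(\mathcal A)_{\text{gauged}}$ is of this form for a tuple that is unique up to additive constants in $\zeta$ and $\chi$; conversely, changing $\zeta$ and $\chi$ by additive constants does not change the element. -/

import Mathlib

open scoped Manifold ContDiff

noncomputable section

namespace BKL

/-! ## The graded Lie algebra over an abstract ring

Throughout `R` is a commutative `ℝ`-algebra; it is later the ring `C^∞(Ω)`. Let `W` be the free
`R`-module on `θ₀, θ₁, θ₂, θ₃`, realized as `Fin 4 → R`. Only homological degrees `0, 1, 2` are
needed. A spatial index is an `i : Fin 3`, the corresponding symbol is `θ_{i.succ}`, and the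
cyclic triples are `(i, i + 1, i + 2)`. -/

section Algebra

set_option linter.unusedSectionVars false

variable (R : Type*) [CommRing R] [Algebra ℝ R]

/-- The signature `diag(-1, 1, 1, 1)`. -/
def eta : Fin 4 → R := ![-1, 1, 1, 1]

variable {R}

/-- The representative `⟨θ_a, θ_b⟩ = η_ab` of the conformal inner product on `W`. -/
def conf (w w' : Fin 4 → R) : R := ∑ a, eta R a * w a * w' a

variable (R)

/-- `Der⁰(∧W) ≅ End(W) ⊕ Der(R)`: the pair `(m, v)` is the derivation that acts as `v` on `R` and
as `θ_b ↦ ∑ₐ m_ab θ_a` on the generators. -/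
abbrev Der0 : Type _ := Matrix (Fin 4) (Fin 4) R × Derivation ℝ R R

variable {R}

/-- The action of a derivation on `W`. -/
def act (d : Der0 R) (w : Fin 4 → R) : Fin 4 → R := fun a => ∑ b, d.1 a b * w b + d.2 (w a)

/-- The commutator in `Der⁰(∧W)`. -/
def derCommutator (d d' : Der0 R) : Der0 R :=
  (d.1 * d'.1 - d'.1 * d.1 + d'.1.map d.2 - d.1.map d'.2, ⁅d.2, d'.2⁆)

theorem act_add (d d' : Der0 R) (w : Fin 4 → R) : act (d + d') w = act d w + act d' w := by
  ext a; simp [act, add_mul, Finset.sum_add_distrib]; ring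

theorem act_smul (r : R) (d : Der0 R) (w : Fin 4 → R) : act (r • d) w = r • act d w := by
  ext a; simp [act, Finset.mul_sum, mul_assoc, mul_add]

theorem act_derCommutator (d d' : Der0 R) (w : Fin 4 → R) :
    act (derCommutator d d') w = act d (act d' w) - act d' (act d w) := by
  ext a
  simp only [act, derCommutator, Matrix.sub_apply, Matrix.add_apply, Matrix.mul_apply,
    Matrix.map_apply, Pi.sub_apply, Fin.sum_univ_four, map_add, Derivation.leibniz, smul_eq_mul,
    Derivation.commutator_apply]
  ring

theorem conf_add_left (u v w : Fin 4 → R) : conf (u + v) w = conf u w + conf v w := by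
  simp [conf, mul_add, add_mul, Finset.sum_add_distrib]

theorem conf_smul_left (r : R) (v w : Fin 4 → R) : conf (r • v) w = r * conf v w := by
  simp only [conf, Finset.mul_sum, Pi.smul_apply, smul_eq_mul]
  exact Finset.sum_congr rfl fun _ _ => by ring

theorem conf_comm (v w : Fin 4 → R) : conf v w = conf w v := by
  simp only [conf]
  exact Finset.sum_congr rfl fun _ _ => by ring

theorem conf_sub_left (u v w : Fin 4 → R) : conf (u - v) w = conf u w - conf v w := by
  simp [conf, mul_sub, sub_mul, Finset.sum_sub_distrib]

variable (R)

/-- `CDer(W)`: the derivations that preserve the conformal inner product. -/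
def CDer : Submodule R (Der0 R) where
  carrier := {d | ∃ f : R, ∀ w w' : Fin 4 → R,
    d.2 (conf w w') = conf (act d w) w' + conf w (act d w') + f * conf w w'}
  zero_mem' := ⟨0, fun w w' => by simp [conf, act]⟩
  add_mem' := by
    rintro d d' ⟨f, hf⟩ ⟨f', hf'⟩
    refine ⟨f + f', fun w w' => ?_⟩
    rw [conf_comm w (act (d + d') w'), act_add, act_add, conf_add_left, conf_add_left,
      conf_comm _ w, conf_comm _ w]
    simp only [Prod.snd_add, Derivation.add_apply, hf, hf']
    ring
  smul_mem' := by
    rintro r d ⟨f, hf⟩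
    refine ⟨r * f, fun w w' => ?_⟩
    rw [conf_comm w (act (r • d) w'), act_smul, act_smul, conf_smul_left, conf_smul_left,
      conf_comm _ w]
    simp only [Prod.smul_snd, Derivation.smul_apply, smul_eq_mul, hf]
    ring

variable {R}

theorem derCommutator_mem {d d' : Der0 R} (hd : d ∈ CDer R) (hd' : d' ∈ CDer R) :
    derCommutator d d' ∈ CDer R := by
  obtain ⟨f, hf⟩ := hd
  obtain ⟨f', hf'⟩ := hd'
  refine ⟨d.2 f' - d'.2 f, fun w w' => ?_⟩
  rw [conf_comm w (act (derCommutator d d') w'), act_derCommutator, act_derCommutator, conf_sub_left,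
    conf_sub_left, conf_comm _ w, conf_comm _ w]
  simp only [derCommutator, Derivation.commutator_apply, hf, hf', map_add, Derivation.leibniz,
    smul_eq_mul]
  ring

instance : Bracket (CDer R) (CDer R) :=
  ⟨fun d d' => ⟨derCommutator d.1 d'.1, derCommutator_mem d.2 d'.2⟩⟩

/-- `σ₀`, with `σ₀(θ_a) = θ_a`. -/
def sigma0 : CDer R := ⟨(1, 0), -2, fun w w' => by
  simp [conf, act, Matrix.one_apply, Fin.sum_univ_four]; ring⟩

/-- `σ_ab`, with `σ_ab(θ_c) = η_bc θ_a - η_ac θ_b`. -/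
def sigma (a b : Fin 4) : CDer R :=
  ⟨(Matrix.of fun d c => (if b = c ∧ a = d then eta R b else 0)
      - (if a = c ∧ b = d then eta R a else 0), 0), 0, fun w w' => by
    fin_cases a <;> fin_cases b <;> simp [conf, act, eta, Fin.sum_univ_four]⟩

/-- A derivation of `R`, extended to annihilate `θ₀, …, θ₃`. -/
def ofDer (v : Derivation ℝ R R) : CDer R := ⟨(0, v), 0, fun w w' => by
  simp [conf, act, eta, Fin.sum_univ_four]; ring⟩


/-- `σ_i = σ_{0i}` for a spatial index `i`. -/
def boost (i : Fin 3) : CDer R := sigma 0 i.succ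

/-- `σ_{jk}` for `(i, j, k)` cyclic, so `rot 0 = σ₂₃`, `rot 1 = σ₃₁`, `rot 2 = σ₁₂`. -/
def rot (i : Fin 3) : CDer R := sigma (i + 1).succ (i + 2).succ

/-- Pairs `a < b`, indexing the basis `θ_a θ_b` of `∧²W`. -/
abbrev Pairs : Type := {p : Fin 4 × Fin 4 // p.1 < p.2}

variable (R)

/-- `W ⊗ CDer(W)`; the family `x` stands for `∑ₐ θ_a x_a`. -/
abbrev L1 : Type _ := Fin 4 → CDer R

/-- `∧²W ⊗ CDer(W)`; the family `y` stands for `∑_{a<b} θ_a θ_b y_ab`. -/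
abbrev L2 : Type _ := Pairs → CDer R

variable {R}

/-- The components of `∑_{a,b} θ_a θ_b z_ab` in the basis `θ_a θ_b`, `a < b`. -/
def wedge {X : Type*} [AddCommGroup X] (z : Fin 4 → Fin 4 → X) : Pairs → X :=
  fun p => z p.1.1 p.1.2 - z p.1.2 p.1.1

/-- The element `θ_a δ`. -/
def th (a : Fin 4) (δ : CDer R) : L1 R := Pi.single a δ

/-- The element `θ_a θ_b δ`. -/
def th2 (a b : Fin 4) (δ : CDer R) : L2 R := wedge (Pi.single a (Pi.single b δ))

/-- The bracket `[ωδ, ω'δ'] = ωω'[δ,δ'] + ωδ(ω')δ' - δ'(ω)ω'δ` of two elements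
`∑ₐ θ_a x_a`, `∑_b θ_b y_b` of degree one. -/
def bracketL (x y : L1 R) : L2 R :=
  wedge fun a b => ⁅x a, y b⁆ + ∑ c, (x a).1.1 b c • y c - ∑ c, (y b).1.1 a c • x c

/-- The real part of `(θ₀θ_i + iθ_jθ_k)ᵢᵀ S (σ_j + iσ_{kl})ⱼ` for a complex `3 × 3` matrix `S`. -/
def idealElement (S : Matrix (Fin 3) (Fin 3) ℂ) : L2 R :=
  ∑ m : Fin 3, ∑ n : Fin 3,
    (algebraMap ℝ R (S m n).re •
        (th2 0 m.succ (boost n) - th2 (m + 1).succ (m + 2).succ (rot n))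
      - algebraMap ℝ R (S m n).im •
        (th2 0 m.succ (rot n) + th2 (m + 1).succ (m + 2).succ (boost n)))

variable (R)

/-- The degree two part `𝓘²` of the ideal: `S` runs over the symmetric traceless matrices. -/
def I2 : Submodule R (L2 R) :=
  Submodule.span R {y | ∃ S : Matrix (Fin 3) (Fin 3) ℂ, S.IsSymm ∧ S.trace = 0 ∧ y = idealElement S}

/-- `Φ² = ∧²W ⊕ ∧⁴W`; the second component is the coefficient of `θ₀θ₁θ₂θ₃`. -/
abbrev Phi2 : Type _ := (Pairs → R) × R

/-- `𝓔_Φ¹ = 𝓔¹ ⊕ Φ¹` with `𝓔¹ = W ⊗ CDer(W)` and `Φ¹ = W`. -/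
abbrev E1 : Type _ := L1 R × (Fin 4 → R)

/-- `𝓔_Φ² = 𝓔² ⊕ Φ²` with `𝓔² = (∧²W ⊗ CDer(W)) / 𝓘²`. -/
abbrev E2 : Type _ := (L2 R ⧸ I2 R) × Phi2 R

variable {R}

/-- Module multiplication `θ_a φ = θ_a ∧ φ ⊕ θ_a ∧ φ^*` for `φ ∈ Φ¹`. The basis Hodge dual satisfies
`θ_a ∧ θ_b^* = -η_ab θ₀θ₁θ₂θ₃`. -/
def thetaMul (a : Fin 4) (φ : Fin 4 → R) : Phi2 R :=
  (wedge (Pi.single a φ), -(eta R a * φ a))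

/-- The bracket `𝓔¹ × Φ¹ → Φ²`, `[ωδ, φ] = ω δ(φ)`. -/
def bracketLPhi (x : L1 R) (φ : Fin 4 → R) : Phi2 R := ∑ a, thetaMul a (act (x a).1 φ)

/-- The symmetric bilinear bracket `Φ¹ × Φ¹ → 𝓔²` with
`[φ, φ] = (-6 a^p a^q + ⟨a,a⟩ η^{pq}) η^{ij} θ_i θ_p σ_{jq}` for `φ = a^i θ_i`. -/
def bracketPhi (a b : Fin 4 → R) : L2 R :=
  wedge fun i p => ∑ q, (eta R i * (-3 * (a p * b q + a q * b p)
    + (if p = q then conf a b * eta R p else 0))) • (sigma i q : CDer R)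

/-- The bracket `𝓔_Φ¹ × 𝓔_Φ¹ → 𝓔_Φ²`. -/
def bracketE (x y : E1 R) : E2 R :=
  (Submodule.Quotient.mk (bracketL x.1 y.1 + bracketPhi x.2 y.2),
    bracketLPhi x.1 y.2 + bracketLPhi y.1 x.2)

/-! ### The BKL filtration -/

/-- The degrees `200, 020, 002`. -/
def dg200 (i : Fin 3) : Fin 3 → ℕ := fun m => if m = i then 2 else 0

/-- The degrees `011, 101, 110`. -/
def dg011 (i : Fin 3) : Fin 3 → ℕ := fun m => if m = i then 0 else 1

/-- The degrees `211, 121, 112`. -/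
def dg211 (i : Fin 3) : Fin 3 → ℕ := fun m => if m = i then 2 else 1

/-- The degree `222`. -/
def dg222 : Fin 3 → ℕ := fun _ => 2

variable (R)

/-- Generators of the gauge part of `G_α 𝓔` of homological degree zero. -/
def tabE0 (α : Fin 3 → ℕ) : Set (CDer R) :=
  {x | (α = 0 ∧ ((∃ v, x = ofDer v) ∨ x = sigma0)) ∨
    ∃ i : Fin 3, α = dg011 i ∧ (x = boost i ∨ x = rot i)}

/-- Generators of the gauge part of `G_α 𝓔` of homological degree one. -/
def tabE1 (α : Fin 3 → ℕ) : Set (L1 R) :=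
  {x | ∃ i : Fin 3,
    (α = 0 ∧ x = th 0 sigma0 + th i.succ (boost i)) ∨
    (α = dg200 i ∧
      x = -th i.succ (rot i) + th (i + 1).succ (rot (i + 1)) + th (i + 2).succ (rot (i + 2))) ∨
    (α = dg011 i ∧
      ((∃ v, x = th i.succ (ofDer v)) ∨
        x = th 0 (boost i) + th i.succ sigma0 ∨
        x = th (i + 1).succ (boost (i + 2)) + th (i + 2).succ (boost (i + 1)) ∨
        x = th (i + 2).succ (rot (i + 1)) ∨
        x = th (i + 1).succ (rot (i + 2)))) ∨
    (α = dg211 i ∧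
      x = th (i + 1).succ (boost (i + 2)) - th (i + 2).succ (boost (i + 1)))}

/-- Generators of the gauge part of `G_α 𝓔` of homological degree two. -/
def tabE2 (α : Fin 3 → ℕ) : Set (L2 R) :=
  {x | (α = 0 ∧
      x = ∑ i : Fin 3, (th2 (i + 1).succ (i + 2).succ (rot i)
        + (2 : R) • th2 0 i.succ (boost i))) ∨
    (∃ i : Fin 3, α = dg011 i ∧
      x = th2 0 (i + 1).succ (rot (i + 2)) + th2 i.succ (i + 1).succ (boost (i + 1))) ∨
    (∃ i : Fin 3, α = dg211 i ∧
      ((∃ v, x = th2 (i + 1).succ (i + 2).succ (ofDer v)) ∨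
        x = th2 0 (i + 1).succ (boost (i + 2)) - th2 0 (i + 2).succ (boost (i + 1))
          - (2 : R) • th2 (i + 1).succ (i + 2).succ sigma0 ∨
        x = th2 0 (i + 1).succ (boost (i + 2)) + th2 0 (i + 2).succ (boost (i + 1))
          - (2 : R) • th2 i.succ (i + 1).succ (rot (i + 1)))) ∨
    (α = dg222 ∧
      x = ∑ i : Fin 3, (th2 0 i.succ (rot i)
        - (2 : R) • th2 (i + 1).succ (i + 2).succ (boost i)))}

/-- Generators of the gauge part of `G_α Φ` of homological degree one. -/
def tabPhi1 (α : Fin 3 → ℕ) : Set (Fin 4 → R) :=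
  {x | (α = 0 ∧ x = Pi.single 0 1) ∨ ∃ i : Fin 3, α = dg011 i ∧ x = Pi.single i.succ 1}

/-- Generators of the gauge part of `G_α Φ` of homological degree two. -/
def tabPhi2 (α : Fin 3 → ℕ) : Set (Phi2 R) :=
  {x | ∃ i : Fin 3, α = dg211 i ∧
    x = (wedge (Pi.single (i + 1).succ (Pi.single (i + 2).succ 1)), 0)}

/-- `G_α 𝓔_Φ¹`: the span of the generators of degree one and of `θ₀` times those of degree zero. -/
def G1 (α : Fin 3 → ℕ) : Submodule R (E1 R) :=
  (Submodule.span R (tabE1 R α ∪ th 0 '' tabE0 R α)).prod (Submodule.span R (tabPhi1 R α))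

/-- `G_α 𝓔_Φ²`: the span of the generators of degree two and of `θ₀` times those of degree one. -/
def G2 (α : Fin 3 → ℕ) : Submodule R (E2 R) :=
  ((Submodule.span R
      (tabE2 R α ∪ (fun x : L1 R => wedge (Pi.single 0 x)) '' tabE1 R α)).map (I2 R).mkQ).prod
    (Submodule.span R (tabPhi2 R α ∪ thetaMul 0 '' tabPhi1 R α))

/-- The BKL filtration `F_α 𝓔_Φ² = ⨁_{β ≤ α} G_β 𝓔_Φ²`. -/
def F2 (α : Fin 3 → ℕ) : Submodule R (E2 R) := ⨆ β, ⨆ (_ : β ≤ α), G2 R β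

/-! ### The Rees algebra and the associated graded algebra -/

/-- Formal power series `∑_α x_α s^α` in `s = (s₁, s₂, s₃)`. -/
abbrev Series (X : Type*) : Type _ := (Fin 3 → ℕ) → X

/-- Multiplication by the symbol `s_i`. -/
def mulS {X : Type*} [AddCommGroup X] [Module R X] (i : Fin 3) : Series X →ₗ[R] Series X where
  toFun y := fun α => if α i = 0 then 0 else y (α - Pi.single i 1)
  map_add' y z := by
    ext α; by_cases h : α i = 0 <;> simp [h]
  map_smul' r y := by
    ext α; by_cases h : α i = 0 <;> simp [h]

/-- Degree two of the Rees algebra: `𝓟² = {∑_α x_α s^α | x_α ∈ F_α 𝓔_Φ²}`. -/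
def Rees2 : Submodule R (Series (E2 R)) := Submodule.pi Set.univ (F2 R)

/-- `s𝓟² = s₁𝓟² + s₂𝓟² + s₃𝓟²`. -/
def sRees2 : Submodule R (Series (E2 R)) := ⨆ i, (Rees2 R).map (mulS R i)

/-- The quotient in which brackets of elements of `𝓐¹` live; it contains `𝓐² = 𝓟²/s𝓟²`. -/
abbrev A2 : Type _ := Series (E2 R) ⧸ sRees2 R

/-- `𝓐¹`, where an element of the associated graded algebra `𝓐 = 𝓟/s𝓟` is given by its unique
representative `∑_α x_α s^α` in `𝓟` with `x_α ∈ G_α 𝓔_Φ`. -/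
def A1 : Submodule R (Series (E1 R)) := Submodule.pi Set.univ (G1 R)

variable {R}

/-- The bracket on `𝓔_Φ[[s]]` in degree one. -/
def bracketSeries (x y : Series (E1 R)) : Series (E2 R) :=
  fun γ => ∑ α ∈ Finset.Iic γ, bracketE (x α) (y (γ - α))

/-- The bracket of `𝓐` in degree one: the class modulo `s𝓟` of the bracket of representatives. -/
def bracketA (x y : Series (E1 R)) : A2 R := Submodule.Quotient.mk (bracketSeries x y)

variable (R)

/-- `MC(𝓐) = {x ∈ 𝓐¹ | [x, x] = 0}`. -/
def MCA : Set (Series (E1 R)) := {x | x ∈ A1 R ∧ bracketA x x = 0}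

variable {R}

/-- The element of `𝓔_Φ¹` obtained from an element of `𝓐¹` by setting `s₁ = s₂ = s₃ = 1`; all
degrees that occur in `𝓐` are at most `222`. -/
def setOne (x : Series (E1 R)) : E1 R := ∑ α ∈ Finset.Iic dg222, x α

/-- The frame of `x ∈ 𝓔_Φ¹`: if the frame part is `∑ₐ θ_a V_a`, the derivation `V_a`. -/
def frameOf (x : E1 R) (a : Fin 4) : Derivation ℝ R R := (x.1 a).1.2

/-- The coefficient of `θ_a σ₀` in `x ∈ 𝓔_Φ¹`. All `σ_ab` have zero diagonal, so that this is the
upper left entry of the matrix. -/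
def sigma0Coeff (x : E1 R) (a : Fin 4) : R := (x.1 a).1.1 0 0

/-- The one-form that corresponds to `w = ∑ₐ w_a θ_a` via the frame of `x`, that is, the one-form
`α` with `α(V_a) = w_a`, is exact: it is `df` for some `f`, so that `V_a(f) = w_a`. -/
def IsExactVia (x : E1 R) (w : Fin 4 → R) : Prop := ∃ f : R, ∀ a, frameOf x a f = w a

/-- Exactness: both one-forms associated to `x` (from the `σ₀` part and from the scalar field) are
exact. -/
def IsExact (x : Series (E1 R)) : Prop :=
  IsExactVia (setOne x) (sigma0Coeff (setOne x)) ∧ IsExactVia (setOne x) (setOne x).2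

/-- The `s^α`-part of the basis of the gauge subspace, where `V₁, V₂, V₃` is a frame of spatial
derivations. -/
def tabSpecial (V : Fin 3 → Derivation ℝ R R) (α : Fin 3 → ℕ) : Set (E1 R) :=
  {x | (α = 0 ∧ x = (0, Pi.single 0 1)) ∨
    ∃ i : Fin 3,
    (α = 0 ∧ x = (th 0 sigma0 + th i.succ (boost i), 0)) ∨
    (α = dg200 i ∧
      x = (-th i.succ (rot i) + th (i + 1).succ (rot (i + 1)) + th (i + 2).succ (rot (i + 2)), 0)) ∨
    (α = dg011 i ∧
      ((∃ l, x = (th i.succ (ofDer (V l)), 0)) ∨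
        x = (th 0 (boost i) + th i.succ sigma0, 0) ∨
        x = (th (i + 2).succ (rot (i + 1)), 0) ∨
        x = (th (i + 1).succ (rot (i + 2)), 0) ∨
        x = (0, Pi.single i.succ 1)))}

/-- The affine gauge subspace `θ₀∂₀ + 𝓐_special`. -/
def affineGauged (d0 : Derivation ℝ R R) (V : Fin 3 → Derivation ℝ R R) :
    Set (Series (E1 R)) :=
  {x | ∀ α, (x - (Pi.single 0 (th 0 (ofDer d0), 0) : Series (E1 R))) α ∈
    Submodule.span R (tabSpecial V α)}

end Algebra

/-! ## Smooth functions and vector fields on `Ω = [0,∞) × M³` -/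

section VectorFieldAction

variable {E H N : Type*} [NormedAddCommGroup E] [NormedSpace ℝ E] [TopologicalSpace H]
  (I : ModelWithCorners ℝ E H) [TopologicalSpace N] [ChartedSpace H N] [IsManifold I ∞ N]

/-- The smooth function `V f = df(V)` for a smooth vector field `V` and a smooth function `f`. -/
def vfApply (V : Cₛ^∞⟮I; E, (TangentSpace I : N → Type _)⟯) (f : C^∞⟮I, N; ℝ⟯) :
    C^∞⟮I, N; ℝ⟯ :=
  ⟨fun x => (mfderiv I 𝓘(ℝ, ℝ) f x (V x) : ℝ), by
    have h1 : ContMDiff I.tangent 𝓘(ℝ, ℝ).tangent ∞ (tangentMap I 𝓘(ℝ, ℝ) f) :=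
      f.contMDiff.contMDiff_tangentMap (by simp)
    have h4 : ContMDiff 𝓘(ℝ, ℝ).tangent 𝓘(ℝ, ℝ) ∞
        (fun p : TangentBundle 𝓘(ℝ, ℝ) ℝ => (p.2 : ℝ)) :=
      contMDiff_snd_tangentBundle_modelSpace ℝ 𝓘(ℝ, ℝ)
    exact h4.comp (h1.comp V.contMDiff)⟩

/-- A smooth vector field, viewed as a derivation of the algebra of smooth functions. -/
def vfDerivation (V : Cₛ^∞⟮I; E, (TangentSpace I : N → Type _)⟯) :
    Derivation ℝ C^∞⟮I, N; ℝ⟯ C^∞⟮I, N; ℝ⟯ :=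
  Derivation.mk'
    { toFun := vfApply I V
      map_add' := fun f g => by
        ext x
        have hf : MDifferentiableAt I 𝓘(ℝ, ℝ) f x := f.contMDiff.mdifferentiable (by simp) x
        have hg : MDifferentiableAt I 𝓘(ℝ, ℝ) g x := g.contMDiff.mdifferentiable (by simp) x
        have h := mfderiv_add hf hg
        change (mfderiv I 𝓘(ℝ, ℝ) (⇑f + ⇑g) x (V x) : ℝ) = _
        rw [h]
        rfl
      map_smul' := fun r f => by
        ext x
        have hf : MDifferentiableAt I 𝓘(ℝ, ℝ) f x := f.contMDiff.mdifferentiable (by simp) x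
        have h := const_smul_mfderiv hf r
        change (mfderiv I 𝓘(ℝ, ℝ) (r • ⇑f) x (V x) : ℝ) = _
        rw [h]
        rfl }
    (fun f g => by
      ext x
      have hf : MDifferentiableAt I 𝓘(ℝ, ℝ) f x := f.contMDiff.mdifferentiable (by simp) x
      have hg : MDifferentiableAt I 𝓘(ℝ, ℝ) g x := g.contMDiff.mdifferentiable (by simp) x
      have h := (hf.hasMFDerivAt.mul hg.hasMFDerivAt).mfderiv
      change (mfderiv I 𝓘(ℝ, ℝ) (⇑f * ⇑g) x (V x) : ℝ) = _
      rw [h]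
      rfl)

end VectorFieldAction

/-- `Ω = [0,∞) × M³`; the half line is a manifold with boundary. -/
abbrev Om (M : Type*) : Type _ := EuclideanHalfSpace 1 × M

/-- The model with corners of `Ω`. -/
abbrev IOm : ModelWithCorners ℝ (EuclideanSpace ℝ (Fin 1) × EuclideanSpace ℝ (Fin 3))
    (ModelProd (EuclideanHalfSpace 1) (EuclideanSpace ℝ (Fin 3))) := (𝓡∂ 1).prod (𝓡 3)

section Manifold
variable (M : Type*) [TopologicalSpace M] [ChartedSpace (EuclideanSpace ℝ (Fin 3)) M]

/-- `C^∞(M³)`. -/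
abbrev CM : Type _ := C^∞⟮𝓡 3, M; ℝ⟯
/-- `C^∞(Ω)`. -/
abbrev COm : Type _ := C^∞⟮IOm, Om M; ℝ⟯

/-- `Γ(TM³)`. -/
abbrev VF [IsManifold (𝓡 3) ∞ M] : Type _ :=
  Cₛ^∞⟮𝓡 3; EuclideanSpace ℝ (Fin 3), (TangentSpace (𝓡 3) : M → Type _)⟯

/-- `Γ(TΩ)`. -/
abbrev VFOm [IsManifold (𝓡 3) ∞ M] : Type _ :=
  Cₛ^∞⟮IOm; EuclideanSpace ℝ (Fin 1) × EuclideanSpace ℝ (Fin 3),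
    (TangentSpace IOm : Om M → Type _)⟯

variable {M}

/-- The coordinate `τ` on the half line. -/
def tau : COm M := ⟨fun q => q.1.1 0, by
  have h1 : ContMDiff (𝓡∂ 1) 𝓘(ℝ, EuclideanSpace ℝ (Fin 1)) ∞ (𝓡∂ 1) :=
    ModelWithCorners.contMDiff _
  have h2 : ContMDiff 𝓘(ℝ, EuclideanSpace ℝ (Fin 1)) 𝓘(ℝ, ℝ) ∞
      (fun v : EuclideanSpace ℝ (Fin 1) => v 0) :=
    (EuclideanSpace.proj (0 : Fin 1) : EuclideanSpace ℝ (Fin 1) →L[ℝ] ℝ).contMDiff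
  exact h2.comp (h1.comp contMDiff_fst)⟩

/-- The injection `C^∞(M³) → C^∞(Ω)`. -/
def pull (f : CM M) : COm M := f.comp ⟨Prod.snd, contMDiff_snd⟩

/-- The function `e^f`. -/
def expOm (f : COm M) : COm M :=
  ⟨fun q => Real.exp (f q), (Real.contDiff_exp (n := ∞)).contMDiff.comp f.contMDiff⟩

variable [IsManifold (𝓡 3) ∞ M]

/-- The vector field `∂₀ = ∂/∂τ` on `Ω`. -/
def d0Field : VFOm M :=
  ⟨fun _ => ((EuclideanSpace.single 0 1, 0) :
      EuclideanSpace ℝ (Fin 1) × EuclideanSpace ℝ (Fin 3)), by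
    have h0 : ContMDiff (𝓡∂ 1) (𝓡∂ 1).tangent ∞ (fun t : EuclideanHalfSpace 1 =>
        (⟨t, EuclideanSpace.single 0 1⟩ : TangentBundle (𝓡∂ 1) (EuclideanHalfSpace 1))) := by
      intro t
      refine (Bundle.contMDiffAt_section (IB := 𝓡∂ 1) (F := EuclideanSpace ℝ (Fin 1))
        (E := (TangentSpace (𝓡∂ 1) : EuclideanHalfSpace 1 → Type _)) t).2 ?_
      simp only [trivializationAt_model_space_apply]
      exact contMDiffAt_const
    have h1 : ContMDiff (𝓡 3) (𝓡 3).tangent ∞ (fun x : M =>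
        (⟨x, 0⟩ : TangentBundle (𝓡 3) M)) := 
      Bundle.contMDiff_zeroSection ℝ (TangentSpace (𝓡 3) : M → Type _)
    exact (contMDiff_equivTangentBundleProd_symm (I := 𝓡∂ 1) (I' := 𝓡 3)
      (M := EuclideanHalfSpace 1) (M' := M)).comp
        ((h0.comp contMDiff_fst).prodMk (h1.comp contMDiff_snd))⟩

/-- A vector field on `M³`, viewed as a vector field on `Ω`. -/
def liftField (X : VF M) : VFOm M :=
  ⟨fun q => ((0, X q.2) : EuclideanSpace ℝ (Fin 1) × EuclideanSpace ℝ (Fin 3)), by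
    have h0 : ContMDiff (𝓡∂ 1) (𝓡∂ 1).tangent ∞ (fun t : EuclideanHalfSpace 1 =>
        (⟨t, 0⟩ : TangentBundle (𝓡∂ 1) (EuclideanHalfSpace 1))) := 
      Bundle.contMDiff_zeroSection ℝ (TangentSpace (𝓡∂ 1) : EuclideanHalfSpace 1 → Type _)
    exact (contMDiff_equivTangentBundleProd_symm (I := 𝓡∂ 1) (I' := 𝓡 3)
      (M := EuclideanHalfSpace 1) (M' := M)).comp
        ((h0.comp contMDiff_fst).prodMk (X.contMDiff.comp contMDiff_snd))⟩

/-- Three vector fields constitute a frame of `TM³`. -/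
def IsFrame (D : Fin 3 → VF M) : Prop :=
  ∀ x, LinearIndependent ℝ (fun i => (D i x : TangentSpace (𝓡 3) x))

/-- The basis of the tangent space at `x` given by a frame. -/
def frameBasis {D : Fin 3 → VF M} (hD : IsFrame D) (x : M) :
    Module.Basis (Fin 3) ℝ (TangentSpace (𝓡 3) x) :=
  basisOfLinearIndependentOfCardEqFinrank (hD x)
    (finrank_euclideanSpace_fin (𝕜 := ℝ) (n := 3)).symm

theorem frameBasis_apply {D : Fin 3 → VF M} (hD : IsFrame D) (x : M) (i : Fin 3) :
    frameBasis hD x i = D i x := by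
  exact congrFun (coe_basisOfLinearIndependentOfCardEqFinrank _ _) i

/-- The coefficients of a smooth vector field in a smooth frame are smooth. -/
theorem contMDiff_frameCoeff {D : Fin 3 → VF M} (hD : IsFrame D)
    {V : Π x : M, TangentSpace (𝓡 3) x}
    (hV : ContMDiff (𝓡 3) (𝓡 3).tangent ∞ (fun x => (⟨x, V x⟩ : TangentBundle (𝓡 3) M)))
    (k : Fin 3) :
    ContMDiff (𝓡 3) 𝓘(ℝ, ℝ) ∞ (fun x => (frameBasis hD x).repr (V x) k) := by
  intro x₀
  set e := trivializationAt (EuclideanSpace ℝ (Fin 3)) (TangentSpace (𝓡 3) : M → Type _) x₀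
  let b : Module.Basis (Fin 3) ℝ (EuclideanSpace ℝ (Fin 3)) :=
    (EuclideanSpace.basisFun (Fin 3) ℝ).toBasis
  have hx₀ : x₀ ∈ e.baseSet := FiberBundle.mem_baseSet_trivializationAt' x₀
  let A : M → Matrix (Fin 3) (Fin 3) ℝ := fun x => Matrix.of fun i j => e.localFrameCoeff (𝓡 3) b i x (D j x)
  let w : M → Fin 3 → ℝ := fun x i => e.localFrameCoeff (𝓡 3) b i x (V x)
  have hA : ∀ i j, ContMDiffAt (𝓡 3) 𝓘(ℝ, ℝ) ∞ (fun x => A x i j) x₀ := fun i j =>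
    contMDiffAt_localFrameCoeff (e := e) (I := 𝓡 3) b hx₀ ((D j).contMDiff x₀) i
  have hw : ∀ i, ContMDiffAt (𝓡 3) 𝓘(ℝ, ℝ) ∞ (fun x => w x i) x₀ := fun i =>
    contMDiffAt_localFrameCoeff (e := e) (I := 𝓡 3) b hx₀ (hV x₀) i
  have hdet : ∀ B : M → Matrix (Fin 3) (Fin 3) ℝ,
      (∀ i j, ContMDiffAt (𝓡 3) 𝓘(ℝ, ℝ) ∞ (fun x => B x i j) x₀) →
      ContMDiffAt (𝓡 3) 𝓘(ℝ, ℝ) ∞ (fun x => (B x).det) x₀ := by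
    intro B hB
    simp only [Matrix.det_fin_three]
    exact ((((((hB 0 0).mul (hB 1 1)).mul (hB 2 2)).sub
      (((hB 0 0).mul (hB 1 2)).mul (hB 2 1))).sub
      (((hB 0 1).mul (hB 1 0)).mul (hB 2 2))).add
      (((hB 0 1).mul (hB 1 2)).mul (hB 2 0))).add
      (((hB 0 2).mul (hB 1 0)).mul (hB 2 1)) |>.sub
      (((hB 0 2).mul (hB 1 1)).mul (hB 2 0))
  have hcoe : ∀ x ∈ e.baseSet, ∀ u : TangentSpace (𝓡 3) x,
      (∀ i, e.localFrameCoeff (𝓡 3) b i x u = 0) → u = 0 := by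
    classical
    intro x hx u hu
    have h := e.eq_sum_localFrameCoeff_smul (I := 𝓡 3) (b := b) (s := fun y => if h : y = x then h ▸ u else 0) hx
    simpa [hu] using h
  have hdet0 : ∀ x ∈ e.baseSet, (A x).det ≠ 0 := by
    intro x hx h0
    obtain ⟨v, hv, hv0⟩ := Matrix.exists_mulVec_eq_zero_iff.2 h0
    refine hv ?_
    have : ∑ j, v j • (D j x : TangentSpace (𝓡 3) x) = 0 := by
      refine hcoe x hx _ fun i => ?_
      have := congrFun hv0 i
      simpa [A, Matrix.mulVec, dotProduct, mul_comm] using this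
    exact funext (Fintype.linearIndependent_iff.1 (hD x) v this)
  have key : ∀ x ∈ e.baseSet, (frameBasis hD x).repr (V x) k
      = ((A x).updateCol k (w x)).det * ((A x).det)⁻¹ := by
    intro x hx
    have h1 : w x = (A x).mulVec (fun j => (frameBasis hD x).repr (V x) j) := by
      ext i
      have := (frameBasis hD x).sum_repr (V x)
      simp only [w]
      conv_lhs => rw [← this]
      simp [A, Matrix.mulVec, dotProduct, frameBasis_apply, mul_comm]
    have h2 : (A x).cramer (w x) k = (A x).det * (frameBasis hD x).repr (V x) k := by
      rw [Matrix.cramer_eq_adjugate_mulVec, h1, Matrix.mulVec_mulVec, Matrix.adjugate_mul]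
      simp [Matrix.smul_mulVec]
    rw [← Matrix.cramer_apply, h2, mul_comm, inv_mul_cancel_left₀ (hdet0 x hx)]
  have hfin : ContMDiffAt (𝓡 3) 𝓘(ℝ, ℝ) ∞
      (fun x => ((A x).updateCol k (w x)).det * ((A x).det)⁻¹) x₀ := by
    refine ContMDiffAt.mul (hdet _ fun i j => ?_) ((hdet A hA).inv₀ (hdet0 x₀ hx₀))
    by_cases hj : j = k
    · subst hj; simpa using hw i
    · simpa [Matrix.updateCol_ne hj] using hA i j
  refine hfin.congr_of_eventuallyEq ?_
  filter_upwards [e.open_baseSet.mem_nhds hx₀] with x hx using key x hx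

/-- The structure functions `c_{ij}^k` of a frame: `[D_i, D_j] = ∑ₖ c_{ij}^k D_k`. -/
def structureFun {D : Fin 3 → VF M} (hD : IsFrame D) (i j k : Fin 3) : CM M :=
  ⟨fun x => (frameBasis hD x).repr (VectorField.mlieBracket (𝓡 3) (D i) (D j) x) k,
    contMDiff_frameCoeff hD (fun x => by
      have : IsManifold (𝓡 3) (((⊤ : ℕ∞) : WithTop ℕ∞) + 1) M := by simpa using ‹IsManifold (𝓡 3) ∞ M›
      have : IsManifold (𝓡 3) (minSmoothness ℝ 2) M := by
        rw [minSmoothness_of_isRCLikeNormedField]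
        exact IsManifold.of_le (m := 2) (n := ∞) (WithTop.coe_le_coe.2 (le_top : (2 : ℕ∞) ≤ ⊤))
      exact ContMDiffAt.mlieBracket_vectorField (m := ⊤) (n := ⊤) ((D i).contMDiff x) ((D j).contMDiff x) (by simp)) k⟩

/-- `∂₀` as a derivation of `C^∞(Ω)`. -/
def del0 : Derivation ℝ (COm M) (COm M) := vfDerivation IOm d0Field

/-- A vector field on `M³` as a derivation of `C^∞(Ω)`. -/
def lift (X : VF M) : Derivation ℝ (COm M) (COm M) := vfDerivation IOm (liftField X)

/-- `X(f)` for `X ∈ Γ(TM³)` and `f ∈ C^∞(M³)`. -/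
def lie (X : VF M) (f : CM M) : CM M := vfDerivation (𝓡 3) X f

/-- Nondegeneracy: the frame of `x` (at `s₁ = s₂ = s₃ = 1`) is an isomorphism `T^*Ω ≅ W`, that is,
the four tangent vectors `V_a` are linearly independent at every point of the four-dimensional
`Ω`. -/
def IsNondegenerate (x : Series (E1 (COm M))) : Prop :=
  ∀ q : Om M, LinearIndependent ℝ fun a => Derivation.evalAt q (frameOf (setOne x) a)

/-- `MC(𝓐)_gauged`, where `L` is the fixed frame of `TM³`. -/
def MCgauged (L : Fin 3 → VF M) : Set (Series (E1 (COm M))) :=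
  {x | x ∈ MCA (COm M) ∧ x ∈ affineGauged del0 (fun l => lift (L l)) ∧
    IsNondegenerate x ∧ IsExact x}

variable (M) in
/-- Tuples `(D₁, D₂, D₃, p₁, p₂, p₃, p₀, ζ, χ)` on `M³` with `D₁, D₂, D₃` a frame. -/
structure Data where
  /-- The vector fields `D₁, D₂, D₃`. -/
  D : Fin 3 → VF M
  frame : IsFrame D
  /-- The functions `p₁, p₂, p₃`. -/
  p : Fin 3 → CM M
  p0 : CM M
  zeta : CM M
  chi : CM M

namespace Data

/-- The structure functions of `D₁, D₂, D₃`. -/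
def c (T : Data M) (i j k : Fin 3) : CM M := structureFun T.frame i j k

/-- The constraint equations. -/
def Constraints (T : Data M) : Prop :=
  (0 = 3 * T.p0 ^ 2 - T.p 1 * T.p 2 - T.p 2 * T.p 0 - T.p 0 * T.p 1) ∧
  ∀ i j k : Fin 3, j = i + 1 → k = i + 2 →
    0 = -((1 / 2 : ℝ) • lie (T.D i) (T.p j + T.p k))
      - (1 / 2 : ℝ) • (T.c i j j * (T.p i - T.p j))
      + (1 / 2 : ℝ) • (T.c k i k * (T.p i - T.p k))
      + T.p i * lie (T.D i) T.zeta
      + 3 * T.p0 * lie (T.D i) T.chi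

/-- `e^{-p_i τ}`. -/
def decay (T : Data M) (i : Fin 3) : COm M := expOm (-(pull (T.p i) * tau))

/-- The coefficient of `s⁰`. -/
def term000 (T : Data M) : E1 (COm M) :=
  (th 0 (ofDer del0), 0) + pull T.p0 • (0, Pi.single 0 1)
    + ∑ i : Fin 3, pull (T.p i) • (th 0 sigma0 + th i.succ (boost i), 0)

/-- The coefficient of `s_i²`. -/
def term200 (T : Data M) (i j k : Fin 3) : E1 (COm M) :=
  ((1 / 2 : ℝ) • (T.decay i ^ 2 * pull (T.c j k i))) •
    (th i.succ (rot i) - th j.succ (rot j) - th k.succ (rot k), 0)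

/-- The coefficient of `s_j s_k`. -/
def term011 (T : Data M) (i j k : Fin 3) : E1 (COm M) :=
  (T.decay j * T.decay k) •
    ((th i.succ (ofDer (lift (T.D i))), 0)
      - (pull (lie (T.D i) T.zeta) - tau * pull (lie (T.D i) (T.p 0 + T.p 1 + T.p 2))) •
          (th 0 (boost i) + th i.succ sigma0, 0)
      + (pull (lie (T.D i) T.zeta) + pull (T.c k i k) - tau * pull (lie (T.D i) (T.p k))) •
          (th k.succ (rot j), 0)
      - (pull (lie (T.D i) T.zeta) - pull (T.c i j j) - tau * pull (lie (T.D i) (T.p j))) •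
          (th j.succ (rot k), 0)
      + (pull (lie (T.D i) T.chi) + tau * pull (lie (T.D i) T.p0)) •
          (0, Pi.single i.succ 1))

/-- The explicit element of `𝓐¹` associated to a tuple. -/
def element (T : Data M) : Series (E1 (COm M)) :=
  Pi.single 0 T.term000
    + ∑ i : Fin 3, (Pi.single (dg200 i) (T.term200 i (i + 1) (i + 2))
      + Pi.single (dg011 i) (T.term011 i (i + 1) (i + 2)))

/-- Two tuples agree up to additive constants in `ζ` and `χ`. -/
def SameUpToConstants (T T' : Data M) : Prop :=
  T'.D = T.D ∧ T'.p = T.p ∧ T'.p0 = T.p0 ∧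
    (∃ a : ℝ, ∀ x, T'.zeta x = T.zeta x + a) ∧ (∃ b : ℝ, ∀ x, T'.chi x = T.chi x + b)

end Data

end Manifold

end BKL

end

/-! After gauge fixing, an element of `affineGauged` is a list of coefficients (`Gauge`): functions
p, n, w, a, b, q, f, the derivation d0 and three derivations V, each living in one fixed degree of
s. The proof first turns [x, x] = 0 in 𝓐 into a finite system for these coefficients
(`Gauge.Equations`), then solves that system.

For the first half: a power series lies in s𝓟² exactly when its coefficient at every γ lies in the
sum of the G_β with β < γ (`mem_sRees2_iff`). To test this, 𝓔² gets a basis adapted to the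
filtration, with coordinate functionals `fZ`, `fE`, `fN`, ... modulo 𝓘². The coordinate of a
generator of degree δ matters at γ only if δ is not < γ. Every product that occurs in this
coordinate of the bracket has degree at least δ, so only products of degree exactly δ survive
(`single_dgc`). This is the BKL truncation: curvature and gradient terms leave the Hamiltonian
equation, and the off-diagonal evolution equations become empty.

What remains says: p and f do not depend on τ; [∂₀, V_i] = -(p_j + p_k)V_i; the commutators [V_j,
V_k] are given by n, a, b, w (vanishing torsion); n, w, a, b, q satisfy linear evolution equations;
w and q satisfy curl equations; a Jacobi type identity holds; and there are one Hamiltonian and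
three momentum equations.

For a tuple, almost all of this is automatic. The torsion equation is the commutator of the D_i with
the exponential factors carried along (`Tuple.Rules.lieV`). The curl equations are this commutator
applied to the potentials τ(p₁+p₂+p₃) - ζ and τp₀ + χ, which also show exactness. The Jacobi type
identity is a component of the Jacobi identity for V (`LieV.jacobi`), and the evolution equations
are derivatives in τ. The momentum equation equals a nonvanishing factor times minus twice the
momentum constraint minus τ times the D_i derivative of the Hamiltonian constraint (`momentum_eq`),
so exactly the constraints are left.

Conversely, given a solution, p and f come from M, e^{(p_j+p_k)τ}V_i has coefficients constant in τ
and hence is a field D_i on M, and subtracting the linear growth in τ from the potentials of the two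
exact forms yields ζ and χ. Then w and q agree with those of the tuple, and vanishing torsion leaves
no freedom for n, a, b (`Gauge.eq_of_lieV`), so the solution is the element of the tuple
(`exists_data`). Only the derivatives of ζ and χ along the frame enter, so on connected M they are
determined up to constants.

The algebra is done over an arbitrary commutative real algebra. Geometry enters through the rules
collected in `Tuple.Rules`, the fact that a function killed by ∂₀ comes from M, and the separation
of tangent vectors by smooth functions. -/

noncomputable section

namespace BKL

section Algebra

set_option linter.unusedSectionVars false

/-! ### Cyclic arithmetic of spatial indices -/

@[simp] theorem fin3_add_one_add_one (i : Fin 3) : i + 1 + 1 = i + 2 := by revert i; decide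
@[simp] theorem fin3_add_one_add_two (i : Fin 3) : i + 1 + 2 = i := by revert i; decide
@[simp] theorem fin3_add_two_add_one (i : Fin 3) : i + 2 + 1 = i := by revert i; decide
@[simp] theorem fin3_add_two_add_two (i : Fin 3) : i + 2 + 2 = i + 1 := by revert i; decide
@[simp] theorem fin3_add_one_ne (i : Fin 3) : i + 1 ≠ i := by revert i; decide
@[simp] theorem fin3_add_two_ne (i : Fin 3) : i + 2 ≠ i := by revert i; decide
@[simp] theorem fin3_ne_add_one (i : Fin 3) : i ≠ i + 1 := by revert i; decide
@[simp] theorem fin3_ne_add_two (i : Fin 3) : i ≠ i + 2 := by revert i; decide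
@[simp] theorem fin3_add_one_ne_add_two (i : Fin 3) : i + 1 ≠ i + 2 := by revert i; decide
@[simp] theorem fin3_add_two_ne_add_one (i : Fin 3) : i + 2 ≠ i + 1 := by revert i; decide

theorem fin3_sum_cyclic {X : Type*} [AddCommMonoid X] (f : Fin 3 → X) (i : Fin 3) :
    ∑ m, f m = f i + f (i + 1) + f (i + 2) := by
  rw [Fin.sum_univ_three]
  fin_cases i
  · rfl
  · exact (add_assoc _ _ _).trans (add_comm _ _)
  · exact (add_comm _ _).trans (add_assoc _ _ _).symm

theorem fin4_sum_cyclic {X : Type*} [AddCommMonoid X] (f : Fin 4 → X) (i : Fin 3) :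
    ∑ m, f m = f 0 + (f i.succ + f (i + 1).succ + f (i + 2).succ) := by
  rw [Fin.sum_univ_succ, fin3_sum_cyclic (fun m => f m.succ) i]

theorem fin3_forall_cyclic {P : Fin 3 → Prop} (i : Fin 3) (h0 : P i) (h1 : P (i + 1))
    (h2 : P (i + 2)) : ∀ m, P m := by
  intro m
  have : m = i ∨ m = i + 1 ∨ m = i + 2 := by clear h0 h1 h2; revert m i; decide
  rcases this with rfl | rfl | rfl <;> assumption

variable {R : Type*} [CommRing R] [Algebra ℝ R]

/-- 2 is invertible because `R` is a real algebra; no other property of C^∞(Ω) is needed in the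
algebraic part. -/
theorem eq_zero_of_add_self {x : R} (h : x + x = 0) : x = 0 := by
  have : (2⁻¹ : ℝ) • (x + x) = x := by
    rw [← two_smul ℝ x, smul_smul]; norm_num
  rw [← this, h, smul_zero]

/-! ### Coordinates on `CDer(W)` -/

/-- The `σ₀` coordinate. -/
def sC : CDer R →ₗ[R] R where
  toFun d := d.1.1 0 0
  map_add' _ _ := rfl
  map_smul' _ _ := rfl

/-- The `σ_i` coordinate. -/
def bC (i : Fin 3) : CDer R →ₗ[R] R where
  toFun d := d.1.1 0 i.succ
  map_add' _ _ := rfl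
  map_smul' _ _ := rfl

/-- The `σ_{jk}` coordinate. -/
def rC (i : Fin 3) : CDer R →ₗ[R] R where
  toFun d := d.1.1 (i + 1).succ (i + 2).succ
  map_add' _ _ := rfl
  map_smul' _ _ := rfl

/-- The component in `Der(C^∞)`. -/
def dC : CDer R →ₗ[R] Derivation ℝ R R where
  toFun d := d.1.2
  map_add' _ _ := rfl
  map_smul' _ _ := rfl

theorem sC_apply (d : CDer R) : sC d = d.1.1 0 0 := rfl

theorem bC_apply (i : Fin 3) (d : CDer R) : bC i d = d.1.1 0 i.succ := rfl

theorem rC_apply (i : Fin 3) (d : CDer R) : rC i d = d.1.1 (i + 1).succ (i + 2).succ := rfl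

theorem conf_single_right (w : Fin 4 → R) (a : Fin 4) :
    conf w (Pi.single a 1) = eta R a * w a := by
  simp [conf, Pi.single_apply]

theorem act_single (d : Der0 R) (a b : Fin 4) : act d (Pi.single a 1) b = d.1 b a := by
  by_cases h : b = a <;> simp [act, Pi.single_apply, h]

/-- The conformal identity is evaluated on two basis vectors, whose inner product is constant. The
matrix therefore lies in the Lorentz algebra plus multiples of the identity, and all relations
between entries below come from here. -/
theorem entry_relation (d : CDer R) : ∃ f : R, ∀ a b,
    0 = eta R b * d.1.1 b a + eta R a * d.1.1 a b + if a = b then f * eta R a else 0 := by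
  obtain ⟨f, hf⟩ := d.2
  refine ⟨f, fun a b => ?_⟩
  have h := hf (Pi.single a 1) (Pi.single b 1)
  rw [conf_single_right, conf_single_right, conf_comm, conf_single_right, act_single,
    act_single] at h
  by_cases hab : a = b
  · subst hab
    have e : d.1.2 (eta R a) = 0 := by
      fin_cases a <;> simp [eta]
    simpa [e] using h
  · simpa [hab] using h

theorem eta_zero : eta R 0 = -1 := rfl
theorem eta_succ (i : Fin 3) : eta R i.succ = 1 := by fin_cases i <;> rfl

theorem entry_zero_zero (d : CDer R) : d.1.1 0 0 = sC d := rfl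

theorem entry_zero_succ (d : CDer R) (i : Fin 3) : d.1.1 0 i.succ = bC i d := rfl

theorem entry_diag (d : CDer R) (i : Fin 3) : d.1.1 i.succ i.succ = sC d := by
  obtain ⟨f, hf⟩ := entry_relation d
  have h0 := hf 0 0
  have h1 := hf i.succ i.succ
  simp only [eta_zero, eta_succ, if_true] at h0 h1
  refine sub_eq_zero.1 (eq_zero_of_add_self ?_)
  change _ - d.1.1 0 0 + (_ - d.1.1 0 0) = 0
  linear_combination -h0 - h1

theorem entry_succ_zero (d : CDer R) (i : Fin 3) : d.1.1 i.succ 0 = bC i d := by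
  obtain ⟨f, hf⟩ := entry_relation d
  have h0 := hf 0 i.succ
  rw [if_neg (Fin.succ_ne_zero i).symm, eta_zero, eta_succ] at h0
  change _ = d.1.1 0 i.succ
  linear_combination -h0

theorem entry_rot (d : CDer R) (i : Fin 3) : d.1.1 (i + 1).succ (i + 2).succ = rC i d := rfl

theorem entry_rot_swap (d : CDer R) (i : Fin 3) :
    d.1.1 (i + 2).succ (i + 1).succ = -rC i d := by
  obtain ⟨f, hf⟩ := entry_relation d
  have h0 := hf (i + 1).succ (i + 2).succ
  rw [if_neg (by simp), eta_succ, eta_succ] at h0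
  change _ = -d.1.1 (i + 1).succ (i + 2).succ
  linear_combination -h0

theorem entry_add_one (d : CDer R) (i : Fin 3) : d.1.1 i.succ (i + 1).succ = rC (i + 2) d := by
  simpa using entry_rot d (i + 2)

theorem entry_add_one_swap (d : CDer R) (i : Fin 3) :
    d.1.1 (i + 1).succ i.succ = -rC (i + 2) d := by
  simpa using entry_rot_swap d (i + 2)

theorem entry_add_two (d : CDer R) (i : Fin 3) : d.1.1 i.succ (i + 2).succ = -rC (i + 1) d := by
  simpa using entry_rot_swap d (i + 1)

theorem entry_add_two_swap (d : CDer R) (i : Fin 3) :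
    d.1.1 (i + 2).succ i.succ = rC (i + 1) d := by
  simpa using entry_rot d (i + 1)

/-- The entry relations make the diagonal constant, the boosts symmetric and the rotations
antisymmetric, so seven functions and a derivation of `R` are a full set of coordinates on CDer(W).
-/
theorem CDer.ext_coord {d d' : CDer R} (hs : sC d = sC d') (hb : ∀ i, bC i d = bC i d')
    (hr : ∀ i, rC i d = rC i d') (hd : dC d = dC d') : d = d' := by
  refine Subtype.ext (Prod.ext ?_ hd)
  ext a b
  refine Fin.cases ?_ (fun i => ?_) a
  · refine Fin.cases hs (fun j => hb j) b
  · refine Fin.cases ?_ (fun j => ?_) b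
    · rw [entry_succ_zero, entry_succ_zero, hb]
    · revert j
      refine fin3_forall_cyclic i ?_ ?_ ?_
      · rw [entry_diag, entry_diag, hs]
      · rw [entry_add_one, entry_add_one, hr]
      · rw [entry_add_two, entry_add_two, hr]

@[simp] theorem sC_sigma0 : sC (sigma0 : CDer R) = 1 := rfl
@[simp] theorem bC_sigma0 (i : Fin 3) : bC i (sigma0 : CDer R) = 0 := by
  simp [bC_apply, sigma0, (Fin.succ_ne_zero i).symm]
@[simp] theorem rC_sigma0 (i : Fin 3) : rC i (sigma0 : CDer R) = 0 := by
  simp [rC_apply, sigma0]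
@[simp] theorem dC_sigma0 : dC (sigma0 : CDer R) = 0 := rfl
@[simp] theorem sC_ofDer (v : Derivation ℝ R R) : sC (ofDer v) = 0 := rfl
@[simp] theorem bC_ofDer (i : Fin 3) (v : Derivation ℝ R R) : bC i (ofDer v) = 0 := rfl
@[simp] theorem rC_ofDer (i : Fin 3) (v : Derivation ℝ R R) : rC i (ofDer v) = 0 := rfl
@[simp] theorem dC_ofDer (v : Derivation ℝ R R) : dC (ofDer v) = v := rfl
theorem sC_sigma (a b : Fin 4) : sC (sigma a b : CDer R) = 0 := by
  by_cases ha : a = 0 <;> by_cases hb : b = 0 <;> simp [sC_apply, sigma, ha, hb]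
@[simp] theorem dC_sigma (a b : Fin 4) : dC (sigma a b : CDer R) = 0 := rfl
@[simp] theorem sC_boost (i : Fin 3) : sC (boost i : CDer R) = 0 := sC_sigma _ _
@[simp] theorem sC_rot (i : Fin 3) : sC (rot i : CDer R) = 0 := sC_sigma _ _
@[simp] theorem dC_boost (i : Fin 3) : dC (boost i : CDer R) = 0 := rfl
@[simp] theorem dC_rot (i : Fin 3) : dC (rot i : CDer R) = 0 := rfl
theorem bC_boost (i j : Fin 3) : bC i (boost j : CDer R) = if i = j then 1 else 0 := by
  by_cases h : i = j <;> simp [bC_apply, boost, sigma, h, eta_succ, eq_comm]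
@[simp] theorem rC_boost (i j : Fin 3) : rC i (boost j : CDer R) = 0 := by
  simp [rC_apply, boost, sigma, (Fin.succ_ne_zero _).symm]
@[simp] theorem bC_rot (i j : Fin 3) : bC i (rot j : CDer R) = 0 := by
  simp [bC_apply, rot, sigma]
theorem rC_rot (i j : Fin 3) : rC i (rot j : CDer R) = if i = j then 1 else 0 := by
  revert j
  refine fin3_forall_cyclic i ?_ ?_ ?_ <;> simp [rC_apply, rot, sigma, eta_succ]
@[simp] theorem bC_boost_self (i : Fin 3) : bC i (boost i : CDer R) = 1 := by simp [bC_boost]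
@[simp] theorem rC_rot_self (i : Fin 3) : rC i (rot i : CDer R) = 1 := by simp [rC_rot]

/-- The element of `CDer(W)` with the given coordinates. -/
def mkC (s : R) (b r : Fin 3 → R) (v : Derivation ℝ R R) : CDer R :=
  s • sigma0 + ∑ i, b i • boost i + ∑ i, r i • rot i + ofDer v

@[simp] theorem sC_mkC (s : R) (b r : Fin 3 → R) (v : Derivation ℝ R R) :
    sC (mkC s b r v) = s := by simp [mkC]
@[simp] theorem bC_mkC (s : R) (b r : Fin 3 → R) (v : Derivation ℝ R R) (i : Fin 3) :
    bC i (mkC s b r v) = b i := by simp [mkC, bC_boost]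
@[simp] theorem rC_mkC (s : R) (b r : Fin 3 → R) (v : Derivation ℝ R R) (i : Fin 3) :
    rC i (mkC s b r v) = r i := by simp [mkC, rC_rot]
@[simp] theorem dC_mkC (s : R) (b r : Fin 3 → R) (v : Derivation ℝ R R) :
    dC (mkC s b r v) = v := by simp [mkC]

theorem mkC_coord (d : CDer R) : d = mkC (sC d) (fun i => bC i d) (fun i => rC i d) (dC d) :=
  CDer.ext_coord (by simp) (by simp) (by simp) (by simp)

theorem entry_bracket (x y : CDer R) (a b : Fin 4) : (⁅x, y⁆ : CDer R).1.1 a b =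
    ∑ c, x.1.1 a c * y.1.1 c b - ∑ c, y.1.1 a c * x.1.1 c b + dC x (y.1.1 a b)
      - dC y (x.1.1 a b) := by
  change (x.1.1 * y.1.1 - y.1.1 * x.1.1 + y.1.1.map x.1.2 - x.1.1.map y.1.2) a b = _
  simp [Matrix.mul_apply, dC]

theorem dC_bracket (x y : CDer R) : dC ⁅x, y⁆ = ⁅dC x, dC y⁆ := rfl

theorem sC_bracket (x y : CDer R) : sC ⁅x, y⁆ = dC x (sC y) - dC y (sC x) := by
  change (⁅x, y⁆ : CDer R).1.1 0 0 = _
  rw [entry_bracket, fin4_sum_cyclic _ 0, fin4_sum_cyclic _ 0]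
  simp only [entry_zero_zero, entry_zero_succ, entry_succ_zero]
  ring

/-- The Lorentz relations in cyclic form: boost with rotation gives boost here, and boost with boost
or rotation with rotation gives rotation in `rC_bracket`. The σ₀ coordinates cancel because the
identity matrix is central. -/
theorem bC_bracket (x y : CDer R) (i : Fin 3) : bC i ⁅x, y⁆ =
    dC x (bC i y) - dC y (bC i x) - bC (i + 1) x * rC (i + 2) y + bC (i + 2) x * rC (i + 1) y
      + bC (i + 1) y * rC (i + 2) x - bC (i + 2) y * rC (i + 1) x := by
  change (⁅x, y⁆ : CDer R).1.1 0 i.succ = _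
  rw [entry_bracket, fin4_sum_cyclic _ i, fin4_sum_cyclic _ i]
  simp only [entry_zero_zero, entry_zero_succ, entry_diag, entry_add_one_swap, entry_add_two_swap]
  ring

theorem rC_bracket (x y : CDer R) (i : Fin 3) : rC i ⁅x, y⁆ =
    dC x (rC i y) - dC y (rC i x) + bC (i + 1) x * bC (i + 2) y - bC (i + 1) y * bC (i + 2) x
      + rC (i + 2) x * rC (i + 1) y - rC (i + 2) y * rC (i + 1) x := by
  change (⁅x, y⁆ : CDer R).1.1 (i + 1).succ (i + 2).succ = _
  rw [entry_bracket, fin4_sum_cyclic _ i, fin4_sum_cyclic _ i]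
  simp only [entry_zero_succ, entry_succ_zero, entry_diag, entry_add_one_swap, entry_add_two,
    entry_rot]
  ring

end Algebra

section Algebra

set_option linter.unusedSectionVars false

variable {R : Type*} [CommRing R] [Algebra ℝ R]

/-! ### Coordinates on `∧²W` -/

section Pairs

variable {X : Type*} [AddCommGroup X] [Module R X]

/-- The antisymmetric component of a family indexed by `a < b`. -/
def comp (R : Type*) [CommRing R] {X : Type*} [AddCommGroup X] [Module R X] (a b : Fin 4) :
    (Pairs → X) →ₗ[R] X where
  toFun y := (if h : a < b then y ⟨(a, b), h⟩ else 0) - (if h : b < a then y ⟨(b, a), h⟩ else 0)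
  map_add' y z := by
    rcases lt_trichotomy a b with h | h | h
    · simp [h, h.not_gt]
    · simp [h]
    · simp [h, h.not_gt]; abel
  map_smul' r y := by
    rcases lt_trichotomy a b with h | h | h
    · simp [h, h.not_gt]
    · simp [h]
    · simp [h, h.not_gt]

theorem comp_wedge (a b : Fin 4) (z : Fin 4 → Fin 4 → X) :
    comp R a b (wedge z) = z a b - z b a := by
  change (if h : a < b then wedge z ⟨(a, b), h⟩ else 0)
    - (if h : b < a then wedge z ⟨(b, a), h⟩ else 0) = _
  rcases lt_trichotomy a b with h | h | h
  · simp [h, h.not_gt, wedge]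
  · simp [h]
  · simp [h, h.not_gt, wedge]

/-- The coefficient of `θ₀θ_i`. -/
def eC (R : Type*) [CommRing R] {X : Type*} [AddCommGroup X] [Module R X] (i : Fin 3) :
    (Pairs → X) →ₗ[R] X := comp R 0 i.succ

/-- The coefficient of `θ_jθ_k`. -/
def hC (R : Type*) [CommRing R] {X : Type*} [AddCommGroup X] [Module R X] (i : Fin 3) :
    (Pairs → X) →ₗ[R] X := comp R (i + 1).succ (i + 2).succ

theorem eC_wedge (i : Fin 3) (z : Fin 4 → Fin 4 → X) :
    eC R i (wedge z) = z 0 i.succ - z i.succ 0 := comp_wedge _ _ _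

theorem hC_wedge (i : Fin 3) (z : Fin 4 → Fin 4 → X) : hC R i (wedge z) =
    z (i + 1).succ (i + 2).succ - z (i + 2).succ (i + 1).succ := comp_wedge _ _ _

-- The six coefficients of θ₀θ_i and θ_jθ_k are all the coordinates. One of the cyclic products,
-- θ₃θ₁, is stored with the opposite orientation; this is why `comp` is antisymmetrized and why a
-- sign is cancelled in the last case.
variable (R) in
theorem pairs_ext {y y' : Pairs → X} (he : ∀ i, eC R i y = eC R i y')
    (hh : ∀ i, hC R i y = hC R i y') : y = y' := by
  have key : ∀ (a b : Fin 4) (h : a < b), y ⟨(a, b), h⟩ = y' ⟨(a, b), h⟩ := by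
    intro a b h
    have e : ∀ z : Pairs → X, comp R a b z = z ⟨(a, b), h⟩ := fun z => by
      simp [comp, h, h.not_gt]
    have e' : ∀ z : Pairs → X, comp R b a z = -z ⟨(a, b), h⟩ := fun z => by
      simp [comp, h, h.not_gt]
    rw [← e y, ← e y']
    refine Fin.cases (fun h e e' => ?_) (fun i h e e' => ?_) a h e e'
    · refine Fin.cases (fun h => absurd h (lt_irrefl _)) (fun j h e e' => he j) b h e e'
    · refine Fin.cases (fun h => absurd h (by simp)) (fun j h e e' => ?_) b h e e'
      revert j
      refine fin3_forall_cyclic i ?_ ?_ ?_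
      · exact fun h => absurd h (lt_irrefl _)
      · intro h e e'
        have := hh (i + 2)
        simpa [hC] using this
      · intro h e e'
        have := hh (i + 1)
        simp only [hC, fin3_add_one_add_one, fin3_add_one_add_two] at this
        rw [e' y, e' y'] at this
        rw [e y, e y']
        exact neg_injective this
  ext ⟨⟨a, b⟩, h⟩
  exact key a b h

/-- The element `θ₀θ_i δ`. -/
def eL (R : Type*) [CommRing R] {X : Type*} [AddCommGroup X] [Module R X] (i : Fin 3) :
    X →ₗ[R] (Pairs → X) where
  toFun δ := wedge (Pi.single 0 (Pi.single i.succ δ))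
  map_add' x y := by ext; simp [wedge, Pi.single_add]; abel
  map_smul' x y := by ext; simp [wedge, Pi.single_smul', smul_sub]

/-- The element `θ_jθ_k δ`. -/
def hL (R : Type*) [CommRing R] {X : Type*} [AddCommGroup X] [Module R X] (i : Fin 3) :
    X →ₗ[R] (Pairs → X) where
  toFun δ := wedge (Pi.single (i + 1).succ (Pi.single (i + 2).succ δ))
  map_add' x y := by ext; simp [wedge, Pi.single_add]; abel
  map_smul' x y := by ext; simp [wedge, Pi.single_smul', smul_sub]

theorem eC_eL (i m : Fin 3) (x : X) : eC R i (eL R m x) = if i = m then x else 0 := by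
  change eC R i (wedge _) = _
  rw [eC_wedge]
  by_cases h : i = m <;> simp [h]

theorem hC_eL (i m : Fin 3) (x : X) : hC R i (eL R m x) = 0 := by
  change hC R i (wedge _) = _
  rw [hC_wedge]
  simp

theorem eC_hL (i m : Fin 3) (x : X) : eC R i (hL R m x) = 0 := by
  change eC R i (wedge _) = _
  rw [eC_wedge]
  by_cases h : i = m + 1 <;> simp [h, (Fin.succ_ne_zero _).symm]

theorem hC_hL (i m : Fin 3) (x : X) : hC R i (hL R m x) = if i = m then x else 0 := by
  change hC R i (wedge _) = _
  rw [hC_wedge]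
  revert m
  refine fin3_forall_cyclic i ?_ ?_ ?_ <;> simp

@[simp] theorem eC_eL_self (i : Fin 3) (x : X) : eC R i (eL R i x) = x := by simp [eC_eL]
@[simp] theorem hC_hL_self (i : Fin 3) (x : X) : hC R i (hL R i x) = x := by simp [hC_hL]

variable (R) in
theorem pairs_decomp (y : Pairs → X) :
    y = ∑ i, (eL R i (eC R i y) + hL R i (hC R i y)) :=
  pairs_ext R (by simp [eC_eL, eC_hL]) (by simp [hC_eL, hC_hL])

end Pairs

theorem th2_succ_succ (i : Fin 3) (δ : CDer R) :
    th2 (i + 1).succ (i + 2).succ δ = hL R i δ := rfl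

theorem th2_add_one (i : Fin 3) (δ : CDer R) :
    th2 i.succ (i + 1).succ δ = hL R (i + 2) δ := by
  simp [← th2_succ_succ]

theorem wedge_single_zero (x : L1 R) :
    wedge (Pi.single 0 x) = ∑ i, eL R i (x i.succ) := by
  refine pairs_ext R (fun i => ?_) (fun i => ?_)
  · rw [eC_wedge]
    simp [eC_eL]
  · rw [hC_wedge]
    simp [hC_eL]

/-! ### The basis of `𝓔²` and the dual functionals -/

/-- Letters pair a generator with its functional. By degree: Z, E in 0; N in 2e_i; W, Y, A, B, T in
e_j + e_k; K, U, X in 2e_i + e_j + e_k; O in (2,2,2). E, W, A, B belong to single terms θ₀θ_mδ and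
need no name on the generator side; the terms with values in Der are read off by `dC`. -/
def bZ : L2 R := ∑ i : Fin 3, (hL R i (rot i : CDer R) + (2 : R) • eL R i (boost i : CDer R))
def bN (i : Fin 3) : L2 R :=
  -eL R i (rot i : CDer R) + eL R (i + 1) (rot (i + 1) : CDer R) + eL R (i + 2) (rot (i + 2) : CDer R)
def bY (i : Fin 3) : L2 R := eL R (i + 1) (boost (i + 2) : CDer R) + eL R (i + 2) (boost (i + 1) : CDer R)
def bT (i : Fin 3) : L2 R := eL R (i + 1) (rot (i + 2) : CDer R) + hL R (i + 2) (boost (i + 1) : CDer R)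
def bK (i : Fin 3) : L2 R := eL R (i + 1) (boost (i + 2) : CDer R) - eL R (i + 2) (boost (i + 1) : CDer R)
def bU (i : Fin 3) : L2 R := eL R (i + 1) (boost (i + 2) : CDer R) - eL R (i + 2) (boost (i + 1) : CDer R)
  - (2 : R) • hL R i (sigma0 : CDer R)
def bX (i : Fin 3) : L2 R := eL R (i + 1) (boost (i + 2) : CDer R) + eL R (i + 2) (boost (i + 1) : CDer R)
  - (2 : R) • hL R (i + 2) (rot (i + 1) : CDer R)
def bO : L2 R := ∑ i : Fin 3, (eL R i (rot i : CDer R) - (2 : R) • hL R i (boost i : CDer R))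

/-- Coordinates modulo 𝓘² up to nonzero constants: the coefficient of Z is a third of its
functional, those of N, Y, K, X are one half, those of U and O are -1/2 and -1/6, and the others are
exact. The constants are cleared in the spanning lemmas. -/
def fZ : L2 R →ₗ[R] R := ∑ i, rC i ∘ₗ hC R i
def fE (i : Fin 3) : L2 R →ₗ[R] R :=
  bC i ∘ₗ eC R i - rC (i + 1) ∘ₗ hC R (i + 1) - rC (i + 2) ∘ₗ hC R (i + 2)
def fN (i : Fin 3) : L2 R →ₗ[R] R :=
  rC (i + 1) ∘ₗ eC R (i + 1) + rC (i + 2) ∘ₗ eC R (i + 2) + bC i ∘ₗ hC R i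
def fW (i : Fin 3) : L2 R →ₗ[R] R := sC ∘ₗ eC R i
def fY (i : Fin 3) : L2 R →ₗ[R] R :=
  bC (i + 2) ∘ₗ eC R (i + 1) + bC (i + 1) ∘ₗ eC R (i + 2) + rC (i + 2) ∘ₗ hC R (i + 1)
    + rC (i + 1) ∘ₗ hC R (i + 2)
def fA (i : Fin 3) : L2 R →ₗ[R] R := rC (i + 1) ∘ₗ eC R (i + 2) - bC (i + 2) ∘ₗ hC R (i + 1)
def fB (i : Fin 3) : L2 R →ₗ[R] R := rC (i + 2) ∘ₗ eC R (i + 1) - bC (i + 1) ∘ₗ hC R (i + 2)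
def fT (i : Fin 3) : L2 R →ₗ[R] R := bC (i + 1) ∘ₗ hC R (i + 2) - bC (i + 2) ∘ₗ hC R (i + 1)
def fK (i : Fin 3) : L2 R →ₗ[R] R :=
  bC (i + 2) ∘ₗ eC R (i + 1) - bC (i + 1) ∘ₗ eC R (i + 2) + sC ∘ₗ hC R i
def fU (i : Fin 3) : L2 R →ₗ[R] R := sC ∘ₗ hC R i
def fX (i : Fin 3) : L2 R →ₗ[R] R := rC (i + 2) ∘ₗ hC R (i + 1) - rC (i + 1) ∘ₗ hC R (i + 2)
def fO : L2 R →ₗ[R] R := ∑ i, bC i ∘ₗ hC R i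

theorem idealElement_eq (S : Matrix (Fin 3) (Fin 3) ℂ) :
    (idealElement S : L2 R) = ∑ m : Fin 3, ∑ n : Fin 3,
    (algebraMap ℝ R (S m n).re • (eL R m (boost n : CDer R) - hL R m (rot n : CDer R))
      - algebraMap ℝ R (S m n).im • (eL R m (rot n : CDer R) + hL R m (boost n : CDer R))) := rfl

theorem eC_idealElement (S : Matrix (Fin 3) (Fin 3) ℂ) (m : Fin 3) :
    eC R m (idealElement S : L2 R) = ∑ n : Fin 3,
    (algebraMap ℝ R (S m n).re • boost n - algebraMap ℝ R (S m n).im • rot n) := by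
  rw [idealElement_eq, map_sum, Finset.sum_eq_single m]
  · simp only [map_sum, map_sub, map_smul, map_add, eC_hL, eC_eL_self, sub_zero, add_zero]
  · intro k _ hk
    simp only [map_sum, map_sub, map_smul, map_add, eC_hL, eC_eL, if_neg hk.symm, sub_zero,
      add_zero, smul_zero, Finset.sum_const_zero]
  · simp

theorem hC_idealElement (S : Matrix (Fin 3) (Fin 3) ℂ) (m : Fin 3) :
    hC R m (idealElement S : L2 R) = ∑ n : Fin 3,
    (-(algebraMap ℝ R (S m n).re • rot n) - algebraMap ℝ R (S m n).im • boost n) := by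
  rw [idealElement_eq, map_sum, Finset.sum_eq_single m]
  · simp only [map_sum, map_sub, map_smul, map_add, hC_eL, hC_hL_self, zero_sub, zero_add, smul_neg]
  · intro k _ hk
    simp only [map_sum, map_sub, map_smul, map_add, hC_eL, hC_hL, if_neg hk.symm, sub_zero,
      add_zero, smul_zero, Finset.sum_const_zero]
  · simp

end Algebra

/-! ### The functionals vanish on the ideal, and explicit elements of the ideal -/

section Algebra

set_option linter.unusedSectionVars false

variable {R : Type*} [CommRing R] [Algebra ℝ R]

theorem fZ_apply (y : L2 R) : fZ y = ∑ i, rC i (hC R i y) := by simp [fZ]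
theorem fE_apply (i : Fin 3) (y : L2 R) : fE i y =
    bC i (eC R i y) - rC (i + 1) (hC R (i + 1) y) - rC (i + 2) (hC R (i + 2) y) := rfl
theorem fN_apply (i : Fin 3) (y : L2 R) : fN i y =
    rC (i + 1) (eC R (i + 1) y) + rC (i + 2) (eC R (i + 2) y) + bC i (hC R i y) := rfl
theorem fW_apply (i : Fin 3) (y : L2 R) : fW i y = sC (eC R i y) := rfl
theorem fY_apply (i : Fin 3) (y : L2 R) : fY i y =
    bC (i + 2) (eC R (i + 1) y) + bC (i + 1) (eC R (i + 2) y) + rC (i + 2) (hC R (i + 1) y)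
      + rC (i + 1) (hC R (i + 2) y) := rfl
theorem fA_apply (i : Fin 3) (y : L2 R) : fA i y =
    rC (i + 1) (eC R (i + 2) y) - bC (i + 2) (hC R (i + 1) y) := rfl
theorem fB_apply (i : Fin 3) (y : L2 R) : fB i y =
    rC (i + 2) (eC R (i + 1) y) - bC (i + 1) (hC R (i + 2) y) := rfl
theorem fT_apply (i : Fin 3) (y : L2 R) : fT i y =
    bC (i + 1) (hC R (i + 2) y) - bC (i + 2) (hC R (i + 1) y) := rfl
theorem fK_apply (i : Fin 3) (y : L2 R) : fK i y =
    bC (i + 2) (eC R (i + 1) y) - bC (i + 1) (eC R (i + 2) y) + sC (hC R i y) := rfl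
theorem fU_apply (i : Fin 3) (y : L2 R) : fU i y = sC (hC R i y) := rfl
theorem fX_apply (i : Fin 3) (y : L2 R) : fX i y =
    rC (i + 2) (hC R (i + 1) y) - rC (i + 1) (hC R (i + 2) y) := rfl
theorem fO_apply (y : L2 R) : fO y = ∑ i, bC i (hC R i y) := by simp [fO]

section Ideal

variable (S : Matrix (Fin 3) (Fin 3) ℂ) (m n : Fin 3)

theorem sC_eC_idealElement : sC (eC R m (idealElement S : L2 R)) = 0 := by
  simp [eC_idealElement, -algebraMap_smul]
theorem bC_eC_idealElement :
    bC n (eC R m (idealElement S : L2 R)) = algebraMap ℝ R (S m n).re := by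
  simp [eC_idealElement, bC_boost, -algebraMap_smul]
theorem rC_eC_idealElement :
    rC n (eC R m (idealElement S : L2 R)) = -algebraMap ℝ R (S m n).im := by
  simp [eC_idealElement, rC_rot, -algebraMap_smul]
theorem dC_eC_idealElement : dC (eC R m (idealElement S : L2 R)) = 0 := by
  simp [eC_idealElement, -algebraMap_smul]
theorem sC_hC_idealElement : sC (hC R m (idealElement S : L2 R)) = 0 := by
  simp [hC_idealElement, -algebraMap_smul]
theorem bC_hC_idealElement :
    bC n (hC R m (idealElement S : L2 R)) = -algebraMap ℝ R (S m n).im := by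
  simp [hC_idealElement, bC_boost, -algebraMap_smul]
theorem rC_hC_idealElement :
    rC n (hC R m (idealElement S : L2 R)) = -algebraMap ℝ R (S m n).re := by
  simp [hC_idealElement, rC_rot, -algebraMap_smul]
theorem dC_hC_idealElement : dC (hC R m (idealElement S : L2 R)) = 0 := by
  simp [hC_idealElement, -algebraMap_smul]

end Ideal

theorem apply_eq_zero_of_mem_I2 {X : Type*} [AddCommGroup X] [Module R X] (f : L2 R →ₗ[R] X)
    (h : ∀ S : Matrix (Fin 3) (Fin 3) ℂ, S.IsSymm → S.trace = 0 → f (idealElement S) = 0) :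
    I2 R ≤ LinearMap.ker f := by
  refine Submodule.span_le.2 ?_
  rintro _ ⟨S, hS, ht, rfl⟩
  exact h S hS ht

theorem re_trace {S : Matrix (Fin 3) (Fin 3) ℂ} (ht : S.trace = 0) (i : Fin 3) :
    algebraMap ℝ R (S i i).re + algebraMap ℝ R (S (i + 1) (i + 1)).re
      + algebraMap ℝ R (S (i + 2) (i + 2)).re = 0 := by
  have h : ∑ m, S m m = 0 := ht
  rw [fin3_sum_cyclic _ i] at h
  rw [← map_add, ← map_add, ← Complex.add_re, ← Complex.add_re, h, Complex.zero_re, map_zero]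

theorem im_trace {S : Matrix (Fin 3) (Fin 3) ℂ} (ht : S.trace = 0) (i : Fin 3) :
    algebraMap ℝ R (S i i).im + algebraMap ℝ R (S (i + 1) (i + 1)).im
      + algebraMap ℝ R (S (i + 2) (i + 2)).im = 0 := by
  have h : ∑ m, S m m = 0 := ht
  rw [fin3_sum_cyclic _ i] at h
  rw [← map_add, ← map_add, ← Complex.add_im, ← Complex.add_im, h, Complex.zero_im, map_zero]

/-- In a generator of 𝓘², Re S enters θ₀θ_mσ_n and, with the opposite sign, θ_{m'}θ_{m''}σ_{n'n''};
Im S enters the two mixed kinds with equal signs. Trace zero therefore kills Z, E, N, symmetry kills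
A, B, T, X, and the σ₀ and Der components see nothing. Y, K and O never yield an equation, so only
their role as coefficients is used. -/
theorem I2_le_ker_fZ : I2 R ≤ LinearMap.ker fZ := by
  refine apply_eq_zero_of_mem_I2 _ fun S _ ht => ?_
  rw [fZ_apply, fin3_sum_cyclic _ 0]
  simp only [rC_hC_idealElement]
  linear_combination -re_trace (R := R) ht 0

theorem I2_le_ker_fE (i : Fin 3) : I2 R ≤ LinearMap.ker (fE i) := by
  refine apply_eq_zero_of_mem_I2 _ fun S _ ht => ?_
  rw [fE_apply]
  simp only [rC_hC_idealElement, bC_eC_idealElement]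
  linear_combination re_trace (R := R) ht i

theorem I2_le_ker_fN (i : Fin 3) : I2 R ≤ LinearMap.ker (fN i) := by
  refine apply_eq_zero_of_mem_I2 _ fun S _ ht => ?_
  rw [fN_apply]
  simp only [rC_eC_idealElement, bC_hC_idealElement]
  linear_combination -im_trace (R := R) ht i

theorem I2_le_ker_fW (i : Fin 3) : I2 R ≤ LinearMap.ker (fW i) :=
  apply_eq_zero_of_mem_I2 _ fun S _ _ => sC_eC_idealElement S i

theorem I2_le_ker_fU (i : Fin 3) : I2 R ≤ LinearMap.ker (fU i) :=
  apply_eq_zero_of_mem_I2 _ fun S _ _ => sC_hC_idealElement S i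

theorem I2_le_ker_dC_eC (i : Fin 3) : I2 R ≤ LinearMap.ker (dC ∘ₗ eC R i) :=
  apply_eq_zero_of_mem_I2 _ fun S _ _ => dC_eC_idealElement S i

theorem I2_le_ker_dC_hC (i : Fin 3) : I2 R ≤ LinearMap.ker (dC ∘ₗ hC R i) :=
  apply_eq_zero_of_mem_I2 _ fun S _ _ => dC_hC_idealElement S i

theorem I2_le_ker_fA (i : Fin 3) : I2 R ≤ LinearMap.ker (fA i) := by
  refine apply_eq_zero_of_mem_I2 _ fun S hS _ => ?_
  rw [fA_apply, rC_eC_idealElement, bC_hC_idealElement, hS.apply (i + 1) (i + 2)]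
  ring

theorem I2_le_ker_fB (i : Fin 3) : I2 R ≤ LinearMap.ker (fB i) := by
  refine apply_eq_zero_of_mem_I2 _ fun S hS _ => ?_
  rw [fB_apply, rC_eC_idealElement, bC_hC_idealElement, hS.apply (i + 1) (i + 2)]
  ring

theorem I2_le_ker_fT (i : Fin 3) : I2 R ≤ LinearMap.ker (fT i) := by
  refine apply_eq_zero_of_mem_I2 _ fun S hS _ => ?_
  rw [fT_apply, bC_hC_idealElement, bC_hC_idealElement, hS.apply (i + 1) (i + 2)]
  ring

theorem I2_le_ker_fX (i : Fin 3) : I2 R ≤ LinearMap.ker (fX i) := by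
  refine apply_eq_zero_of_mem_I2 _ fun S hS _ => ?_
  rw [fX_apply, rC_hC_idealElement, rC_hC_idealElement, hS.apply (i + 1) (i + 2)]
  ring

/-- Here S = s(E_jk + E_kj). The choices s = 1 and s = i give the one real and the one imaginary
relation in the off-diagonal block of i. -/
theorem offdiag_mem_I2 (s : ℂ) (i : Fin 3) :
    algebraMap ℝ R s.re • (eL R (i + 1) (boost (i + 2) : CDer R) + eL R (i + 2) (boost (i + 1) : CDer R)
        - hL R (i + 1) (rot (i + 2) : CDer R) - hL R (i + 2) (rot (i + 1) : CDer R))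
      - algebraMap ℝ R s.im • (eL R (i + 1) (rot (i + 2) : CDer R) + eL R (i + 2) (rot (i + 1) : CDer R)
        + hL R (i + 1) (boost (i + 2) : CDer R) + hL R (i + 2) (boost (i + 1) : CDer R)) ∈ I2 R := by
  refine Submodule.subset_span ⟨Matrix.of fun m n =>
    if (m = i + 1 ∧ n = i + 2) ∨ (m = i + 2 ∧ n = i + 1) then s else 0, ?_, ?_, ?_⟩
  · refine Matrix.IsSymm.ext fun m n => ?_
    simp only [Matrix.of_apply]
    congr 1
    apply propext; tauto
  · rw [Matrix.trace, fin3_sum_cyclic _ i]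
    simp
  · rw [idealElement_eq, fin3_sum_cyclic _ i]
    simp only [fin3_sum_cyclic _ i]
    simp [-algebraMap_smul]
    module

/-- Here S = s(E_ii - E_jj) with j = i + 1; over i these span the traceless diagonal matrices. -/
theorem diag_mem_I2 (s : ℂ) (i : Fin 3) :
    algebraMap ℝ R s.re • (eL R i (boost i : CDer R) - eL R (i + 1) (boost (i + 1) : CDer R) - hL R i (rot i : CDer R)
        + hL R (i + 1) (rot (i + 1) : CDer R))
      - algebraMap ℝ R s.im • (eL R i (rot i : CDer R) - eL R (i + 1) (rot (i + 1) : CDer R) + hL R i (boost i : CDer R)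
        - hL R (i + 1) (boost (i + 1) : CDer R)) ∈ I2 R := by
  refine Submodule.subset_span ⟨Matrix.diagonal fun m =>
    if m = i then s else if m = i + 1 then -s else 0, ?_, ?_, ?_⟩
  · exact Matrix.diagonal_transpose _
  · rw [Matrix.trace_diagonal, fin3_sum_cyclic _ i]
    simp
  · rw [idealElement_eq, fin3_sum_cyclic _ i]
    simp only [fin3_sum_cyclic _ i]
    simp [-algebraMap_smul]
    module

end Algebra

section Algebra

set_option linter.unusedSectionVars false

variable {R : Type*} [CommRing R] [Algebra ℝ R]

/-! ### Every element of `𝓔²` is a combination of the basis -/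

/-- Any nonzero real number can be divided out; it is applied with 2, 3 and 6, the denominators of
the coordinates. -/
theorem mem_of_two_smul {X : Type*} [AddCommGroup X] [Module R X] {S : Submodule R X} {x : X}
    (n : ℝ) (hn : n ≠ 0) (h : algebraMap ℝ R n • x ∈ S) : x ∈ S := by
  have := S.smul_mem (algebraMap ℝ R n⁻¹) h
  rwa [smul_smul, ← map_mul, inv_mul_cancel₀ hn, map_one, one_smul] at this

theorem CDer.decomp (d : CDer R) (i : Fin 3) : d = sC d • sigma0
    + (bC i d • boost i + bC (i + 1) d • boost (i + 1) + bC (i + 2) d • boost (i + 2))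
    + (rC i d • rot i + rC (i + 1) d • rot (i + 1) + rC (i + 2) d • rot (i + 2))
    + ofDer (dC d) := by
  rw [← fin3_sum_cyclic (fun m => bC m d • (boost m : CDer R)) i,
    ← fin3_sum_cyclic (fun m => rC m d • (rot m : CDer R)) i]
  exact mkC_coord d

/-- The part of `y` in the span of `θ_jθ_kσ₀` and the `θ₀θ_mσ_n`, `θ_{m'}θ_{m''}σ_{n'n''}` with
`{m, n} = {j, k}`. -/
def realOff (i : Fin 3) (y : L2 R) : L2 R :=
  bC (i + 2) (eC R (i + 1) y) • eL R (i + 1) (boost (i + 2) : CDer R)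
    + bC (i + 1) (eC R (i + 2) y) • eL R (i + 2) (boost (i + 1) : CDer R)
    + rC (i + 2) (hC R (i + 1) y) • hL R (i + 1) (rot (i + 2) : CDer R)
    + rC (i + 1) (hC R (i + 2) y) • hL R (i + 2) (rot (i + 1) : CDer R)
    + sC (hC R i y) • hL R i (sigma0 : CDer R)

/-- The part of `y` in the span of the `θ₀θ_mσ_{n'n''}`, `θ_{m'}θ_{m''}σ_n` with
`{m, n} = {j, k}`. -/
def imagOff (i : Fin 3) (y : L2 R) : L2 R :=
  rC (i + 2) (eC R (i + 1) y) • eL R (i + 1) (rot (i + 2) : CDer R)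
    + rC (i + 1) (eC R (i + 2) y) • eL R (i + 2) (rot (i + 1) : CDer R)
    + bC (i + 2) (hC R (i + 1) y) • hL R (i + 1) (boost (i + 2) : CDer R)
    + bC (i + 1) (hC R (i + 2) y) • hL R (i + 2) (boost (i + 1) : CDer R)

/-- The part of `y` in the span of the `θ₀θ_mσ_m` and `θ_{m'}θ_{m''}σ_{m'm''}`. -/
def realDiag (y : L2 R) : L2 R :=
  ∑ i, (bC i (eC R i y) • eL R i (boost i : CDer R) + rC i (hC R i y) • hL R i (rot i : CDer R))

/-- The part of `y` in the span of the `θ₀θ_mσ_{m'm''}` and `θ_{m'}θ_{m''}σ_m`. -/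
def imagDiag (y : L2 R) : L2 R :=
  ∑ i, (rC i (eC R i y) • eL R i (rot i : CDer R) + bC i (hC R i y) • hL R i (boost i : CDer R))

/-- The relations of 𝓘² used for elimination each stay in one block: real or imaginary, diagonal or
off-diagonal in (m, n). The term θ_jθ_kσ₀ joins the real off-diagonal block because the generator U
contains it. -/
theorem L2_decomp (y : L2 R) : y = realDiag y + imagDiag y
    + ∑ i, (realOff i y + imagOff i y + sC (eC R i y) • eL R i (sigma0 : CDer R)
      + eL R i (ofDer (dC (eC R i y))) + hL R i (ofDer (dC (hC R i y)))) := by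
  refine (pairs_decomp R y).trans ?_
  rw [realDiag, imagDiag, fin3_sum_cyclic _ 0, fin3_sum_cyclic _ 0, fin3_sum_cyclic _ 0,
    fin3_sum_cyclic _ 0]
  simp only [realOff, imagOff]
  rw [congrArg (eL R 0) (CDer.decomp (eC R 0 y) 0),
    congrArg (eL R (0 + 1)) (CDer.decomp (eC R (0 + 1) y) (0 + 1)),
    congrArg (eL R (0 + 2)) (CDer.decomp (eC R (0 + 2) y) (0 + 2)),
    congrArg (hL R 0) (CDer.decomp (hC R 0 y) 0),
    congrArg (hL R (0 + 1)) (CDer.decomp (hC R (0 + 1) y) (0 + 1)),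
    congrArg (hL R (0 + 2)) (CDer.decomp (hC R (0 + 2) y) (0 + 2))]
  simp only [map_add, map_smul, fin3_add_one_add_one, fin3_add_one_add_two, fin3_add_two_add_one,
    fin3_add_two_add_two]
  abel

section Membership

variable {S : Submodule R (L2 R)}

/-- Five coordinates and one relation leave the four generators Y, K, U, X. -/
theorem realOff_mem (hI : I2 R ≤ S) (y : L2 R) (i : Fin 3) (hY : fY i y • bY i ∈ S) (hK : fK i y • bK i ∈ S)
    (hU : fU i y • bU i ∈ S) (hX : fX i y • bX i ∈ S) : realOff i y ∈ S := by
  have h1 := hI (offdiag_mem_I2 (R := R) 1 i)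
  simp only [Complex.one_re, Complex.one_im, map_one, map_zero, zero_smul, sub_zero,
    one_smul] at h1
  refine mem_of_two_smul 2 two_ne_zero ?_
  -- None of the four generators contains θ_kθ_iσ_ij, so the coefficient of that term dictates the
  -- multiple of the ideal element.
  have key : algebraMap ℝ R 2 • realOff i y = fY i y • bY i + fK i y • bK i - fU i y • bU i
      + fX i y • bX i + (-2 * rC (i + 2) (hC R (i + 1) y)) • (eL R (i + 1) (boost (i + 2) : CDer R)
        + eL R (i + 2) (boost (i + 1) : CDer R)
        - hL R (i + 1) (rot (i + 2) : CDer R) - hL R (i + 2) (rot (i + 1) : CDer R)) := by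
    rw [map_ofNat]
    simp only [realOff, bY, bK, bU, bX, fY_apply, fK_apply, fU_apply, fX_apply]
    module
  rw [key]
  exact add_mem (add_mem (sub_mem (add_mem hY hK) hU) hX) (S.smul_mem _ h1)

/-- Four coordinates and one relation leave A, B, T; here θ_kθ_iσ_k is absent from the generators
and fixes the multiple of the relation. -/
theorem imagOff_mem (hI : I2 R ≤ S) (y : L2 R) (i : Fin 3) (hA : fA i y • eL R (i + 2) (rot (i + 1) : CDer R) ∈ S)
    (hB : fB i y • eL R (i + 1) (rot (i + 2) : CDer R) ∈ S)
    (hT : fT i y • bT i ∈ S) : imagOff i y ∈ S := by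
  have h1 := hI (offdiag_mem_I2 (R := R) Complex.I i)
  simp only [Complex.I_re, Complex.I_im, map_one, map_zero, zero_smul, zero_sub,
    one_smul, neg_mem_iff] at h1
  have key : imagOff i y = fA i y • eL R (i + 2) (rot (i + 1) : CDer R)
      + fB i y • eL R (i + 1) (rot (i + 2) : CDer R) + fT i y • bT i
      + bC (i + 2) (hC R (i + 1) y) • (eL R (i + 1) (rot (i + 2) : CDer R)
        + eL R (i + 2) (rot (i + 1) : CDer R) + hL R (i + 1) (boost (i + 2) : CDer R)
        + hL R (i + 2) (boost (i + 1) : CDer R)) := by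
    simp only [imagOff, bT, fA_apply, fB_apply, fT_apply]
    module
  rw [key]
  exact add_mem (add_mem (add_mem hA hB) hT) (S.smul_mem _ h1)

/-- Six coordinates and two independent relations leave Z and the three E. All three cyclic
differences are used, although their sum is zero, to keep the identity symmetric; the factor 3 is
`fZ bZ`. -/
theorem realDiag_mem (hI : I2 R ≤ S) (y : L2 R) (hZ : fZ y • bZ ∈ S)
    (hE : ∀ i, fE i y • eL R i (boost i : CDer R) ∈ S) : realDiag y ∈ S := by
  have h1 : ∀ i, eL R i (boost i : CDer R) - eL R (i + 1) (boost (i + 1) : CDer R)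
      - hL R i (rot i : CDer R) + hL R (i + 1) (rot (i + 1) : CDer R) ∈ S := fun i => by
    simpa using hI (diag_mem_I2 (R := R) 1 i)
  refine mem_of_two_smul 3 three_ne_zero ?_
  have key : algebraMap ℝ R 3 • realDiag y = fZ y • bZ
      + (3 : R) • (fE 0 y • eL R 0 (boost 0 : CDer R)
        + fE (0 + 1) y • eL R (0 + 1) (boost (0 + 1) : CDer R)
        + fE (0 + 2) y • eL R (0 + 2) (boost (0 + 2) : CDer R))
      + (rC (0 + 1) (hC R (0 + 1) y) - rC 0 (hC R 0 y)) •
        (eL R 0 (boost 0 : CDer R) - eL R (0 + 1) (boost (0 + 1) : CDer R)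
          - hL R 0 (rot 0 : CDer R) + hL R (0 + 1) (rot (0 + 1) : CDer R))
      + (rC (0 + 2) (hC R (0 + 2) y) - rC (0 + 1) (hC R (0 + 1) y)) •
        (eL R (0 + 1) (boost (0 + 1) : CDer R) - eL R (0 + 2) (boost (0 + 2) : CDer R)
          - hL R (0 + 1) (rot (0 + 1) : CDer R) + hL R (0 + 2) (rot (0 + 2) : CDer R))
      + (rC 0 (hC R 0 y) - rC (0 + 2) (hC R (0 + 2) y)) •
        (eL R (0 + 2) (boost (0 + 2) : CDer R) - eL R 0 (boost 0 : CDer R)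
          - hL R (0 + 2) (rot (0 + 2) : CDer R) + hL R 0 (rot 0 : CDer R)) := by
    rw [map_ofNat, realDiag, bZ, fZ_apply, fin3_sum_cyclic _ 0, fin3_sum_cyclic _ 0,
      fin3_sum_cyclic _ 0]
    simp only [fE_apply, fin3_add_one_add_one, fin3_add_one_add_two, fin3_add_two_add_one,
      fin3_add_two_add_two]
    module
  rw [key]
  have h12 := h1 (0 + 1)
  have h20 := h1 (0 + 2)
  rw [fin3_add_one_add_one] at h12
  rw [fin3_add_two_add_one] at h20
  exact add_mem (add_mem (add_mem (add_mem hZ (S.smul_mem _ (add_mem (add_mem (hE _) (hE _))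
    (hE _)))) (S.smul_mem _ (h1 0))) (S.smul_mem _ h12)) (S.smul_mem _ h20)

/-- The same count leaves the three N and O; 6 is the common denominator of the factors 1/2 and
-1/6. -/
theorem imagDiag_mem (hI : I2 R ≤ S) (y : L2 R) (hN : ∀ i, fN i y • bN i ∈ S) (hO : fO y • bO ∈ S) : imagDiag y ∈ S := by
  have h1 : ∀ i, eL R i (rot i : CDer R) - eL R (i + 1) (rot (i + 1) : CDer R)
      + hL R i (boost i : CDer R) - hL R (i + 1) (boost (i + 1) : CDer R) ∈ S := fun i => by
    have := neg_mem (hI (diag_mem_I2 (R := R) Complex.I i))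
    simpa [-neg_mem_iff] using this
  refine mem_of_two_smul 6 (by norm_num) ?_
  have key : algebraMap ℝ R 6 • imagDiag y = (3 : R) • (fN 0 y • bN 0
        + fN (0 + 1) y • bN (0 + 1) + fN (0 + 2) y • bN (0 + 2)) - fO y • bO
      + (2 * (bC 0 (hC R 0 y) - bC (0 + 1) (hC R (0 + 1) y))) •
        (eL R 0 (rot 0 : CDer R) - eL R (0 + 1) (rot (0 + 1) : CDer R)
          + hL R 0 (boost 0 : CDer R) - hL R (0 + 1) (boost (0 + 1) : CDer R))
      + (2 * (bC (0 + 1) (hC R (0 + 1) y) - bC (0 + 2) (hC R (0 + 2) y))) •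
        (eL R (0 + 1) (rot (0 + 1) : CDer R) - eL R (0 + 2) (rot (0 + 2) : CDer R)
          + hL R (0 + 1) (boost (0 + 1) : CDer R) - hL R (0 + 2) (boost (0 + 2) : CDer R))
      + (2 * (bC (0 + 2) (hC R (0 + 2) y) - bC 0 (hC R 0 y))) •
        (eL R (0 + 2) (rot (0 + 2) : CDer R) - eL R 0 (rot 0 : CDer R)
          + hL R (0 + 2) (boost (0 + 2) : CDer R) - hL R 0 (boost 0 : CDer R)) := by
    rw [map_ofNat, imagDiag, bO, fO_apply, fin3_sum_cyclic _ 0, fin3_sum_cyclic _ 0,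
      fin3_sum_cyclic _ 0]
    simp only [fN_apply, bN, fin3_add_one_add_one, fin3_add_one_add_two, fin3_add_two_add_one,
      fin3_add_two_add_two]
    module
  rw [key]
  have h12 := h1 (0 + 1)
  have h20 := h1 (0 + 2)
  rw [fin3_add_one_add_one] at h12
  rw [fin3_add_two_add_one] at h20
  exact add_mem (add_mem (add_mem (sub_mem (S.smul_mem _ (add_mem (add_mem (hN _) (hN _))
    (hN _))) hO) (S.smul_mem _ (h1 0))) (S.smul_mem _ h12)) (S.smul_mem _ h20)

/-- Spanning in the form needed for a filtration step S: each hypothesis can be met either because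
the generator lies in S or because its coordinate vanishes. -/
theorem L2_mem (hI : I2 R ≤ S) (y : L2 R) (hZ : fZ y • bZ ∈ S) (hE : ∀ i, fE i y • eL R i (boost i : CDer R) ∈ S)
    (hN : ∀ i, fN i y • bN i ∈ S) (hW : ∀ i, fW i y • eL R i (sigma0 : CDer R) ∈ S)
    (hY : ∀ i, fY i y • bY i ∈ S) (hA : ∀ i, fA i y • eL R (i + 2) (rot (i + 1) : CDer R) ∈ S)
    (hB : ∀ i, fB i y • eL R (i + 1) (rot (i + 2) : CDer R) ∈ S)
    (hT : ∀ i, fT i y • bT i ∈ S) (he : ∀ i, eL R i (ofDer (dC (eC R i y))) ∈ S)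
    (hK : ∀ i, fK i y • bK i ∈ S) (hU : ∀ i, fU i y • bU i ∈ S) (hX : ∀ i, fX i y • bX i ∈ S)
    (hh : ∀ i, hL R i (ofDer (dC (hC R i y))) ∈ S) (hO : fO y • bO ∈ S) : y ∈ S := by
  rw [L2_decomp y]
  exact add_mem (add_mem (realDiag_mem hI y hZ hE) (imagDiag_mem hI y hN hO))
    (sum_mem fun i _ => add_mem (add_mem (add_mem (add_mem
      (realOff_mem hI y i (hY i) (hK i) (hU i) (hX i)) (imagOff_mem hI y i (hA i) (hB i) (hT i)))
      (hW i)) (he i)) (hh i))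

end Membership

end Algebra

section Algebra

set_option linter.unusedSectionVars false

variable {R : Type*} [CommRing R] [Algebra ℝ R]

/-! ### The filtration -/

/-- Multiplication by `θ₀`. -/
def theta0Mul : L1 R →ₗ[R] L2 R where
  toFun x := wedge (Pi.single 0 x)
  map_add' x y := by simp only [wedge_single_zero, ← Finset.sum_add_distrib, ← map_add]; rfl
  map_smul' r x := by
    simp only [wedge_single_zero, RingHom.id_apply, Finset.smul_sum, ← map_smul]; rfl

theorem theta0Mul_th_zero (δ : CDer R) : theta0Mul (th 0 δ) = 0 := by
  change wedge (Pi.single 0 _) = _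
  rw [wedge_single_zero]
  simp [th]

/-- The generators of the gauge part of `G_α 𝓔²`. -/
def gen2 (R : Type*) [CommRing R] [Algebra ℝ R] (α : Fin 3 → ℕ) : Set (L2 R) :=
  tabE2 R α ∪ (fun x : L1 R => wedge (Pi.single 0 x)) '' tabE1 R α

/-- Since θ₀² = 0, multiplication by θ₀ strips the θ₀ terms, as in θ₀(θ₀σ₀ + θ_iσ_i) = θ₀θ_iσ_i.
What results is exactly the adapted basis, sorted by degree. -/
theorem gen2_iff {β : Fin 3 → ℕ} {g : L2 R} : g ∈ gen2 R β ↔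
    (β = 0 ∧ (g = bZ ∨ ∃ m, g = eL R m (boost m : CDer R))) ∨
    (∃ m, β = dg200 m ∧ g = bN m) ∨
    (∃ m, β = dg011 m ∧ ((∃ v, g = eL R m (ofDer v)) ∨ g = eL R m (sigma0 : CDer R) ∨ g = bY m ∨
      g = eL R (m + 2) (rot (m + 1) : CDer R) ∨ g = eL R (m + 1) (rot (m + 2) : CDer R) ∨
      g = bT m)) ∨
    (∃ m, β = dg211 m ∧ (g = bK m ∨ (∃ v, g = hL R m (ofDer v)) ∨ g = bU m ∨ g = bX m)) ∨
    (β = dg222 ∧ g = bO) := by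
  have hT : ∀ i : Fin 3, th2 0 (i + 1).succ (rot (i + 2))
      + th2 i.succ (i + 1).succ (boost (i + 1)) = (bT i : L2 R) := fun i => by
    rw [th2_add_one]; rfl
  have hX : ∀ i : Fin 3, th2 0 (i + 1).succ (boost (i + 2)) + th2 0 (i + 2).succ (boost (i + 1))
          - (2 : R) • th2 i.succ (i + 1).succ (rot (i + 1)) = (bX i : L2 R) := fun i => by
    rw [th2_add_one]; rfl
  constructor
  · rintro (h | ⟨x, ⟨i, h⟩, rfl⟩)
    · rcases h with ⟨hβ, rfl⟩ | ⟨i, hβ, rfl⟩ | ⟨i, hβ, ⟨v, rfl⟩ | rfl | rfl⟩ | ⟨hβ, rfl⟩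
      · exact Or.inl ⟨hβ, Or.inl rfl⟩
      · exact Or.inr (Or.inr (Or.inl ⟨i, hβ, by simp [hT]⟩))
      · exact Or.inr (Or.inr (Or.inr (Or.inl ⟨i, hβ, Or.inr (Or.inl ⟨v, rfl⟩)⟩)))
      · exact Or.inr (Or.inr (Or.inr (Or.inl ⟨i, hβ, Or.inr (Or.inr (Or.inl rfl))⟩)))
      · exact Or.inr (Or.inr (Or.inr (Or.inl ⟨i, hβ, by simp [hX]⟩)))
      · exact Or.inr (Or.inr (Or.inr (Or.inr ⟨hβ, rfl⟩)))
    · change (_ = _ ∧ _) ∨ _ at h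
      change (β = 0 ∧ (theta0Mul x = bZ ∨ _)) ∨ _
      rcases h with ⟨hβ, rfl⟩ | ⟨hβ, rfl⟩ | ⟨hβ, ⟨v, rfl⟩ | rfl | rfl | rfl | rfl⟩ | ⟨hβ, rfl⟩
      · refine Or.inl ⟨hβ, Or.inr ⟨i, ?_⟩⟩
        change theta0Mul _ = _
        rw [map_add, theta0Mul_th_zero, zero_add]; rfl
      · exact Or.inr (Or.inl ⟨i, hβ, by
          change theta0Mul _ = _; rw [map_add, map_add, map_neg]; rfl⟩)
      · exact Or.inr (Or.inr (Or.inl ⟨i, hβ, Or.inl ⟨v, rfl⟩⟩))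
      · refine Or.inr (Or.inr (Or.inl ⟨i, hβ, Or.inr (Or.inl ?_)⟩))
        change theta0Mul _ = _
        rw [map_add, theta0Mul_th_zero, zero_add]; rfl
      · refine Or.inr (Or.inr (Or.inl ⟨i, hβ, Or.inr (Or.inr (Or.inl ?_))⟩))
        change theta0Mul _ = _
        rw [map_add]; rfl
      · exact Or.inr (Or.inr (Or.inl ⟨i, hβ, Or.inr (Or.inr (Or.inr (Or.inl rfl)))⟩))
      · exact Or.inr (Or.inr (Or.inl ⟨i, hβ, Or.inr (Or.inr (Or.inr (Or.inr (Or.inl rfl))))⟩))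
      · refine Or.inr (Or.inr (Or.inr (Or.inl ⟨i, hβ, Or.inl ?_⟩)))
        change theta0Mul _ = _
        rw [map_sub]; rfl
  · rintro (⟨hβ, rfl | ⟨i, rfl⟩⟩ | ⟨i, hβ, rfl⟩ | ⟨i, hβ, ⟨v, rfl⟩ | rfl | rfl | rfl | rfl | rfl⟩ |
      ⟨i, hβ, rfl | ⟨v, rfl⟩ | rfl | rfl⟩ | ⟨hβ, rfl⟩)
    · exact Or.inl (Or.inl ⟨hβ, rfl⟩)
    · refine Or.inr ⟨_, ⟨i, Or.inl ⟨hβ, rfl⟩⟩, ?_⟩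
      change theta0Mul _ = _
      rw [map_add, theta0Mul_th_zero, zero_add]; rfl
    · refine Or.inr ⟨_, ⟨i, Or.inr (Or.inl ⟨hβ, rfl⟩)⟩, ?_⟩
      change theta0Mul _ = _
      rw [map_add, map_add, map_neg]; rfl
    · exact Or.inr ⟨_, ⟨i, Or.inr (Or.inr (Or.inl ⟨hβ, Or.inl ⟨v, rfl⟩⟩))⟩, rfl⟩
    · refine Or.inr ⟨_, ⟨i, Or.inr (Or.inr (Or.inl ⟨hβ, Or.inr (Or.inl rfl)⟩))⟩, ?_⟩
      change theta0Mul _ = _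
      rw [map_add, theta0Mul_th_zero, zero_add]; rfl
    · refine Or.inr ⟨_, ⟨i, Or.inr (Or.inr (Or.inl ⟨hβ, Or.inr (Or.inr (Or.inl rfl))⟩))⟩, ?_⟩
      change theta0Mul _ = _
      rw [map_add]; rfl
    · exact Or.inr ⟨_, ⟨i, Or.inr (Or.inr (Or.inl ⟨hβ,
        Or.inr (Or.inr (Or.inr (Or.inl rfl)))⟩))⟩, rfl⟩
    · exact Or.inr ⟨_, ⟨i, Or.inr (Or.inr (Or.inl ⟨hβ,
        Or.inr (Or.inr (Or.inr (Or.inr rfl)))⟩))⟩, rfl⟩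
    · exact Or.inl (Or.inr (Or.inl ⟨i, hβ, (hT i).symm⟩))
    · refine Or.inr ⟨_, ⟨i, Or.inr (Or.inr (Or.inr ⟨hβ, rfl⟩))⟩, ?_⟩
      change theta0Mul _ = _
      rw [map_sub]; rfl
    · exact Or.inl (Or.inr (Or.inr (Or.inl ⟨i, hβ, Or.inl ⟨v, rfl⟩⟩)))
    · exact Or.inl (Or.inr (Or.inr (Or.inl ⟨i, hβ, Or.inr (Or.inl rfl)⟩)))
    · exact Or.inl (Or.inr (Or.inr (Or.inl ⟨i, hβ, Or.inr (Or.inr (hX i).symm)⟩)))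
    · exact Or.inl (Or.inr (Or.inr (Or.inr ⟨hβ, rfl⟩)))

/-- The sum of the `G_β 𝓔_Φ²` over all `β < γ`. -/
def lowerF2 (R : Type*) [CommRing R] [Algebra ℝ R] (γ : Fin 3 → ℕ) : Submodule R (E2 R) :=
  ⨆ β, ⨆ (_ : β < γ), G2 R β

theorem G2_le_lowerF2 {β γ : Fin 3 → ℕ} (h : β < γ) : G2 R β ≤ lowerF2 R γ :=
  le_iSup₂_of_le β h le_rfl

/-- The coefficient at γ of s_i𝓟² ranges over F at γ - e_i, and β < γ means β ≤ γ - e_i for some i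
with γ_i > 0. Coefficients of different degrees can be split independently because 𝓟 consists of all
formal power series. -/
theorem mem_sRees2_iff (y : Series (E2 R)) : y ∈ sRees2 R ↔ ∀ γ, y γ ∈ lowerF2 R γ := by
  classical
  constructor
  · intro hy γ
    have : sRees2 R ≤ (lowerF2 R γ).comap (LinearMap.proj γ) := by
      refine iSup_le fun i => ?_
      rintro _ ⟨z, hz, rfl⟩
      change (if γ i = 0 then 0 else z (γ - Pi.single i 1)) ∈ lowerF2 R γ
      split_ifs with h
      · exact zero_mem _
      · have hz' : z (γ - Pi.single i 1) ∈ F2 R (γ - Pi.single i 1) := hz _ trivial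
        refine (iSup₂_le fun β hβ => G2_le_lowerF2 ?_ : F2 R (γ - Pi.single i 1) ≤ _) hz'
        refine lt_of_le_of_lt hβ (Pi.lt_def.2 ⟨fun j => Nat.sub_le _ _, i, ?_⟩)
        simp only [Pi.sub_apply, Pi.single_eq_same]
        omega
    exact this hy
  · intro hy
    -- The possible contribution of s_i in degree γ. If γ_i = 0 there is none, whereas the truncated
    -- difference γ - e_i would be γ itself.
    let T : (Fin 3 → ℕ) → Fin 3 → Submodule R (E2 R) := fun γ i =>
      if γ i = 0 then ⊥ else F2 R (γ - Pi.single i 1)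
    have hle : ∀ γ, lowerF2 R γ ≤ ⨆ i, T γ i := by
      refine fun γ => iSup₂_le fun β hβ => ?_
      obtain ⟨hle, i, hi⟩ := Pi.lt_def.1 hβ
      refine le_iSup_of_le i ?_
      have hγ : γ i ≠ 0 := by omega
      simp only [T, if_neg hγ]
      refine le_iSup₂_of_le β (fun j => ?_) le_rfl
      by_cases h : j = i
      · subst h; simp only [Pi.sub_apply, Pi.single_eq_same]; omega
      · simpa [h] using hle j
    have hex : ∀ γ, ∃ z : Fin 3 → E2 R, (∀ i, z i ∈ T γ i) ∧ ∑ i, z i = y γ := by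
      intro γ
      have h := hle γ (hy γ)
      have h' : y γ ∈ ⨆ i ∈ (Finset.univ : Finset (Fin 3)), T γ i := by simpa using h
      obtain ⟨μ, hμ⟩ := (Submodule.mem_iSup_finset_iff_exists_sum _ _).1 h'
      exact ⟨fun i => μ i, fun i => (μ i).2, hμ⟩
    choose z hz hsum using hex
    -- Divide the i-th summand by s_i, that is, shift its index by e_i; nothing is lost since it
    -- vanishes where γ_i = 0.
    have hy' : y = ∑ i, mulS R i (fun α => z (α + Pi.single i 1) i) := by
      ext1 γ
      rw [← hsum γ, Finset.sum_apply]
      refine Finset.sum_congr rfl fun i _ => ?_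
      change _ = if γ i = 0 then 0 else z (γ - Pi.single i 1 + Pi.single i 1) i
      split_ifs with h
      · have := hz γ i
        simpa [T, h] using this
      · congr 1
        ext j
        by_cases hj : j = i
        · subst hj; simp only [Pi.add_apply, Pi.sub_apply, Pi.single_eq_same]; omega
        · simp [hj]
    rw [hy']
    refine sum_mem fun i _ => (le_iSup (fun i => (Rees2 R).map (mulS R i)) i)
      (Submodule.mem_map_of_mem fun α _ => ?_)
    have := hz (α + Pi.single i 1) i
    simpa [T] using this

/-- A functional that vanishes on `𝓘²` and on the generators of lower degree vanishes on
the lower part of the filtration. -/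
theorem apply_eq_zero_of_mem_lowerF2 {X : Type*} [AddCommGroup X] [Module R X]
    (f : L2 R →ₗ[R] X) (hI : I2 R ≤ LinearMap.ker f) {γ : Fin 3 → ℕ}
    (hg : ∀ β < γ, ∀ g ∈ gen2 R β, f g = 0) {y : L2 R} {φ : Phi2 R}
    (h : ((Submodule.Quotient.mk y, φ) : E2 R) ∈ lowerF2 R γ) : f y = 0 := by
  have : lowerF2 R γ ≤ LinearMap.ker ((I2 R).liftQ f hI ∘ₗ LinearMap.fst R _ _) := by
    refine iSup₂_le fun β hβ => ?_
    rintro ⟨x, ψ⟩ ⟨hx, -⟩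
    change (I2 R).liftQ f hI x = 0
    have h2 : (Submodule.span R (gen2 R β)).map (I2 R).mkQ
        ≤ LinearMap.ker ((I2 R).liftQ f hI) := by
      rw [Submodule.map_le_iff_le_comap]
      refine Submodule.span_le.2 fun g hgm => ?_
      exact hg β hβ g hgm
    exact h2 hx
  exact this h

theorem phi_apply_eq_zero_of_mem_lowerF2 (f : Phi2 R →ₗ[R] R) {γ : Fin 3 → ℕ}
    (hg : ∀ β < γ, ∀ g ∈ tabPhi2 R β ∪ thetaMul 0 '' tabPhi1 R β, f g = 0) {y : L2 R ⧸ I2 R}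
    {φ : Phi2 R} (h : ((y, φ) : E2 R) ∈ lowerF2 R γ) : f φ = 0 := by
  have : lowerF2 R γ ≤ LinearMap.ker (f ∘ₗ LinearMap.snd R (L2 R ⧸ I2 R) (Phi2 R)) := by
    refine iSup₂_le fun β hβ => ?_
    rintro ⟨x, ψ⟩ ⟨-, hψ⟩
    exact (Submodule.span_le.2 fun g hgm => hg β hβ g hgm :
      Submodule.span R (tabPhi2 R β ∪ thetaMul 0 '' tabPhi1 R β) ≤ LinearMap.ker f) hψ
  exact this h

end Algebra

/-! ### Testing membership in the lower part of the filtration -/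

section Algebra

set_option linter.unusedSectionVars false

variable {R : Type*} [CommRing R] [Algebra ℝ R]

section Degrees

variable (i m : Fin 3)

theorem dg200_not_lt_dg200 : ¬ dg200 m < dg200 i := by
  rw [Pi.lt_def, Pi.le_def]; revert i m; decide
theorem dg011_not_lt_dg200 : ¬ dg011 m < dg200 i := by
  rw [Pi.lt_def, Pi.le_def]; revert i m; decide
theorem dg211_not_lt_dg200 : ¬ dg211 m < dg200 i := by
  rw [Pi.lt_def, Pi.le_def]; revert i m; decide
theorem dg222_not_lt_dg200 : ¬ dg222 < dg200 i := by
  rw [Pi.lt_def, Pi.le_def]; revert i; decide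
theorem dg011_not_lt_dg011 : ¬ dg011 m < dg011 i := by
  rw [Pi.lt_def, Pi.le_def]; revert i m; decide
theorem dg211_not_lt_dg011 : ¬ dg211 m < dg011 i := by
  rw [Pi.lt_def, Pi.le_def]; revert i m; decide
theorem dg222_not_lt_dg011 : ¬ dg222 < dg011 i := by
  rw [Pi.lt_def, Pi.le_def]; revert i; decide
theorem dg211_not_lt_dg211 : ¬ dg211 m < dg211 i := by
  rw [Pi.lt_def, Pi.le_def]; revert i m; decide
theorem dg222_not_lt_dg211 : ¬ dg222 < dg211 i := by
  rw [Pi.lt_def, Pi.le_def]; revert i; decide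

end Degrees

theorem gen2_lt_dg200 {i : Fin 3} {β : Fin 3 → ℕ} {g : L2 R} (hg : g ∈ gen2 R β)
    (hβ : β < dg200 i) : g = bZ ∨ ∃ m, g = eL R m (boost m : CDer R) := by
  rcases gen2_iff.1 hg with ⟨-, h⟩ | ⟨m, rfl, -⟩ | ⟨m, rfl, -⟩ | ⟨m, rfl, -⟩ | ⟨rfl, -⟩
  · exact h
  · exact absurd hβ (dg200_not_lt_dg200 _ _)
  · exact absurd hβ (dg011_not_lt_dg200 _ _)
  · exact absurd hβ (dg211_not_lt_dg200 _ _)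
  · exact absurd hβ (dg222_not_lt_dg200 _)

/-- The degree 2e_m is in fact never below e_j + e_k, but the N generators need not be excluded, as
the functionals of this degree vanish on them anyway. -/
theorem gen2_lt_dg011 {i : Fin 3} {β : Fin 3 → ℕ} {g : L2 R} (hg : g ∈ gen2 R β)
    (hβ : β < dg011 i) :
    (g = bZ ∨ ∃ m, g = eL R m (boost m : CDer R)) ∨ ∃ m, g = bN m := by
  rcases gen2_iff.1 hg with ⟨-, h⟩ | ⟨m, rfl, h⟩ | ⟨m, rfl, -⟩ | ⟨m, rfl, -⟩ | ⟨rfl, -⟩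
  · exact Or.inl h
  · exact Or.inr ⟨m, h⟩
  · exact absurd hβ (dg011_not_lt_dg011 _ _)
  · exact absurd hβ (dg211_not_lt_dg011 _ _)
  · exact absurd hβ (dg222_not_lt_dg011 _)

theorem gen2_lt_dg211 {i : Fin 3} {β : Fin 3 → ℕ} {g : L2 R} (hg : g ∈ gen2 R β)
    (hβ : β < dg211 i) : ((g = bZ ∨ ∃ m, g = eL R m (boost m : CDer R)) ∨ (∃ m, g = bN m)) ∨
      ∃ m, (∃ v, g = eL R m (ofDer v)) ∨ g = eL R m (sigma0 : CDer R) ∨ g = bY m ∨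
      g = eL R (m + 2) (rot (m + 1) : CDer R) ∨ g = eL R (m + 1) (rot (m + 2) : CDer R) ∨
      g = bT m := by
  rcases gen2_iff.1 hg with ⟨-, h⟩ | ⟨m, rfl, h⟩ | ⟨m, rfl, h⟩ | ⟨m, rfl, -⟩ | ⟨rfl, -⟩
  · exact Or.inl (Or.inl h)
  · exact Or.inl (Or.inr ⟨m, h⟩)
  · exact Or.inr ⟨m, h⟩
  · exact absurd hβ (dg211_not_lt_dg211 _ _)
  · exact absurd hβ (dg222_not_lt_dg211 _)

theorem eC_bZ (i : Fin 3) : eC R i (bZ : L2 R) = (2 : R) • boost i := by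
  rw [bZ, fin3_sum_cyclic _ i]; simp [eC_eL, eC_hL]
theorem hC_bZ (i : Fin 3) : hC R i (bZ : L2 R) = rot i := by
  rw [bZ, fin3_sum_cyclic _ i]; simp [hC_eL, hC_hL]

variable {y : L2 R} {φ : Phi2 R} (i : Fin 3)

/-- Each functional kills 𝓘² and all generators of degree strictly below its own, so it is well
defined on the graded quotient in its own degree. This and the following lemmas are how an equation
is read off from vanishing in 𝓐. -/
theorem fZ_eq_zero (h : ((Submodule.Quotient.mk y, φ) : E2 R) ∈ lowerF2 R 0) : fZ y = 0 :=
  apply_eq_zero_of_mem_lowerF2 (X := R) (y := y) fZ I2_le_ker_fZ (fun _ hβ => absurd hβ not_lt_zero) h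

theorem fE_eq_zero (h : ((Submodule.Quotient.mk y, φ) : E2 R) ∈ lowerF2 R 0) : fE i y = 0 :=
  apply_eq_zero_of_mem_lowerF2 (X := R) (y := y) (fE i) (I2_le_ker_fE i) (fun _ hβ => absurd hβ not_lt_zero) h

theorem fN_eq_zero (h : ((Submodule.Quotient.mk y, φ) : E2 R) ∈ lowerF2 R (dg200 i)) :
    fN i y = 0 := by
  refine apply_eq_zero_of_mem_lowerF2 (X := R) (y := y) (fN i) (I2_le_ker_fN i) (fun β hβ g hg => ?_) h
  rcases gen2_lt_dg200 hg hβ with rfl | ⟨m, rfl⟩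
  · simp [fN_apply, eC_bZ, hC_bZ]
  · simp [fN_apply, eC_eL, hC_eL, apply_ite]

theorem fW_eq_zero (h : ((Submodule.Quotient.mk y, φ) : E2 R) ∈ lowerF2 R (dg011 i)) :
    fW i y = 0 := by
  refine apply_eq_zero_of_mem_lowerF2 (X := R) (y := y) (fW i) (I2_le_ker_fW i) (fun β hβ g hg => ?_) h
  rcases gen2_lt_dg011 hg hβ with (rfl | ⟨m, rfl⟩) | ⟨m, rfl⟩
  · simp [fW_apply, eC_bZ]
  · simp [fW_apply, eC_eL, apply_ite]
  · revert m
    refine fin3_forall_cyclic i ?_ ?_ ?_ <;> simp [fW_apply, bN, eC_eL]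

theorem fA_eq_zero (h : ((Submodule.Quotient.mk y, φ) : E2 R) ∈ lowerF2 R (dg011 i)) :
    fA i y = 0 := by
  refine apply_eq_zero_of_mem_lowerF2 (X := R) (y := y) (fA i) (I2_le_ker_fA i) (fun β hβ g hg => ?_) h
  rcases gen2_lt_dg011 hg hβ with (rfl | ⟨m, rfl⟩) | ⟨m, rfl⟩
  · simp [fA_apply, eC_bZ, hC_bZ]
  · simp [fA_apply, eC_eL, hC_eL, apply_ite]
  · revert m
    refine fin3_forall_cyclic i ?_ ?_ ?_ <;> simp [fA_apply, bN, eC_eL, hC_eL, rC_rot]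

theorem fB_eq_zero (h : ((Submodule.Quotient.mk y, φ) : E2 R) ∈ lowerF2 R (dg011 i)) :
    fB i y = 0 := by
  refine apply_eq_zero_of_mem_lowerF2 (X := R) (y := y) (fB i) (I2_le_ker_fB i) (fun β hβ g hg => ?_) h
  rcases gen2_lt_dg011 hg hβ with (rfl | ⟨m, rfl⟩) | ⟨m, rfl⟩
  · simp [fB_apply, eC_bZ, hC_bZ]
  · simp [fB_apply, eC_eL, hC_eL, apply_ite]
  · revert m
    refine fin3_forall_cyclic i ?_ ?_ ?_ <;> simp [fB_apply, bN, eC_eL, hC_eL, rC_rot]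

theorem fT_eq_zero (h : ((Submodule.Quotient.mk y, φ) : E2 R) ∈ lowerF2 R (dg011 i)) :
    fT i y = 0 := by
  refine apply_eq_zero_of_mem_lowerF2 (X := R) (y := y) (fT i) (I2_le_ker_fT i) (fun β hβ g hg => ?_) h
  rcases gen2_lt_dg011 hg hβ with (rfl | ⟨m, rfl⟩) | ⟨m, rfl⟩
  · simp [fT_apply, hC_bZ]
  · simp [fT_apply, hC_eL]
  · simp [fT_apply, bN, hC_eL]

theorem dC_eC_eq_zero (h : ((Submodule.Quotient.mk y, φ) : E2 R) ∈ lowerF2 R (dg011 i)) :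
    dC (eC R i y) = 0 := by
  refine apply_eq_zero_of_mem_lowerF2 (X := Derivation ℝ R R) (y := y)
    (dC ∘ₗ eC R i) (I2_le_ker_dC_eC i) (fun β hβ g hg => ?_) h
  change dC (eC R i g) = 0
  rcases gen2_lt_dg011 hg hβ with (rfl | ⟨m, rfl⟩) | ⟨m, rfl⟩
  · simp [eC_bZ]
  · simp [eC_eL, apply_ite]
  · revert m
    refine fin3_forall_cyclic i ?_ ?_ ?_ <;> simp [bN, eC_eL]

theorem fU_eq_zero (h : ((Submodule.Quotient.mk y, φ) : E2 R) ∈ lowerF2 R (dg211 i)) :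
    fU i y = 0 := by
  refine apply_eq_zero_of_mem_lowerF2 (X := R) (y := y) (fU i) (I2_le_ker_fU i) (fun β hβ g hg => ?_) h
  rcases gen2_lt_dg211 hg hβ with ((rfl | ⟨m, rfl⟩) | ⟨m, rfl⟩) |
    ⟨m, ⟨v, rfl⟩ | rfl | rfl | rfl | rfl | rfl⟩
  · simp [fU_apply, hC_bZ]
  all_goals simp [fU_apply, bN, bY, bT, hC_eL, hC_hL, apply_ite]

theorem dC_hC_eq_zero (h : ((Submodule.Quotient.mk y, φ) : E2 R) ∈ lowerF2 R (dg211 i)) :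
    dC (hC R i y) = 0 := by
  refine apply_eq_zero_of_mem_lowerF2 (X := Derivation ℝ R R) (y := y)
    (dC ∘ₗ hC R i) (I2_le_ker_dC_hC i) (fun β hβ g hg => ?_) h
  change dC (hC R i g) = 0
  rcases gen2_lt_dg211 hg hβ with ((rfl | ⟨m, rfl⟩) | ⟨m, rfl⟩) |
    ⟨m, ⟨v, rfl⟩ | rfl | rfl | rfl | rfl | rfl⟩
  · simp [hC_bZ]
  all_goals simp [bN, bY, bT, hC_eL, hC_hL, apply_ite]

theorem fX_eq_zero (h : ((Submodule.Quotient.mk y, φ) : E2 R) ∈ lowerF2 R (dg211 i)) :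
    fX i y = 0 := by
  refine apply_eq_zero_of_mem_lowerF2 (X := R) (y := y) (fX i) (I2_le_ker_fX i) (fun β hβ g hg => ?_) h
  rcases gen2_lt_dg211 hg hβ with ((rfl | ⟨m, rfl⟩) | ⟨m, rfl⟩) |
    ⟨m, ⟨v, rfl⟩ | rfl | rfl | rfl | rfl | rfl⟩
  · simp [fX_apply, hC_bZ, rC_rot]
  all_goals simp [fX_apply, bN, bY, bT, hC_eL, hC_hL, apply_ite]

theorem phi_top_eq_zero {y : L2 R ⧸ I2 R} (h : ((y, φ) : E2 R) ∈ lowerF2 R 0) : φ.2 = 0 :=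
  phi_apply_eq_zero_of_mem_lowerF2 (LinearMap.snd R _ _) (fun _ hβ => absurd hβ not_lt_zero) h

/-- The product θ₀θ₀ vanishes, but the dual term θ₀ ∧ θ₀^* is the volume form: the top component of
Φ² has degree 0. -/
theorem thetaMul_zero_single_zero :
    thetaMul 0 (Pi.single 0 1 : Fin 4 → R) = ((0, 1) : Phi2 R) := by
  refine Prod.ext (pairs_ext R (fun i => ?_) (fun i => ?_)) ?_
  · simp [thetaMul, eC_wedge]
  · simp [thetaMul, hC_wedge]
  · simp [thetaMul, eta_zero]

theorem thetaMul_zero_single_succ (m : Fin 3) :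
    thetaMul 0 (Pi.single m.succ 1 : Fin 4 → R) = ((eL R m 1, 0) : Phi2 R) := by
  refine Prod.ext rfl ?_
  simp [thetaMul, (Fin.succ_ne_zero _).symm]

theorem phi_e_eq_zero {y : L2 R ⧸ I2 R} (h : ((y, φ) : E2 R) ∈ lowerF2 R (dg011 i)) :
    eC R i φ.1 = 0 := by
  refine phi_apply_eq_zero_of_mem_lowerF2 (eC R i ∘ₗ LinearMap.fst R _ _)
    (fun β hβ g hg => ?_) h
  rcases hg with ⟨m, rfl, -⟩ | ⟨_, ⟨rfl, rfl⟩ | ⟨m, rfl, rfl⟩, rfl⟩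
  · exact absurd hβ (dg211_not_lt_dg011 _ _)
  · simp [thetaMul_zero_single_zero]
  · exact absurd hβ (dg011_not_lt_dg011 _ _)

theorem phi_h_eq_zero {y : L2 R ⧸ I2 R} (h : ((y, φ) : E2 R) ∈ lowerF2 R (dg211 i)) :
    hC R i φ.1 = 0 := by
  refine phi_apply_eq_zero_of_mem_lowerF2 (hC R i ∘ₗ LinearMap.fst R _ _)
    (fun β hβ g hg => ?_) h
  rcases hg with ⟨m, rfl, -⟩ | ⟨_, ⟨rfl, rfl⟩ | ⟨m, rfl, rfl⟩, rfl⟩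
  · exact absurd hβ (dg211_not_lt_dg211 _ _)
  · simp [thetaMul_zero_single_zero]
  · simp [thetaMul_zero_single_succ, hC_eL]

theorem inl_mem_lowerF2 {β γ : Fin 3 → ℕ} (h : β < γ) {g : L2 R} (hg : g ∈ gen2 R β) :
    ((Submodule.Quotient.mk g, 0) : E2 R) ∈ lowerF2 R γ :=
  G2_le_lowerF2 h ⟨Submodule.mem_map_of_mem (Submodule.subset_span hg), zero_mem _⟩

theorem inr_mem_lowerF2 {β γ : Fin 3 → ℕ} (h : β < γ) {g : Phi2 R}
    (hg : g ∈ tabPhi2 R β ∪ thetaMul 0 '' tabPhi1 R β) : ((0, g) : E2 R) ∈ lowerF2 R γ :=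
  G2_le_lowerF2 h ⟨zero_mem _, Submodule.subset_span hg⟩

/-- The converse test: a coordinate has to vanish only if its generator is not below γ. For O it is
demanded outright, since it vanishes on all brackets to which this is applied. -/
theorem mem_lowerF2_gauge {γ : Fin 3 → ℕ}
    (h0 : ¬ 0 < γ → fZ y = 0 ∧ ∀ i, fE i y = 0)
    (h2 : ∀ i, ¬ dg200 i < γ → fN i y = 0)
    (h11 : ∀ i, ¬ dg011 i < γ → fW i y = 0 ∧ fY i y = 0 ∧ fA i y = 0 ∧ fB i y = 0 ∧ fT i y = 0 ∧
      dC (eC R i y) = 0)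
    (h21 : ∀ i, ¬ dg211 i < γ → fK i y = 0 ∧ fU i y = 0 ∧ fX i y = 0 ∧ dC (hC R i y) = 0)
    (h22 : fO y = 0) : ((Submodule.Quotient.mk y, 0) : E2 R) ∈ lowerF2 R γ := by
  let S : Submodule R (L2 R) := (lowerF2 R γ).comap (LinearMap.inl R _ _ ∘ₗ (I2 R).mkQ)
  have hI : I2 R ≤ S := fun z hz => by
    change ((Submodule.Quotient.mk z, 0) : E2 R) ∈ lowerF2 R γ
    rw [(Submodule.Quotient.mk_eq_zero _).2 hz]
    exact zero_mem _
  have key : ∀ (β : Fin 3 → ℕ) (r : R) (g : L2 R), (¬ β < γ → r = 0) → g ∈ gen2 R β → r • g ∈ S := by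
    intro β r g hr hg
    by_cases hβ : β < γ
    · exact S.smul_mem _ (inl_mem_lowerF2 hβ hg)
    · rw [hr hβ, zero_smul]; exact zero_mem _
  have key' : ∀ (β : Fin 3 → ℕ) (g : L2 R), (¬ β < γ → g = 0) → g ∈ gen2 R β → g ∈ S := by
    intro β g hr hg
    by_cases hβ : β < γ
    · exact inl_mem_lowerF2 hβ hg
    · rw [hr hβ]; exact zero_mem _
  have ofDer_zero : (ofDer 0 : CDer R) = 0 := rfl
  refine L2_mem hI y
    (key 0 _ _ (fun h => (h0 h).1) (gen2_iff.2 (Or.inl ⟨rfl, Or.inl rfl⟩)))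
    (fun i => key 0 _ _ (fun h => (h0 h).2 i) (gen2_iff.2 (Or.inl ⟨rfl, Or.inr ⟨i, rfl⟩⟩)))
    (fun i => key (dg200 i) _ _ (h2 i) (gen2_iff.2 (Or.inr (Or.inl ⟨i, rfl, rfl⟩))))
    (fun i => key (dg011 i) _ _ (fun h => (h11 i h).1)
      (gen2_iff.2 (Or.inr (Or.inr (Or.inl ⟨i, rfl, by simp⟩)))))
    (fun i => key (dg011 i) _ _ (fun h => (h11 i h).2.1)
      (gen2_iff.2 (Or.inr (Or.inr (Or.inl ⟨i, rfl, by simp⟩)))))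
    (fun i => key (dg011 i) _ _ (fun h => (h11 i h).2.2.1)
      (gen2_iff.2 (Or.inr (Or.inr (Or.inl ⟨i, rfl, by simp⟩)))))
    (fun i => key (dg011 i) _ _ (fun h => (h11 i h).2.2.2.1)
      (gen2_iff.2 (Or.inr (Or.inr (Or.inl ⟨i, rfl, by simp⟩)))))
    (fun i => key (dg011 i) _ _ (fun h => (h11 i h).2.2.2.2.1)
      (gen2_iff.2 (Or.inr (Or.inr (Or.inl ⟨i, rfl, by simp⟩)))))
    (fun i => key' (dg011 i) _ (fun h => by rw [(h11 i h).2.2.2.2.2, ofDer_zero, map_zero])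
      (gen2_iff.2 (Or.inr (Or.inr (Or.inl ⟨i, rfl, Or.inl ⟨_, rfl⟩⟩)))))
    (fun i => key (dg211 i) _ _ (fun h => (h21 i h).1)
      (gen2_iff.2 (Or.inr (Or.inr (Or.inr (Or.inl ⟨i, rfl, by simp⟩))))))
    (fun i => key (dg211 i) _ _ (fun h => (h21 i h).2.1)
      (gen2_iff.2 (Or.inr (Or.inr (Or.inr (Or.inl ⟨i, rfl, by simp⟩))))))
    (fun i => key (dg211 i) _ _ (fun h => (h21 i h).2.2.1)
      (gen2_iff.2 (Or.inr (Or.inr (Or.inr (Or.inl ⟨i, rfl, by simp⟩))))))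
    (fun i => key' (dg211 i) _ (fun h => by rw [(h21 i h).2.2.2, ofDer_zero, map_zero])
      (gen2_iff.2 (Or.inr (Or.inr (Or.inr (Or.inl ⟨i, rfl, Or.inr (Or.inl ⟨_, rfl⟩)⟩))))))
    (key dg222 _ _ (fun _ => h22) (gen2_iff.2 (Or.inr (Or.inr (Or.inr (Or.inr ⟨rfl, rfl⟩))))))

theorem mem_lowerF2_phi {γ : Fin 3 → ℕ} (h0 : ¬ 0 < γ → φ.2 = 0)
    (h11 : ∀ i, ¬ dg011 i < γ → eC R i φ.1 = 0) (h21 : ∀ i, ¬ dg211 i < γ → hC R i φ.1 = 0) :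
    ((0, φ) : E2 R) ∈ lowerF2 R γ := by
  have key : ∀ (β : Fin 3 → ℕ) (r : R) (g : Phi2 R), (¬ β < γ → r = 0) →
      g ∈ tabPhi2 R β ∪ thetaMul 0 '' tabPhi1 R β → ((0, r • g) : E2 R) ∈ lowerF2 R γ := by
    intro β r g hr hg
    by_cases hβ : β < γ
    · have := (lowerF2 R γ).smul_mem r (inr_mem_lowerF2 hβ hg)
      rwa [Prod.smul_mk, smul_zero] at this
    · rw [hr hβ, zero_smul]; exact zero_mem _
  have e : ((0, φ) : E2 R) = (0, φ.2 • ((0, 1) : Phi2 R))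
      + ∑ i, (((0, eC R i φ.1 • ((eL R i 1, 0) : Phi2 R)) : E2 R)
        + (0, hC R i φ.1 • ((hL R i 1, 0) : Phi2 R))) := by
    refine Prod.ext (by simp [Prod.fst_sum]) (Prod.ext ?_ ?_)
    · simp only [Prod.snd_add, Prod.snd_sum, Prod.fst_add, Prod.fst_sum, Prod.smul_mk, smul_zero,
        zero_add, ← map_smul, smul_eq_mul, mul_one]
      exact pairs_decomp R φ.1
    · simp [Prod.snd_sum]
  rw [e]
  refine add_mem (key 0 _ _ h0 (Or.inr ⟨_, Or.inl ⟨rfl, rfl⟩, thetaMul_zero_single_zero⟩))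
    (sum_mem fun i _ => add_mem (key (dg011 i) _ _ (h11 i)
      (Or.inr ⟨_, Or.inr ⟨i, rfl, rfl⟩, thetaMul_zero_single_succ i⟩))
      (key (dg211 i) _ _ (h21 i) (Or.inl ⟨i, rfl, rfl⟩)))

end Algebra

section Algebra

set_option linter.unusedSectionVars false

variable {R : Type*} [CommRing R] [Algebra ℝ R]

/-! ### Gauged elements of degree one -/

variable (R) in
/-- The coefficients of an element of degree one of the gauged form. -/
structure Gauge where
  p : Fin 3 → R
  n : Fin 3 → R
  w : Fin 3 → R
  a : Fin 3 → R
  b : Fin 3 → R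
  q : Fin 3 → R
  f : R
  d0 : Derivation ℝ R R
  V : Fin 3 → Derivation ℝ R R

namespace Gauge

/-- The coefficients of the rotations in the `θ_i` component. -/
def rotCoeff (G : Gauge R) (i m : Fin 3) : R :=
  if m = i then -G.n i + G.n (i + 1) + G.n (i + 2) else
    if m = i + 1 then G.b (i + 2) else G.a (i + 1)

/-- The element of `𝓔_Φ¹` with the given coefficients. -/
def elem (G : Gauge R) : E1 R :=
  (Fin.cons (mkC (∑ i, G.p i) G.w 0 G.d0)
    fun i => mkC (G.w i) (Pi.single i (G.p i)) (G.rotCoeff i) (G.V i), Fin.cons G.f G.q)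

variable (G : Gauge R) (i m : Fin 3)

theorem rotCoeff_self : G.rotCoeff i i = -G.n i + G.n (i + 1) + G.n (i + 2) := by simp [rotCoeff]

theorem sC_elem_zero : sC (G.elem.1 0) = G.p i + G.p (i + 1) + G.p (i + 2) := by
  rw [← fin3_sum_cyclic G.p i]; exact sC_mkC _ _ _ _
theorem bC_elem_zero : bC m (G.elem.1 0) = G.w m := bC_mkC _ _ _ _ _
theorem rC_elem_zero : rC m (G.elem.1 0) = 0 := rC_mkC _ _ _ _ _
theorem dC_elem_zero : dC (G.elem.1 0) = G.d0 := dC_mkC _ _ _ _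
theorem sC_elem_succ : sC (G.elem.1 i.succ) = G.w i := sC_mkC _ _ _ _
theorem bC_elem_succ : bC m (G.elem.1 i.succ) = (Pi.single i (G.p i) : Fin 3 → R) m :=
  bC_mkC _ _ _ _ _
theorem rC_elem_succ : rC m (G.elem.1 i.succ) = G.rotCoeff i m := rC_mkC _ _ _ _ _
theorem dC_elem_succ : dC (G.elem.1 i.succ) = G.V i := dC_mkC _ _ _ _
theorem elem_phi_zero : G.elem.2 0 = G.f := rfl
theorem elem_phi_succ : G.elem.2 i.succ = G.q i := rfl

theorem bC_elem_self : bC i (G.elem.1 i.succ) = G.p i := by simp [bC_elem_succ]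
theorem rC_elem_self :
    rC i (G.elem.1 i.succ) = -G.n i + G.n (i + 1) + G.n (i + 2) := by
  rw [rC_elem_succ, rotCoeff_self]

end Gauge

/-- The family `z_ab` with `[x, y] = ∑ θ_aθ_b z_ab`. -/
def bracketFam (x y : E1 R) (a b : Fin 4) : CDer R :=
  ⁅x.1 a, y.1 b⁆ + ∑ c, (x.1 a).1.1 b c • y.1 c - ∑ c, (y.1 b).1.1 a c • x.1 c
    + ∑ q, (eta R a * (-3 * (x.2 b * y.2 q + x.2 q * y.2 b)
    + (if b = q then conf x.2 y.2 * eta R b else 0))) • (sigma a q : CDer R)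

/-- The gauge part of the bracket in `𝓔²`, before passing to the quotient by `𝓘²`. -/
def bracketTop (x y : E1 R) : L2 R := bracketL x.1 y.1 + bracketPhi x.2 y.2

theorem bracketTop_eq (x y : E1 R) : bracketTop x y = wedge (bracketFam x y) := by
  ext1 p
  simp only [bracketTop, bracketL, bracketPhi, wedge, bracketFam, Pi.add_apply]
  abel

theorem eC_bracketTop (x y : E1 R) (i : Fin 3) :
    eC R i (bracketTop x y) = bracketFam x y 0 i.succ - bracketFam x y i.succ 0 := by
  rw [bracketTop_eq, eC_wedge]

theorem hC_bracketTop (x y : E1 R) (i : Fin 3) :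
    hC R i (bracketTop x y) = bracketFam x y (i + 1).succ (i + 2).succ
      - bracketFam x y (i + 2).succ (i + 1).succ := by
  rw [bracketTop_eq, hC_wedge]

theorem sigma_self (a : Fin 4) : (sigma a a : CDer R) = 0 := by
  apply Subtype.ext
  change ((Matrix.of fun d c => _), _) = _
  simp; rfl

theorem sigma_swap (a b : Fin 4) : (sigma a b : CDer R) = -sigma b a := by
  apply Subtype.ext
  refine Prod.ext ?_ neg_zero.symm
  ext d c
  simp [sigma]

theorem sigma_zero_succ (i : Fin 3) : (sigma 0 i.succ : CDer R) = boost i := rfl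
theorem sigma_succ_zero (i : Fin 3) : (sigma i.succ 0 : CDer R) = -boost i := sigma_swap _ _
theorem sigma_add_one_add_two (i : Fin 3) :
    (sigma (i + 1).succ (i + 2).succ : CDer R) = rot i := rfl
theorem sigma_add_two_add_one (i : Fin 3) :
    (sigma (i + 2).succ (i + 1).succ : CDer R) = -rot i := sigma_swap _ _
theorem sigma_add_one (i : Fin 3) :
    (sigma i.succ (i + 1).succ : CDer R) = rot (i + 2) := by
  simpa using sigma_add_one_add_two (R := R) (i + 2)
theorem sigma_add_one_swap (i : Fin 3) :
    (sigma (i + 1).succ i.succ : CDer R) = -rot (i + 2) := by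
  rw [sigma_swap, sigma_add_one]
theorem sigma_add_two (i : Fin 3) :
    (sigma i.succ (i + 2).succ : CDer R) = -rot (i + 1) := by
  simpa using sigma_add_two_add_one (R := R) (i + 1)
theorem sigma_add_two_swap (i : Fin 3) :
    (sigma (i + 2).succ i.succ : CDer R) = rot (i + 1) := by
  rw [sigma_swap, sigma_add_two, neg_neg]

theorem conf_cyclic (v w : Fin 4 → R) (i : Fin 3) : conf v w = -(v 0 * w 0) + v i.succ * w i.succ
    + v (i + 1).succ * w (i + 1).succ + v (i + 2).succ * w (i + 2).succ := by
  rw [conf, fin4_sum_cyclic _ i]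
  simp only [eta_zero, eta_succ]
  ring

section Components

variable (x y : E1 R) (i : Fin 3)

/-- The components θ₀θ_i, θ_iθ₀, θ_jθ_k, θ_kθ_j with generic i exhaust all pairs of distinct
indices, and cyclic indices let one computation cover three cases. The Φ part of the bracket is
included, so scalar field and gravity are expanded together. -/
theorem bracketFam_zero_succ : bracketFam x y 0 i.succ = ⁅x.1 0, y.1 i.succ⁆
    + (bC i (x.1 0) • y.1 0 + sC (x.1 0) • y.1 i.succ + rC (i + 2) (x.1 0) • y.1 (i + 1).succ
      - rC (i + 1) (x.1 0) • y.1 (i + 2).succ)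
    - (sC (y.1 i.succ) • x.1 0 + bC i (y.1 i.succ) • x.1 i.succ
      + bC (i + 1) (y.1 i.succ) • x.1 (i + 1).succ + bC (i + 2) (y.1 i.succ) • x.1 (i + 2).succ)
    + ((3 * (x.2 i.succ * y.2 i.succ + x.2 i.succ * y.2 i.succ) - conf x.2 y.2) • boost i
      + (3 * (x.2 i.succ * y.2 (i + 1).succ + x.2 (i + 1).succ * y.2 i.succ)) • boost (i + 1)
      + (3 * (x.2 i.succ * y.2 (i + 2).succ + x.2 (i + 2).succ * y.2 i.succ)) • boost (i + 2)) := by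
  rw [bracketFam, fin4_sum_cyclic _ i, fin4_sum_cyclic _ i, fin4_sum_cyclic _ i]
  simp only [entry_zero_zero, entry_zero_succ, entry_succ_zero, entry_diag, entry_add_one,
    entry_add_two, eta_zero, eta_succ, sigma_self, sigma_zero_succ, Fin.succ_inj,
    fin3_ne_add_one, fin3_ne_add_two, if_true, if_false, smul_zero]
  module

theorem bracketFam_succ_zero : bracketFam x y i.succ 0 = ⁅x.1 i.succ, y.1 0⁆
    + (sC (x.1 i.succ) • y.1 0 + bC i (x.1 i.succ) • y.1 i.succ
      + bC (i + 1) (x.1 i.succ) • y.1 (i + 1).succ + bC (i + 2) (x.1 i.succ) • y.1 (i + 2).succ)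
    - (bC i (y.1 0) • x.1 0 + sC (y.1 0) • x.1 i.succ + rC (i + 2) (y.1 0) • x.1 (i + 1).succ
      - rC (i + 1) (y.1 0) • x.1 (i + 2).succ)
    + ((3 * (x.2 0 * y.2 0 + x.2 0 * y.2 0) + conf x.2 y.2) • boost i
      - (3 * (x.2 0 * y.2 (i + 1).succ + x.2 (i + 1).succ * y.2 0)) • rot (i + 2)
      + (3 * (x.2 0 * y.2 (i + 2).succ + x.2 (i + 2).succ * y.2 0)) • rot (i + 1)) := by
  rw [bracketFam, fin4_sum_cyclic _ i, fin4_sum_cyclic _ i, fin4_sum_cyclic _ i]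
  simp only [entry_zero_zero, entry_zero_succ, entry_succ_zero, entry_diag, entry_add_one,
    entry_add_two, eta_zero, eta_succ, sigma_self, sigma_succ_zero, sigma_add_one,
    sigma_add_two, (Fin.succ_ne_zero _).symm, if_true, if_false, smul_zero]
  module

theorem bracketFam_add_one_add_two : bracketFam x y (i + 1).succ (i + 2).succ =
    ⁅x.1 (i + 1).succ, y.1 (i + 2).succ⁆
    + (bC (i + 2) (x.1 (i + 1).succ) • y.1 0 + rC (i + 1) (x.1 (i + 1).succ) • y.1 i.succ
      - rC i (x.1 (i + 1).succ) • y.1 (i + 1).succ + sC (x.1 (i + 1).succ) • y.1 (i + 2).succ)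
    - (bC (i + 1) (y.1 (i + 2).succ) • x.1 0 - rC (i + 2) (y.1 (i + 2).succ) • x.1 i.succ
      + sC (y.1 (i + 2).succ) • x.1 (i + 1).succ + rC i (y.1 (i + 2).succ) • x.1 (i + 2).succ)
    + ((3 * (x.2 (i + 2).succ * y.2 0 + x.2 0 * y.2 (i + 2).succ)) • boost (i + 1)
      + (3 * (x.2 (i + 2).succ * y.2 i.succ + x.2 i.succ * y.2 (i + 2).succ)) • rot (i + 2)
      + (conf x.2 y.2
        - 3 * (x.2 (i + 2).succ * y.2 (i + 2).succ + x.2 (i + 2).succ * y.2 (i + 2).succ)) •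
        rot i) := by
  rw [bracketFam, fin4_sum_cyclic _ i, fin4_sum_cyclic _ i, fin4_sum_cyclic _ i]
  simp only [entry_succ_zero, entry_diag, entry_add_one_swap, entry_add_two_swap, entry_rot,
    entry_rot_swap, eta_succ, sigma_self, sigma_succ_zero, sigma_add_one_swap,
    sigma_add_one_add_two, Fin.succ_ne_zero, Fin.succ_inj, fin3_add_two_ne,
    fin3_add_two_ne_add_one, if_true, if_false, smul_zero]
  module

theorem bracketFam_add_two_add_one : bracketFam x y (i + 2).succ (i + 1).succ =
    ⁅x.1 (i + 2).succ, y.1 (i + 1).succ⁆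
    + (bC (i + 1) (x.1 (i + 2).succ) • y.1 0 - rC (i + 2) (x.1 (i + 2).succ) • y.1 i.succ
      + sC (x.1 (i + 2).succ) • y.1 (i + 1).succ + rC i (x.1 (i + 2).succ) • y.1 (i + 2).succ)
    - (bC (i + 2) (y.1 (i + 1).succ) • x.1 0 + rC (i + 1) (y.1 (i + 1).succ) • x.1 i.succ
      - rC i (y.1 (i + 1).succ) • x.1 (i + 1).succ + sC (y.1 (i + 1).succ) • x.1 (i + 2).succ)
    + ((3 * (x.2 (i + 1).succ * y.2 0 + x.2 0 * y.2 (i + 1).succ)) • boost (i + 2)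
      - (3 * (x.2 (i + 1).succ * y.2 i.succ + x.2 i.succ * y.2 (i + 1).succ)) • rot (i + 1)
      - (conf x.2 y.2
        - 3 * (x.2 (i + 1).succ * y.2 (i + 1).succ + x.2 (i + 1).succ * y.2 (i + 1).succ)) •
        rot i) := by
  rw [bracketFam, fin4_sum_cyclic _ i, fin4_sum_cyclic _ i, fin4_sum_cyclic _ i]
  simp only [entry_succ_zero, entry_diag, entry_add_one_swap, entry_add_two_swap, entry_rot,
    entry_rot_swap, eta_succ, sigma_self, sigma_succ_zero, sigma_add_two_swap,
    sigma_add_two_add_one, Fin.succ_ne_zero, Fin.succ_inj, fin3_add_one_ne,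
    fin3_add_one_ne_add_two, if_true, if_false, smul_zero]
  module

end Components

end Algebra

section Algebra

set_option linter.unusedSectionVars false
set_option linter.unusedSimpArgs false

variable {R : Type*} [CommRing R] [Algebra ℝ R]

/-! ### The brackets of gauged elements in the basis of `𝓔²` -/

theorem eC_bracketTop_eq (x y : E1 R) (i : Fin 3) : eC R i (bracketTop x y) =
    (⁅x.1 0, y.1 i.succ⁆
    + (bC i (x.1 0) • y.1 0 + sC (x.1 0) • y.1 i.succ + rC (i + 2) (x.1 0) • y.1 (i + 1).succ
      - rC (i + 1) (x.1 0) • y.1 (i + 2).succ)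
    - (sC (y.1 i.succ) • x.1 0 + bC i (y.1 i.succ) • x.1 i.succ
      + bC (i + 1) (y.1 i.succ) • x.1 (i + 1).succ + bC (i + 2) (y.1 i.succ) • x.1 (i + 2).succ)
    + ((3 * (x.2 i.succ * y.2 i.succ + x.2 i.succ * y.2 i.succ) - conf x.2 y.2) • boost i
      + (3 * (x.2 i.succ * y.2 (i + 1).succ + x.2 (i + 1).succ * y.2 i.succ)) • boost (i + 1)
      + (3 * (x.2 i.succ * y.2 (i + 2).succ + x.2 (i + 2).succ * y.2 i.succ)) • boost (i + 2)))
    - (⁅x.1 i.succ, y.1 0⁆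
    + (sC (x.1 i.succ) • y.1 0 + bC i (x.1 i.succ) • y.1 i.succ
      + bC (i + 1) (x.1 i.succ) • y.1 (i + 1).succ + bC (i + 2) (x.1 i.succ) • y.1 (i + 2).succ)
    - (bC i (y.1 0) • x.1 0 + sC (y.1 0) • x.1 i.succ + rC (i + 2) (y.1 0) • x.1 (i + 1).succ
      - rC (i + 1) (y.1 0) • x.1 (i + 2).succ)
    + ((3 * (x.2 0 * y.2 0 + x.2 0 * y.2 0) + conf x.2 y.2) • boost i
      - (3 * (x.2 0 * y.2 (i + 1).succ + x.2 (i + 1).succ * y.2 0)) • rot (i + 2)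
      + (3 * (x.2 0 * y.2 (i + 2).succ + x.2 (i + 2).succ * y.2 0)) • rot (i + 1))) := by
  rw [eC_bracketTop, bracketFam_zero_succ, bracketFam_succ_zero]

theorem hC_bracketTop_eq (x y : E1 R) (i : Fin 3) : hC R i (bracketTop x y) =
    (⁅x.1 (i + 1).succ, y.1 (i + 2).succ⁆
    + (bC (i + 2) (x.1 (i + 1).succ) • y.1 0 + rC (i + 1) (x.1 (i + 1).succ) • y.1 i.succ
      - rC i (x.1 (i + 1).succ) • y.1 (i + 1).succ + sC (x.1 (i + 1).succ) • y.1 (i + 2).succ)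
    - (bC (i + 1) (y.1 (i + 2).succ) • x.1 0 - rC (i + 2) (y.1 (i + 2).succ) • x.1 i.succ
      + sC (y.1 (i + 2).succ) • x.1 (i + 1).succ + rC i (y.1 (i + 2).succ) • x.1 (i + 2).succ)
    + ((3 * (x.2 (i + 2).succ * y.2 0 + x.2 0 * y.2 (i + 2).succ)) • boost (i + 1)
      + (3 * (x.2 (i + 2).succ * y.2 i.succ + x.2 i.succ * y.2 (i + 2).succ)) • rot (i + 2)
      + (conf x.2 y.2
        - 3 * (x.2 (i + 2).succ * y.2 (i + 2).succ + x.2 (i + 2).succ * y.2 (i + 2).succ)) •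
        rot i))
    - (⁅x.1 (i + 2).succ, y.1 (i + 1).succ⁆
    + (bC (i + 1) (x.1 (i + 2).succ) • y.1 0 - rC (i + 2) (x.1 (i + 2).succ) • y.1 i.succ
      + sC (x.1 (i + 2).succ) • y.1 (i + 1).succ + rC i (x.1 (i + 2).succ) • y.1 (i + 2).succ)
    - (bC (i + 2) (y.1 (i + 1).succ) • x.1 0 + rC (i + 1) (y.1 (i + 1).succ) • x.1 i.succ
      - rC i (y.1 (i + 1).succ) • x.1 (i + 1).succ + sC (y.1 (i + 1).succ) • x.1 (i + 2).succ)
    + ((3 * (x.2 (i + 1).succ * y.2 0 + x.2 0 * y.2 (i + 1).succ)) • boost (i + 2)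
      - (3 * (x.2 (i + 1).succ * y.2 i.succ + x.2 i.succ * y.2 (i + 1).succ)) • rot (i + 1)
      - (conf x.2 y.2
        - 3 * (x.2 (i + 1).succ * y.2 (i + 1).succ + x.2 (i + 1).succ * y.2 (i + 1).succ)) •
        rot i)) := by
  rw [hC_bracketTop, bracketFam_add_one_add_two, bracketFam_add_two_add_one]

namespace Gauge

variable (X Y : Gauge R) (i : Fin 3)

/-- The expansion stays bilinear in two independent coefficient lists, because the coefficient of
s^γ in [x, x] brackets parts of different degrees. -/
theorem fZ_bracketTop :
    fZ (bracketTop X.elem Y.elem) = -(2 * (X.a i * Y.a i)) + X.a i * Y.b i - X.a i * Y.w i - 2 * (X.a (i + 1) * Y.a (i + 1))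
        + X.a (i + 1) * Y.b (i + 1) - X.a (i + 1) * Y.w (i + 1)
        - 2 * (X.a (i + 2) * Y.a (i + 2)) + X.a (i + 2) * Y.b (i + 2)
        - X.a (i + 2) * Y.w (i + 2) + X.b i * Y.a i - 2 * (X.b i * Y.b i) + X.b i * Y.w i
        + X.b (i + 1) * Y.a (i + 1) - 2 * (X.b (i + 1) * Y.b (i + 1))
        + X.b (i + 1) * Y.w (i + 1) + X.b (i + 2) * Y.a (i + 2)
        - 2 * (X.b (i + 2) * Y.b (i + 2)) + X.b (i + 2) * Y.w (i + 2) - X.V i (Y.a i)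
        + X.V i (Y.b i) - X.V (i + 1) (Y.a (i + 1)) + X.V (i + 1) (Y.b (i + 1))
        - X.V (i + 2) (Y.a (i + 2)) + X.V (i + 2) (Y.b (i + 2)) - 6 * (X.f * Y.f)
        - 2 * (X.n i * Y.n i) + 2 * (X.n i * Y.n (i + 1)) + 2 * (X.n i * Y.n (i + 2))
        + 2 * (X.n (i + 1) * Y.n i) - 2 * (X.n (i + 1) * Y.n (i + 1))
        + 2 * (X.n (i + 1) * Y.n (i + 2)) + 2 * (X.n (i + 2) * Y.n i)
        + 2 * (X.n (i + 2) * Y.n (i + 1)) - 2 * (X.n (i + 2) * Y.n (i + 2))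
        + X.p i * Y.p (i + 1) + X.p i * Y.p (i + 2) + X.p (i + 1) * Y.p i
        + X.p (i + 1) * Y.p (i + 2) + X.p (i + 2) * Y.p i + X.p (i + 2) * Y.p (i + 1)
        - 6 * (X.q i * Y.q i) - 6 * (X.q (i + 1) * Y.q (i + 1))
        - 6 * (X.q (i + 2) * Y.q (i + 2)) - X.w i * Y.a i + X.w i * Y.b i
        - X.w (i + 1) * Y.a (i + 1) + X.w (i + 1) * Y.b (i + 1) - X.w (i + 2) * Y.a (i + 2)
        + X.w (i + 2) * Y.b (i + 2) - Y.V i (X.a i) + Y.V i (X.b i)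
        - Y.V (i + 1) (X.a (i + 1)) + Y.V (i + 1) (X.b (i + 1)) - Y.V (i + 2) (X.a (i + 2))
        + Y.V (i + 2) (X.b (i + 2)) := by
  rw [fZ_apply, fin3_sum_cyclic _ i]
  simp only [eC_bracketTop_eq, hC_bracketTop_eq, fin3_add_one_add_one, fin3_add_one_add_two,
    fin3_add_two_add_one, fin3_add_two_add_two, fin3_ne_add_one, fin3_ne_add_two, fin3_add_one_ne,
    fin3_add_two_ne, fin3_add_one_ne_add_two, fin3_add_two_ne_add_one, if_true, if_false,
    map_add, map_sub, map_neg, map_zero, map_smul, smul_eq_mul, sC_bracket, bC_bracket, rC_bracket,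
    sC_boost, sC_rot, bC_rot, rC_boost, bC_boost, rC_rot,
    sC_elem_zero _ i, bC_elem_zero, rC_elem_zero, dC_elem_zero, sC_elem_succ, bC_elem_succ,
    rC_elem_succ, dC_elem_succ, elem_phi_zero, elem_phi_succ, conf_cyclic _ _ i, rotCoeff,
    Pi.single_apply]
  ring

theorem fE_bracketTop :
    fE i (bracketTop X.elem Y.elem) = 2 * (X.a i * Y.a i) + X.a i * Y.w i + 2 * (X.a (i + 1) * Y.a (i + 1))
        - X.a (i + 1) * Y.b (i + 1) - X.a (i + 2) * Y.b (i + 2) + 2 * (X.b i * Y.b i)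
        - X.b i * Y.w i - X.b (i + 1) * Y.a (i + 1) - X.b (i + 2) * Y.a (i + 2)
        + 2 * (X.b (i + 2) * Y.b (i + 2)) + X.d0 (Y.p i) + X.V i (Y.a i) - X.V i (Y.b i)
        - X.V i (Y.w i) + X.V (i + 1) (Y.a (i + 1)) - X.V (i + 2) (Y.b (i + 2))
        - 4 * (X.n i * Y.n i) + 4 * (X.n (i + 1) * Y.n (i + 1))
        - 4 * (X.n (i + 1) * Y.n (i + 2)) - 4 * (X.n (i + 2) * Y.n (i + 1))
        + 4 * (X.n (i + 2) * Y.n (i + 2)) + 12 * (X.q i * Y.q i) + X.w i * Y.a i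
        - X.w i * Y.b i + Y.d0 (X.p i) + Y.V i (X.a i) - Y.V i (X.b i) - Y.V i (X.w i)
        + Y.V (i + 1) (X.a (i + 1)) - Y.V (i + 2) (X.b (i + 2)) := by
  rw [fE_apply]
  simp only [eC_bracketTop_eq, hC_bracketTop_eq, fin3_add_one_add_one, fin3_add_one_add_two,
    fin3_add_two_add_one, fin3_add_two_add_two, fin3_ne_add_one, fin3_ne_add_two, fin3_add_one_ne,
    fin3_add_two_ne, fin3_add_one_ne_add_two, fin3_add_two_ne_add_one, if_true, if_false,
    map_add, map_sub, map_neg, map_zero, map_smul, smul_eq_mul, sC_bracket, bC_bracket, rC_bracket,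
    sC_boost, sC_rot, bC_rot, rC_boost, bC_boost, rC_rot,
    sC_elem_zero _ i, bC_elem_zero, rC_elem_zero, dC_elem_zero, sC_elem_succ, bC_elem_succ,
    rC_elem_succ, dC_elem_succ, elem_phi_zero, elem_phi_succ, conf_cyclic _ _ i, rotCoeff,
    Pi.single_apply]
  ring

theorem fN_bracketTop :
    fN i (bracketTop X.elem Y.elem) = 2 * (X.d0 (Y.n i)) + 4 * (X.n i * Y.p i) + 4 * (X.p i * Y.n i) + 2 * (Y.d0 (X.n i)) := by
  rw [fN_apply]
  simp only [eC_bracketTop_eq, hC_bracketTop_eq, fin3_add_one_add_one, fin3_add_one_add_two,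
    fin3_add_two_add_one, fin3_add_two_add_two, fin3_ne_add_one, fin3_ne_add_two, fin3_add_one_ne,
    fin3_add_two_ne, fin3_add_one_ne_add_two, fin3_add_two_ne_add_one, if_true, if_false,
    map_add, map_sub, map_neg, map_zero, map_smul, smul_eq_mul, sC_bracket, bC_bracket, rC_bracket,
    sC_boost, sC_rot, bC_rot, rC_boost, bC_boost, rC_rot,
    sC_elem_zero _ i, bC_elem_zero, rC_elem_zero, dC_elem_zero, sC_elem_succ, bC_elem_succ,
    rC_elem_succ, dC_elem_succ, elem_phi_zero, elem_phi_succ, conf_cyclic _ _ i, rotCoeff,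
    Pi.single_apply]
  ring

theorem fW_bracketTop :
    fW i (bracketTop X.elem Y.elem) = X.d0 (Y.w i) - X.V i (Y.p i) - X.V i (Y.p (i + 1)) - X.V i (Y.p (i + 2))
        + X.p (i + 1) * Y.w i + X.p (i + 2) * Y.w i + X.w i * Y.p (i + 1)
        + X.w i * Y.p (i + 2) + Y.d0 (X.w i) - Y.V i (X.p i) - Y.V i (X.p (i + 1))
        - Y.V i (X.p (i + 2)) := by
  rw [fW_apply]
  simp only [eC_bracketTop_eq, hC_bracketTop_eq, fin3_add_one_add_one, fin3_add_one_add_two,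
    fin3_add_two_add_one, fin3_add_two_add_two, fin3_ne_add_one, fin3_ne_add_two, fin3_add_one_ne,
    fin3_add_two_ne, fin3_add_one_ne_add_two, fin3_add_two_ne_add_one, if_true, if_false,
    map_add, map_sub, map_neg, map_zero, map_smul, smul_eq_mul, sC_bracket, bC_bracket, rC_bracket,
    sC_boost, sC_rot, bC_rot, rC_boost, bC_boost, rC_rot,
    sC_elem_zero _ i, bC_elem_zero, rC_elem_zero, dC_elem_zero, sC_elem_succ, bC_elem_succ,
    rC_elem_succ, dC_elem_succ, elem_phi_zero, elem_phi_succ, conf_cyclic _ _ i, rotCoeff,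
    Pi.single_apply]
  ring

theorem fY_bracketTop :
    fY i (bracketTop X.elem Y.elem) = -(2 * (X.a i * Y.n i)) + 4 * (X.a i * Y.n (i + 2)) - X.a (i + 1) * Y.a (i + 2)
        - 2 * (X.a (i + 1) * Y.b (i + 2)) + X.a (i + 1) * Y.w (i + 2)
        - X.a (i + 2) * Y.a (i + 1) + X.a (i + 2) * Y.w (i + 1) - 2 * (X.b i * Y.n i)
        + 4 * (X.b i * Y.n (i + 1)) - X.b (i + 1) * Y.b (i + 2) - X.b (i + 1) * Y.w (i + 2)
        - 2 * (X.b (i + 2) * Y.a (i + 1)) - X.b (i + 2) * Y.b (i + 1)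
        - X.b (i + 2) * Y.w (i + 1) - 2 * (X.V i (Y.n (i + 1))) + 2 * (X.V i (Y.n (i + 2)))
        - X.V (i + 1) (Y.b (i + 2)) - X.V (i + 1) (Y.w (i + 2)) + X.V (i + 2) (Y.a (i + 1))
        - X.V (i + 2) (Y.w (i + 1)) - 2 * (X.n i * Y.a i) - 2 * (X.n i * Y.b i)
        + 4 * (X.n (i + 1) * Y.b i) + 4 * (X.n (i + 2) * Y.a i)
        + 12 * (X.q (i + 1) * Y.q (i + 2)) + 12 * (X.q (i + 2) * Y.q (i + 1))
        + X.w (i + 1) * Y.a (i + 2) - X.w (i + 1) * Y.b (i + 2) + X.w (i + 2) * Y.a (i + 1)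
        - X.w (i + 2) * Y.b (i + 1) - 2 * (Y.V i (X.n (i + 1))) + 2 * (Y.V i (X.n (i + 2)))
        - Y.V (i + 1) (X.b (i + 2)) - Y.V (i + 1) (X.w (i + 2)) + Y.V (i + 2) (X.a (i + 1))
        - Y.V (i + 2) (X.w (i + 1)) := by
  rw [fY_apply]
  simp only [eC_bracketTop_eq, hC_bracketTop_eq, fin3_add_one_add_one, fin3_add_one_add_two,
    fin3_add_two_add_one, fin3_add_two_add_two, fin3_ne_add_one, fin3_ne_add_two, fin3_add_one_ne,
    fin3_add_two_ne, fin3_add_one_ne_add_two, fin3_add_two_ne_add_one, if_true, if_false,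
    map_add, map_sub, map_neg, map_zero, map_smul, smul_eq_mul, sC_bracket, bC_bracket, rC_bracket,
    sC_boost, sC_rot, bC_rot, rC_boost, bC_boost, rC_rot,
    sC_elem_zero _ i, bC_elem_zero, rC_elem_zero, dC_elem_zero, sC_elem_succ, bC_elem_succ,
    rC_elem_succ, dC_elem_succ, elem_phi_zero, elem_phi_succ, conf_cyclic _ _ i, rotCoeff,
    Pi.single_apply]
  ring

theorem fA_bracketTop :
    fA i (bracketTop X.elem Y.elem) = X.a i * Y.p (i + 1) + X.a i * Y.p (i + 2) + X.d0 (Y.a i) + X.V i (Y.p (i + 2))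
        + X.p (i + 1) * Y.a i + X.p (i + 2) * Y.a i + Y.d0 (X.a i) + Y.V i (X.p (i + 2)) := by
  rw [fA_apply]
  simp only [eC_bracketTop_eq, hC_bracketTop_eq, fin3_add_one_add_one, fin3_add_one_add_two,
    fin3_add_two_add_one, fin3_add_two_add_two, fin3_ne_add_one, fin3_ne_add_two, fin3_add_one_ne,
    fin3_add_two_ne, fin3_add_one_ne_add_two, fin3_add_two_ne_add_one, if_true, if_false,
    map_add, map_sub, map_neg, map_zero, map_smul, smul_eq_mul, sC_bracket, bC_bracket, rC_bracket,
    sC_boost, sC_rot, bC_rot, rC_boost, bC_boost, rC_rot,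
    sC_elem_zero _ i, bC_elem_zero, rC_elem_zero, dC_elem_zero, sC_elem_succ, bC_elem_succ,
    rC_elem_succ, dC_elem_succ, elem_phi_zero, elem_phi_succ, conf_cyclic _ _ i, rotCoeff,
    Pi.single_apply]
  ring

theorem fB_bracketTop :
    fB i (bracketTop X.elem Y.elem) = X.b i * Y.p (i + 1) + X.b i * Y.p (i + 2) + X.d0 (Y.b i) - X.V i (Y.p (i + 1))
        + X.p (i + 1) * Y.b i + X.p (i + 2) * Y.b i + Y.d0 (X.b i) - Y.V i (X.p (i + 1)) := by
  rw [fB_apply]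
  simp only [eC_bracketTop_eq, hC_bracketTop_eq, fin3_add_one_add_one, fin3_add_one_add_two,
    fin3_add_two_add_one, fin3_add_two_add_two, fin3_ne_add_one, fin3_ne_add_two, fin3_add_one_ne,
    fin3_add_two_ne, fin3_add_one_ne_add_two, fin3_add_two_ne_add_one, if_true, if_false,
    map_add, map_sub, map_neg, map_zero, map_smul, smul_eq_mul, sC_bracket, bC_bracket, rC_bracket,
    sC_boost, sC_rot, bC_rot, rC_boost, bC_boost, rC_rot,
    sC_elem_zero _ i, bC_elem_zero, rC_elem_zero, dC_elem_zero, sC_elem_succ, bC_elem_succ,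
    rC_elem_succ, dC_elem_succ, elem_phi_zero, elem_phi_succ, conf_cyclic _ _ i, rotCoeff,
    Pi.single_apply]
  ring

theorem fT_bracketTop :
    fT i (bracketTop X.elem Y.elem) = -(X.a i * Y.p i) + X.a i * Y.p (i + 2) + X.b i * Y.p i - X.b i * Y.p (i + 1)
        + X.V i (Y.p (i + 1)) + X.V i (Y.p (i + 2)) - 6 * (X.f * Y.q i) - X.p i * Y.a i
        + X.p i * Y.b i - X.p (i + 1) * Y.b i + X.p (i + 1) * Y.w i + X.p (i + 2) * Y.a i
        + X.p (i + 2) * Y.w i - 6 * (X.q i * Y.f) + X.w i * Y.p (i + 1) + X.w i * Y.p (i + 2)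
        + Y.V i (X.p (i + 1)) + Y.V i (X.p (i + 2)) := by
  rw [fT_apply]
  simp only [eC_bracketTop_eq, hC_bracketTop_eq, fin3_add_one_add_one, fin3_add_one_add_two,
    fin3_add_two_add_one, fin3_add_two_add_two, fin3_ne_add_one, fin3_ne_add_two, fin3_add_one_ne,
    fin3_add_two_ne, fin3_add_one_ne_add_two, fin3_add_two_ne_add_one, if_true, if_false,
    map_add, map_sub, map_neg, map_zero, map_smul, smul_eq_mul, sC_bracket, bC_bracket, rC_bracket,
    sC_boost, sC_rot, bC_rot, rC_boost, bC_boost, rC_rot,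
    sC_elem_zero _ i, bC_elem_zero, rC_elem_zero, dC_elem_zero, sC_elem_succ, bC_elem_succ,
    rC_elem_succ, dC_elem_succ, elem_phi_zero, elem_phi_succ, conf_cyclic _ _ i, rotCoeff,
    Pi.single_apply]
  ring

/-- The cancellation holds before any degrees are compared; the same happens for O. These
coordinates impose no condition on gauged elements. -/
theorem fK_bracketTop :
    fK i (bracketTop X.elem Y.elem) = 0 := by
  rw [fK_apply]
  simp only [eC_bracketTop_eq, hC_bracketTop_eq, fin3_add_one_add_one, fin3_add_one_add_two,
    fin3_add_two_add_one, fin3_add_two_add_two, fin3_ne_add_one, fin3_ne_add_two, fin3_add_one_ne,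
    fin3_add_two_ne, fin3_add_one_ne_add_two, fin3_add_two_ne_add_one, if_true, if_false,
    map_add, map_sub, map_neg, map_zero, map_smul, smul_eq_mul, sC_bracket, bC_bracket, rC_bracket,
    sC_boost, sC_rot, bC_rot, rC_boost, bC_boost, rC_rot,
    sC_elem_zero _ i, bC_elem_zero, rC_elem_zero, dC_elem_zero, sC_elem_succ, bC_elem_succ,
    rC_elem_succ, dC_elem_succ, elem_phi_zero, elem_phi_succ, conf_cyclic _ _ i, rotCoeff,
    Pi.single_apply]
  ring

theorem fU_bracketTop :
    fU i (bracketTop X.elem Y.elem) = -(X.a (i + 2) * Y.w (i + 1)) - X.b (i + 1) * Y.w (i + 2) + X.V (i + 1) (Y.w (i + 2))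
        - X.V (i + 2) (Y.w (i + 1)) + 2 * (X.n i * Y.w i) + 2 * (X.w i * Y.n i)
        - X.w (i + 1) * Y.a (i + 2) - X.w (i + 2) * Y.b (i + 1) + Y.V (i + 1) (X.w (i + 2))
        - Y.V (i + 2) (X.w (i + 1)) := by
  rw [fU_apply]
  simp only [eC_bracketTop_eq, hC_bracketTop_eq, fin3_add_one_add_one, fin3_add_one_add_two,
    fin3_add_two_add_one, fin3_add_two_add_two, fin3_ne_add_one, fin3_ne_add_two, fin3_add_one_ne,
    fin3_add_two_ne, fin3_add_one_ne_add_two, fin3_add_two_ne_add_one, if_true, if_false,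
    map_add, map_sub, map_neg, map_zero, map_smul, smul_eq_mul, sC_bracket, bC_bracket, rC_bracket,
    sC_boost, sC_rot, bC_rot, rC_boost, bC_boost, rC_rot,
    sC_elem_zero _ i, bC_elem_zero, rC_elem_zero, dC_elem_zero, sC_elem_succ, bC_elem_succ,
    rC_elem_succ, dC_elem_succ, elem_phi_zero, elem_phi_succ, conf_cyclic _ _ i, rotCoeff,
    Pi.single_apply]
  ring

theorem fX_bracketTop :
    fX i (bracketTop X.elem Y.elem) = -(2 * (X.a i * Y.n i)) + X.a (i + 1) * Y.a (i + 2) + X.a (i + 1) * Y.w (i + 2)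
        + X.a (i + 2) * Y.a (i + 1) + 2 * (X.b i * Y.n i) - X.b (i + 1) * Y.b (i + 2)
        - X.b (i + 2) * Y.b (i + 1) + X.b (i + 2) * Y.w (i + 1) - 2 * (X.V i (Y.n i))
        + X.V (i + 1) (Y.b (i + 2)) + X.V (i + 2) (Y.a (i + 1)) - 2 * (X.n i * Y.a i)
        + 2 * (X.n i * Y.b i) - 2 * (X.n i * Y.w i) - 2 * (X.w i * Y.n i)
        + X.w (i + 1) * Y.b (i + 2) + X.w (i + 2) * Y.a (i + 1) - 2 * (Y.V i (X.n i))
        + Y.V (i + 1) (X.b (i + 2)) + Y.V (i + 2) (X.a (i + 1)) := by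
  rw [fX_apply]
  simp only [eC_bracketTop_eq, hC_bracketTop_eq, fin3_add_one_add_one, fin3_add_one_add_two,
    fin3_add_two_add_one, fin3_add_two_add_two, fin3_ne_add_one, fin3_ne_add_two, fin3_add_one_ne,
    fin3_add_two_ne, fin3_add_one_ne_add_two, fin3_add_two_ne_add_one, if_true, if_false,
    map_add, map_sub, map_neg, map_zero, map_smul, smul_eq_mul, sC_bracket, bC_bracket, rC_bracket,
    sC_boost, sC_rot, bC_rot, rC_boost, bC_boost, rC_rot,
    sC_elem_zero _ i, bC_elem_zero, rC_elem_zero, dC_elem_zero, sC_elem_succ, bC_elem_succ,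
    rC_elem_succ, dC_elem_succ, elem_phi_zero, elem_phi_succ, conf_cyclic _ _ i, rotCoeff,
    Pi.single_apply]
  ring

theorem fO_bracketTop :
    fO (bracketTop X.elem Y.elem) = 0 := by
  rw [fO_apply, fin3_sum_cyclic _ 0]
  simp only [eC_bracketTop_eq, hC_bracketTop_eq, fin3_add_one_add_one, fin3_add_one_add_two,
    fin3_add_two_add_one, fin3_add_two_add_two, fin3_ne_add_one, fin3_ne_add_two, fin3_add_one_ne,
    fin3_add_two_ne, fin3_add_one_ne_add_two, fin3_add_two_ne_add_one, if_true, if_false,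
    map_add, map_sub, map_neg, map_zero, map_smul, smul_eq_mul, sC_bracket, bC_bracket, rC_bracket,
    sC_boost, sC_rot, bC_rot, rC_boost, bC_boost, rC_rot,
    sC_elem_zero _ 0, bC_elem_zero, rC_elem_zero, dC_elem_zero, sC_elem_succ, bC_elem_succ,
    rC_elem_succ, dC_elem_succ, elem_phi_zero, elem_phi_succ, conf_cyclic _ _ 0, rotCoeff,
    Pi.single_apply]
  ring

theorem dC_eC_bracketTop : dC (eC R i (bracketTop X.elem Y.elem)) =
    ⁅X.d0, Y.V i⁆ - ⁅X.V i, Y.d0⁆ + X.p (i + 1) • Y.V i + X.p (i + 2) • Y.V i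
      + Y.p (i + 1) • X.V i + Y.p (i + 2) • X.V i := by
  simp only [eC_bracketTop_eq, fin3_ne_add_one, fin3_ne_add_two, fin3_add_one_ne,
    fin3_add_two_ne, if_true, if_false,
    map_add, map_sub, map_smul, dC_bracket, dC_boost, dC_rot,
    sC_elem_zero _ i, bC_elem_zero, rC_elem_zero, dC_elem_zero, sC_elem_succ, bC_elem_succ,
    dC_elem_succ, Pi.single_apply]
  module

theorem dC_hC_bracketTop : dC (hC R i (bracketTop X.elem Y.elem)) =
    ⁅X.V (i + 1), Y.V (i + 2)⁆ - ⁅X.V (i + 2), Y.V (i + 1)⁆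
      + (2 : R) • (X.n i • Y.V i) + (2 : R) • (Y.n i • X.V i)
      - X.a (i + 2) • Y.V (i + 1) - X.w (i + 2) • Y.V (i + 1)
      - Y.a (i + 2) • X.V (i + 1) - Y.w (i + 2) • X.V (i + 1)
      + X.w (i + 1) • Y.V (i + 2) - X.b (i + 1) • Y.V (i + 2)
      + Y.w (i + 1) • X.V (i + 2) - Y.b (i + 1) • X.V (i + 2) := by
  simp only [hC_bracketTop_eq, fin3_add_one_add_one, fin3_add_one_add_two,
    fin3_add_two_add_one, fin3_add_two_add_two, fin3_ne_add_one, fin3_ne_add_two, fin3_add_one_ne,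
    fin3_add_two_ne, fin3_add_one_ne_add_two, fin3_add_two_ne_add_one, if_true, if_false,
    map_add, map_sub, map_smul, dC_bracket, dC_boost, dC_rot, dC_elem_zero, sC_elem_succ,
    bC_elem_succ, rC_elem_succ, dC_elem_succ, rotCoeff, Pi.single_apply]
  module

theorem act_elem (a : Fin 4) : act (X.elem.1 a).1 Y.elem.2 = fun c =>
    (X.elem.1 a).1.1 c 0 * Y.f + ((X.elem.1 a).1.1 c i.succ * Y.q i
      + (X.elem.1 a).1.1 c (i + 1).succ * Y.q (i + 1)
      + (X.elem.1 a).1.1 c (i + 2).succ * Y.q (i + 2))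
      + dC (X.elem.1 a) (Y.elem.2 c) := by
  ext c
  rw [act, fin4_sum_cyclic _ i]
  rfl

theorem bracketLPhi_fst (x : L1 R) (φ : Fin 4 → R) :
    (bracketLPhi x φ).1 = wedge fun a b => act (x a).1 φ b := by
  have key : ∀ c d, ∑ a, (Pi.single a (act (x a).1 φ) : Fin 4 → Fin 4 → R) c d
      = act (x c).1 φ d := by
    intro c d
    rw [Finset.sum_eq_single c]
    · rw [Pi.single_eq_same]
    · intro b _ hb
      rw [Pi.single_eq_of_ne hb.symm]; rfl
    · simp
  rw [bracketLPhi, Prod.fst_sum]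
  ext p
  rw [Finset.sum_apply]
  simp only [thetaMul, wedge, Finset.sum_sub_distrib, key]

theorem bracketLPhi_snd (x : L1 R) (φ : Fin 4 → R) :
    (bracketLPhi x φ).2 = -∑ a, eta R a * act (x a).1 φ a := by
  rw [bracketLPhi, Prod.snd_sum, ← Finset.sum_neg_distrib]
  rfl

theorem eC_bracketLPhi : eC R i (bracketLPhi X.elem.1 Y.elem.2).1 =
    X.d0 (Y.q i) - X.V i Y.f + X.p (i + 1) * Y.q i + X.p (i + 2) * Y.q i := by
  rw [bracketLPhi_fst, eC_wedge, act_elem _ _ i, act_elem _ _ i]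
  simp only [entry_zero_zero, entry_zero_succ, entry_succ_zero, entry_diag, entry_add_one,
    entry_add_two, sC_elem_zero _ i, bC_elem_zero, rC_elem_zero, dC_elem_zero, sC_elem_succ,
    bC_elem_succ, dC_elem_succ, elem_phi_zero, elem_phi_succ, Pi.single_apply,
    fin3_add_one_ne, fin3_add_two_ne, if_true, if_false]
  ring

theorem hC_bracketLPhi : hC R i (bracketLPhi X.elem.1 Y.elem.2).1 =
    X.V (i + 1) (Y.q (i + 2)) - X.V (i + 2) (Y.q (i + 1)) - X.a (i + 2) * Y.q (i + 1)
      - X.b (i + 1) * Y.q (i + 2) + 2 * (X.n i * Y.q i) - X.w (i + 2) * Y.q (i + 1)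
      + X.w (i + 1) * Y.q (i + 2) := by
  rw [bracketLPhi_fst, hC_wedge, act_elem _ _ i, act_elem _ _ i]
  simp only [entry_succ_zero, entry_diag, entry_add_one_swap, entry_add_two_swap, entry_rot,
    entry_rot_swap, sC_elem_succ, bC_elem_succ, rC_elem_succ, rotCoeff, dC_elem_succ,
    elem_phi_succ, Pi.single_apply, fin3_add_one_add_one, fin3_add_one_add_two,
    fin3_add_two_add_one, fin3_add_two_add_two, fin3_ne_add_one, fin3_ne_add_two,
    fin3_add_one_ne_add_two, fin3_add_two_ne_add_one, if_true, if_false]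
  ring

/-- The top component comes from the dual φ^*, that is, from the η-trace of the derivative of the
field. It carries the wave equation of the scalar field, of which only ∂₀f will survive the
truncation. -/
theorem snd_bracketLPhi : (bracketLPhi X.elem.1 Y.elem.2).2 =
    X.d0 Y.f - X.V i (Y.q i) - X.V (i + 1) (Y.q (i + 1)) - X.V (i + 2) (Y.q (i + 2))
      - X.a i * Y.q i - X.a (i + 1) * Y.q (i + 1) - X.a (i + 2) * Y.q (i + 2)
      + X.b i * Y.q i + X.b (i + 1) * Y.q (i + 1) + X.b (i + 2) * Y.q (i + 2) := by
  rw [bracketLPhi_snd, fin4_sum_cyclic _ i]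
  simp only [act_elem _ _ i]
  simp only [entry_zero_zero, entry_zero_succ, entry_succ_zero, entry_diag, entry_add_one,
    entry_add_two, entry_add_one_swap, entry_add_two_swap, entry_rot, entry_rot_swap,
    sC_elem_zero _ i, bC_elem_zero, rC_elem_zero, dC_elem_zero, sC_elem_succ,
    bC_elem_succ, rC_elem_succ, rotCoeff, dC_elem_succ, elem_phi_zero, elem_phi_succ,
    Pi.single_apply, fin3_add_one_add_one, fin3_add_one_add_two, eta_zero, eta_succ,
    fin3_add_two_add_one, fin3_add_two_add_two, fin3_ne_add_one, fin3_ne_add_two,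
    fin3_add_one_ne, fin3_add_two_ne,
    fin3_add_one_ne_add_two, fin3_add_two_ne_add_one, if_true, if_false]
  ring

end Gauge

end Algebra

section Algebra

set_option linter.unusedSectionVars false
set_option linter.unusedSimpArgs false

variable {R : Type*} [CommRing R] [Algebra ℝ R]

/-! ### The Maurer-Cartan equation in the gauged form -/

/-- The degree with components `x, y, z` at `i, i + 1, i + 2`. -/
def dgc (i : Fin 3) (x y z : ℕ) : Fin 3 → ℕ := fun m => if m = i then x else if m = i + 1 then y else z

theorem dgc_add (i : Fin 3) (x y z x' y' z' : ℕ) :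
    dgc i x y z + dgc i x' y' z' = dgc i (x + x') (y + y') (z + z') := by
  ext m
  simp only [dgc, Pi.add_apply]
  split_ifs <;> rfl

theorem dgc_zero (i : Fin 3) : dgc i 0 0 0 = 0 := by ext m; simp [dgc]
theorem dgc_200 (i : Fin 3) : dgc i 2 0 0 = dg200 i := by
  ext m; revert m; refine fin3_forall_cyclic i ?_ ?_ ?_ <;> simp [dgc, dg200]
theorem dgc_020 (i : Fin 3) : dgc i 0 2 0 = dg200 (i + 1) := by
  ext m; revert m; refine fin3_forall_cyclic i ?_ ?_ ?_ <;> simp [dgc, dg200]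
theorem dgc_002 (i : Fin 3) : dgc i 0 0 2 = dg200 (i + 2) := by
  ext m; revert m; refine fin3_forall_cyclic i ?_ ?_ ?_ <;> simp [dgc, dg200]
theorem dgc_011 (i : Fin 3) : dgc i 0 1 1 = dg011 i := by
  ext m; revert m; refine fin3_forall_cyclic i ?_ ?_ ?_ <;> simp [dgc, dg011]
theorem dgc_101 (i : Fin 3) : dgc i 1 0 1 = dg011 (i + 1) := by
  ext m; revert m; refine fin3_forall_cyclic i ?_ ?_ ?_ <;> simp [dgc, dg011]
theorem dgc_110 (i : Fin 3) : dgc i 1 1 0 = dg011 (i + 2) := by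
  ext m; revert m; refine fin3_forall_cyclic i ?_ ?_ ?_ <;> simp [dgc, dg011]
theorem dgc_211 (i : Fin 3) : dgc i 2 1 1 = dg211 i := by
  ext m; revert m; refine fin3_forall_cyclic i ?_ ?_ ?_ <;> simp [dgc, dg211]

/-- This is the truncation. A monomial whose degree is at least δ = (a, b, c) contributes at γ only
if its degree equals γ; as γ is not strictly above δ, this forces its degree to be δ itself. All
terms of larger degree are discarded. -/
theorem single_dgc {X : Type*} [AddCommGroup X] {γ : Fin 3 → ℕ} {i : Fin 3} {a b c x y z : ℕ}
    (h : ¬ dgc i a b c < γ) (hx : a ≤ x) (hy : b ≤ y) (hz : c ≤ z) (v : X) :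
    (Pi.single (dgc i x y z) v : Series X) γ =
      if γ = dgc i a b c ∧ x = a ∧ y = b ∧ z = c then v else 0 := by
  have hle : dgc i a b c ≤ dgc i x y z := fun m => by
    simp only [dgc]; split_ifs <;> assumption
  by_cases hγ : γ = dgc i x y z
  · have e : dgc i a b c = γ := le_antisymm (hγ ▸ hle) (by
      by_contra hn
      exact h (lt_of_le_not_ge (hγ ▸ hle) hn))
    have e' := e.trans hγ
    have h1 := congrFun e' i
    have h2 := congrFun e' (i + 1)
    have h3 := congrFun e' (i + 2)
    simp [dgc] at h1 h2 h3
    subst h1 h2 h3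
    simp [hγ]
  · rw [Pi.single_eq_of_ne hγ, if_neg]
    rintro ⟨rfl, rfl, rfl, rfl⟩
    exact hγ rfl

/-- A Cauchy product of monomials is a monomial. The pairing is only assumed to vanish at zero, so
that products, actions of derivations and commutators are all covered. -/
theorem sum_single {X Y Z : Type*} [AddCommGroup X] [AddCommGroup Y] [AddCommGroup Z]
    (B : X → Y → Z) (h0 : ∀ y, B 0 y = 0) (h0' : ∀ x, B x 0 = 0) (δ δ' γ : Fin 3 → ℕ) (u : X)
    (v : Y) : ∑ α ∈ Finset.Iic γ, B ((Pi.single δ u : Series X) α)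
      ((Pi.single δ' v : Series Y) (γ - α)) = (Pi.single (δ + δ') (B u v) : Series Z) γ := by
  classical
  by_cases hδ : δ ∈ Finset.Iic γ
  · rw [Finset.sum_eq_single_of_mem δ hδ, Pi.single_eq_same]
    · have hle : δ ≤ γ := Finset.mem_Iic.1 hδ
      by_cases h : γ = δ + δ'
      · subst h
        rw [Pi.single_eq_same, add_tsub_cancel_left, Pi.single_eq_same]
      · rw [Pi.single_eq_of_ne h, Pi.single_eq_of_ne, h0']
        rintro rfl
        exact h (add_tsub_cancel_of_le hle).symm
    · intro α _ hα
      rw [Pi.single_eq_of_ne hα, h0]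
  · rw [Finset.sum_eq_zero, Pi.single_eq_of_ne]
    · rintro rfl
      exact hδ (Finset.mem_Iic.2 le_self_add)
    · intro α hα
      rw [Pi.single_eq_of_ne, h0]
      rintro rfl
      exact hδ hα

theorem sum_single_swap {X Y Z : Type*} [AddCommGroup X] [AddCommGroup Y] [AddCommGroup Z]
    (B : X → Y → Z) (h0 : ∀ y, B 0 y = 0) (h0' : ∀ x, B x 0 = 0) (δ δ' γ : Fin 3 → ℕ) (u : X)
    (v : Y) : ∑ α ∈ Finset.Iic γ, B ((Pi.single δ u : Series X) (γ - α))
      ((Pi.single δ' v : Series Y) α) = (Pi.single (δ + δ') (B u v) : Series Z) γ := by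
  rw [sum_single (fun y x => B x y) h0' h0 δ' δ, add_comm]

section SumSingle

variable (δ δ' γ : Fin 3 → ℕ) (r s : R) (v w : Derivation ℝ R R)

theorem sum_single_mul : ∑ α ∈ Finset.Iic γ, (Pi.single δ r : Series R) α
    * (Pi.single δ' s : Series R) (γ - α) = (Pi.single (δ + δ') (r * s) : Series R) γ :=
  sum_single (fun a b => a * b) zero_mul mul_zero _ _ _ _ _

theorem sum_single_mul_swap : ∑ α ∈ Finset.Iic γ, (Pi.single δ r : Series R) (γ - α)
    * (Pi.single δ' s : Series R) α = (Pi.single (δ + δ') (r * s) : Series R) γ :=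
  sum_single_swap (fun a b => a * b) zero_mul mul_zero _ _ _ _ _

theorem sum_single_apply : ∑ α ∈ Finset.Iic γ, (Pi.single δ v : Series (Derivation ℝ R R)) α
    ((Pi.single δ' s : Series R) (γ - α)) = (Pi.single (δ + δ') (v s) : Series R) γ :=
  sum_single (fun (a : Derivation ℝ R R) b => a b) (fun _ => rfl) (fun a => map_zero a) _ _ _ _ _

theorem sum_single_apply_swap : ∑ α ∈ Finset.Iic γ,
    (Pi.single δ v : Series (Derivation ℝ R R)) (γ - α) ((Pi.single δ' s : Series R) α)
      = (Pi.single (δ + δ') (v s) : Series R) γ :=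
  sum_single_swap (fun (a : Derivation ℝ R R) b => a b) (fun _ => rfl) (fun a => map_zero a)
    _ _ _ _ _

theorem sum_single_smul : ∑ α ∈ Finset.Iic γ, (Pi.single δ r : Series R) α
    • (Pi.single δ' v : Series (Derivation ℝ R R)) (γ - α)
      = (Pi.single (δ + δ') (r • v) : Series (Derivation ℝ R R)) γ :=
  sum_single (fun a b => a • b) (zero_smul _) smul_zero _ _ _ _ _

theorem sum_single_smul_swap : ∑ α ∈ Finset.Iic γ, (Pi.single δ r : Series R) (γ - α)
    • (Pi.single δ' v : Series (Derivation ℝ R R)) α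
      = (Pi.single (δ + δ') (r • v) : Series (Derivation ℝ R R)) γ :=
  sum_single_swap (fun a b => a • b) (zero_smul _) smul_zero _ _ _ _ _

theorem sum_single_lie : ∑ α ∈ Finset.Iic γ, ⁅(Pi.single δ v : Series (Derivation ℝ R R)) α,
    (Pi.single δ' w : Series (Derivation ℝ R R)) (γ - α)⁆
      = (Pi.single (δ + δ') ⁅v, w⁆ : Series (Derivation ℝ R R)) γ :=
  sum_single (fun (a b : Derivation ℝ R R) => ⁅a, b⁆) zero_lie lie_zero _ _ _ _ _

end SumSingle

namespace Gauge

variable (G : Gauge R) (i m : Fin 3) (α γ : Fin 3 → ℕ)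

/-- The coefficients in degree `α`. -/
def part : Gauge R where
  p i := (Pi.single 0 (G.p i) : Series R) α
  n i := (Pi.single (dg200 i) (G.n i) : Series R) α
  w i := (Pi.single (dg011 i) (G.w i) : Series R) α
  a i := (Pi.single (dg011 i) (G.a i) : Series R) α
  b i := (Pi.single (dg011 i) (G.b i) : Series R) α
  q i := (Pi.single (dg011 i) (G.q i) : Series R) α
  f := (Pi.single 0 G.f : Series R) α
  d0 := (Pi.single 0 G.d0 : Series (Derivation ℝ R R)) α
  V i := (Pi.single (dg011 i) (G.V i) : Series (Derivation ℝ R R)) α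

/-- The gauged element of `𝓐¹`. -/
def series : Series (E1 R) := fun α => (G.part α).elem

/-- All supports are expressed relative to one cyclic index i, so that adding degrees becomes
arithmetic with numerals in `dgc_add`. -/
theorem part_p : (G.part α).p m = (Pi.single (dgc i 0 0 0) (G.p m) : Series R) α := by
  rw [dgc_zero]; rfl
theorem part_f : (G.part α).f = (Pi.single (dgc i 0 0 0) G.f : Series R) α := by
  rw [dgc_zero]; rfl
theorem part_d0 : (G.part α).d0
    = (Pi.single (dgc i 0 0 0) G.d0 : Series (Derivation ℝ R R)) α := by
  rw [dgc_zero]; rfl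
theorem part_n : (G.part α).n i = (Pi.single (dgc i 2 0 0) (G.n i) : Series R) α := by
  rw [dgc_200]; rfl
theorem part_n_add_one :
    (G.part α).n (i + 1) = (Pi.single (dgc i 0 2 0) (G.n (i + 1)) : Series R) α := by
  rw [dgc_020]; rfl
theorem part_n_add_two :
    (G.part α).n (i + 2) = (Pi.single (dgc i 0 0 2) (G.n (i + 2)) : Series R) α := by
  rw [dgc_002]; rfl
theorem part_w : (G.part α).w i = (Pi.single (dgc i 0 1 1) (G.w i) : Series R) α := by
  rw [dgc_011]; rfl
theorem part_w_add_one :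
    (G.part α).w (i + 1) = (Pi.single (dgc i 1 0 1) (G.w (i + 1)) : Series R) α := by
  rw [dgc_101]; rfl
theorem part_w_add_two :
    (G.part α).w (i + 2) = (Pi.single (dgc i 1 1 0) (G.w (i + 2)) : Series R) α := by
  rw [dgc_110]; rfl
theorem part_a : (G.part α).a i = (Pi.single (dgc i 0 1 1) (G.a i) : Series R) α := by
  rw [dgc_011]; rfl
theorem part_a_add_one :
    (G.part α).a (i + 1) = (Pi.single (dgc i 1 0 1) (G.a (i + 1)) : Series R) α := by
  rw [dgc_101]; rfl
theorem part_a_add_two :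
    (G.part α).a (i + 2) = (Pi.single (dgc i 1 1 0) (G.a (i + 2)) : Series R) α := by
  rw [dgc_110]; rfl
theorem part_b : (G.part α).b i = (Pi.single (dgc i 0 1 1) (G.b i) : Series R) α := by
  rw [dgc_011]; rfl
theorem part_b_add_one :
    (G.part α).b (i + 1) = (Pi.single (dgc i 1 0 1) (G.b (i + 1)) : Series R) α := by
  rw [dgc_101]; rfl
theorem part_b_add_two :
    (G.part α).b (i + 2) = (Pi.single (dgc i 1 1 0) (G.b (i + 2)) : Series R) α := by
  rw [dgc_110]; rfl
theorem part_q : (G.part α).q i = (Pi.single (dgc i 0 1 1) (G.q i) : Series R) α := by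
  rw [dgc_011]; rfl
theorem part_q_add_one :
    (G.part α).q (i + 1) = (Pi.single (dgc i 1 0 1) (G.q (i + 1)) : Series R) α := by
  rw [dgc_101]; rfl
theorem part_q_add_two :
    (G.part α).q (i + 2) = (Pi.single (dgc i 1 1 0) (G.q (i + 2)) : Series R) α := by
  rw [dgc_110]; rfl
theorem part_V : (G.part α).V i = (Pi.single (dgc i 0 1 1) (G.V i) : Series (Derivation ℝ R R)) α := by
  rw [dgc_011]; rfl
theorem part_V_add_one :
    (G.part α).V (i + 1) = (Pi.single (dgc i 1 0 1) (G.V (i + 1)) : Series (Derivation ℝ R R)) α := by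
  rw [dgc_101]; rfl
theorem part_V_add_two :
    (G.part α).V (i + 2) = (Pi.single (dgc i 1 1 0) (G.V (i + 2)) : Series (Derivation ℝ R R)) α := by
  rw [dgc_110]; rfl

/-- The gauge part of `[x, x]` in degree `γ`, before passing to the quotient by `𝓘²`. -/
def brTop : L2 R := ∑ α ∈ Finset.Iic γ, bracketTop (G.series α) (G.series (γ - α))

/-- The `Φ` part of `[x, x]` in degree `γ`. -/
def brPhi : Phi2 R := ∑ α ∈ Finset.Iic γ, (bracketLPhi (G.series α).1 (G.series (γ - α)).2
  + bracketLPhi (G.series (γ - α)).1 (G.series α).2)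

theorem bracketSeries_eq : bracketSeries G.series G.series γ
    = (Submodule.Quotient.mk (G.brTop γ), G.brPhi γ) := by
  refine Prod.ext ?_ ?_
  · rw [bracketSeries, Prod.fst_sum]
    exact (map_sum (I2 R).mkQ _ _).symm
  · rw [bracketSeries, Prod.snd_sum]; rfl

/-- Only the products of p with p and f with f have degree 0. All terms with n, w, a, b, q or V, the
spatial curvature and gradients, have larger degree, and the Kasner relation with a scalar field
remains. -/
theorem fZ_brTop (h : ¬ 0 < γ) : fZ (G.brTop γ) = if γ = 0 then
      2 * (G.p i * G.p (i + 1) + G.p (i + 1) * G.p (i + 2) + G.p (i + 2) * G.p i - 3 * G.f ^ 2) else 0 := by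
  rw [← dgc_zero i] at h ⊢
  simp only [brTop, series, map_sum, fZ_bracketTop _ _ i]
  simp only [
    part_p _ i, part_f _ i, part_d0 _ i, part_n _ i, part_n_add_one _ i, part_n_add_two _ i,
    part_w _ i, part_w_add_one _ i, part_w_add_two _ i, part_a _ i, part_a_add_one _ i,
    part_a_add_two _ i, part_b _ i, part_b_add_one _ i, part_b_add_two _ i, part_q _ i,
    part_q_add_one _ i, part_q_add_two _ i, part_V _ i, part_V_add_one _ i, part_V_add_two _ i,
    Finset.sum_add_distrib, Finset.sum_sub_distrib, Finset.sum_neg_distrib, ← Finset.mul_sum,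
    ← Finset.smul_sum]
  simp only [
    sum_single_mul, sum_single_mul_swap, sum_single_apply, sum_single_apply_swap,
    sum_single_smul, sum_single_smul_swap, sum_single_lie, dgc_add, Nat.reduceAdd]
  simp only [
    single_dgc h, zero_le, le_refl, Nat.reduceLeDiff, Nat.one_le_ofNat, OfNat.ofNat_ne_zero,
    one_ne_zero, OfNat.ofNat_ne_one, and_true, and_false, true_and, false_and, if_false,
    Nat.reduceEqDiff]
  split_ifs
  · ring
  · ring

theorem fE_brTop (h : ¬ 0 < γ) : fE i (G.brTop γ) = if γ = 0 then
      2 * G.d0 (G.p i) else 0 := by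
  rw [← dgc_zero i] at h ⊢
  simp only [brTop, series, map_sum, fE_bracketTop]
  simp only [
    part_p _ i, part_f _ i, part_d0 _ i, part_n _ i, part_n_add_one _ i, part_n_add_two _ i,
    part_w _ i, part_w_add_one _ i, part_w_add_two _ i, part_a _ i, part_a_add_one _ i,
    part_a_add_two _ i, part_b _ i, part_b_add_one _ i, part_b_add_two _ i, part_q _ i,
    part_q_add_one _ i, part_q_add_two _ i, part_V _ i, part_V_add_one _ i, part_V_add_two _ i,
    Finset.sum_add_distrib, Finset.sum_sub_distrib, Finset.sum_neg_distrib, ← Finset.mul_sum,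
    ← Finset.smul_sum]
  simp only [
    sum_single_mul, sum_single_mul_swap, sum_single_apply, sum_single_apply_swap,
    sum_single_smul, sum_single_smul_swap, sum_single_lie, dgc_add, Nat.reduceAdd]
  simp only [
    single_dgc h, zero_le, le_refl, Nat.reduceLeDiff, Nat.one_le_ofNat, OfNat.ofNat_ne_zero,
    one_ne_zero, OfNat.ofNat_ne_one, and_true, and_false, true_and, false_and, if_false,
    Nat.reduceEqDiff]
  split_ifs
  · ring
  · ring

theorem fN_brTop (h : ¬ dg200 i < γ) : fN i (G.brTop γ) = if γ = dg200 i then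
      4 * (G.d0 (G.n i) + 2 * G.p i * G.n i) else 0 := by
  rw [← dgc_200 i] at h ⊢
  simp only [brTop, series, map_sum, fN_bracketTop]
  simp only [
    part_p _ i, part_f _ i, part_d0 _ i, part_n _ i, part_n_add_one _ i, part_n_add_two _ i,
    part_w _ i, part_w_add_one _ i, part_w_add_two _ i, part_a _ i, part_a_add_one _ i,
    part_a_add_two _ i, part_b _ i, part_b_add_one _ i, part_b_add_two _ i, part_q _ i,
    part_q_add_one _ i, part_q_add_two _ i, part_V _ i, part_V_add_one _ i, part_V_add_two _ i,
    Finset.sum_add_distrib, Finset.sum_sub_distrib, Finset.sum_neg_distrib, ← Finset.mul_sum,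
    ← Finset.smul_sum]
  simp only [
    sum_single_mul, sum_single_mul_swap, sum_single_apply, sum_single_apply_swap,
    sum_single_smul, sum_single_smul_swap, sum_single_lie, dgc_add, Nat.reduceAdd]
  simp only [
    single_dgc h, zero_le, le_refl, Nat.reduceLeDiff, Nat.one_le_ofNat, OfNat.ofNat_ne_zero,
    one_ne_zero, OfNat.ofNat_ne_one, and_true, and_false, true_and, false_and, if_false,
    Nat.reduceEqDiff]
  split_ifs
  · ring
  · ring

theorem fW_brTop (h : ¬ dg011 i < γ) : fW i (G.brTop γ) = if γ = dg011 i then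
      2 * (G.d0 (G.w i) - G.V i (G.p i) - G.V i (G.p (i + 1)) - G.V i (G.p (i + 2))
      + (G.p (i + 1) + G.p (i + 2)) * G.w i) else 0 := by
  rw [← dgc_011 i] at h ⊢
  simp only [brTop, series, map_sum, fW_bracketTop]
  simp only [
    part_p _ i, part_f _ i, part_d0 _ i, part_n _ i, part_n_add_one _ i, part_n_add_two _ i,
    part_w _ i, part_w_add_one _ i, part_w_add_two _ i, part_a _ i, part_a_add_one _ i,
    part_a_add_two _ i, part_b _ i, part_b_add_one _ i, part_b_add_two _ i, part_q _ i,
    part_q_add_one _ i, part_q_add_two _ i, part_V _ i, part_V_add_one _ i, part_V_add_two _ i,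
    Finset.sum_add_distrib, Finset.sum_sub_distrib, Finset.sum_neg_distrib, ← Finset.mul_sum,
    ← Finset.smul_sum]
  simp only [
    sum_single_mul, sum_single_mul_swap, sum_single_apply, sum_single_apply_swap,
    sum_single_smul, sum_single_smul_swap, sum_single_lie, dgc_add, Nat.reduceAdd]
  simp only [
    single_dgc h, zero_le, le_refl, Nat.reduceLeDiff, Nat.one_le_ofNat, OfNat.ofNat_ne_zero,
    one_ne_zero, OfNat.ofNat_ne_one, and_true, and_false, true_and, false_and, if_false,
    Nat.reduceEqDiff]
  split_ifs
  · ring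
  · ring

/-- Every term of this coordinate has degree strictly above e_j + e_k, so the off-diagonal evolution
equation is empty after truncation. -/
theorem fY_brTop (h : ¬ dg011 i < γ) : fY i (G.brTop γ) = 0 := by
  rw [← dgc_011 i] at h
  simp only [brTop, series, map_sum, fY_bracketTop]
  simp only [
    part_p _ i, part_f _ i, part_d0 _ i, part_n _ i, part_n_add_one _ i, part_n_add_two _ i,
    part_w _ i, part_w_add_one _ i, part_w_add_two _ i, part_a _ i, part_a_add_one _ i,
    part_a_add_two _ i, part_b _ i, part_b_add_one _ i, part_b_add_two _ i, part_q _ i,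
    part_q_add_one _ i, part_q_add_two _ i, part_V _ i, part_V_add_one _ i, part_V_add_two _ i,
    Finset.sum_add_distrib, Finset.sum_sub_distrib, Finset.sum_neg_distrib, ← Finset.mul_sum,
    ← Finset.smul_sum]
  simp only [
    sum_single_mul, sum_single_mul_swap, sum_single_apply, sum_single_apply_swap,
    sum_single_smul, sum_single_smul_swap, sum_single_lie, dgc_add, Nat.reduceAdd]
  simp only [
    single_dgc h, zero_le, le_refl, Nat.reduceLeDiff, Nat.one_le_ofNat, OfNat.ofNat_ne_zero,
    one_ne_zero, OfNat.ofNat_ne_one, and_true, and_false, true_and, false_and, if_false,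
    Nat.reduceEqDiff]
  ring

theorem fA_brTop (h : ¬ dg011 i < γ) : fA i (G.brTop γ) = if γ = dg011 i then
      2 * (G.d0 (G.a i) + G.V i (G.p (i + 2)) + (G.p (i + 1) + G.p (i + 2)) * G.a i) else 0 := by
  rw [← dgc_011 i] at h ⊢
  simp only [brTop, series, map_sum, fA_bracketTop]
  simp only [
    part_p _ i, part_f _ i, part_d0 _ i, part_n _ i, part_n_add_one _ i, part_n_add_two _ i,
    part_w _ i, part_w_add_one _ i, part_w_add_two _ i, part_a _ i, part_a_add_one _ i,
    part_a_add_two _ i, part_b _ i, part_b_add_one _ i, part_b_add_two _ i, part_q _ i,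
    part_q_add_one _ i, part_q_add_two _ i, part_V _ i, part_V_add_one _ i, part_V_add_two _ i,
    Finset.sum_add_distrib, Finset.sum_sub_distrib, Finset.sum_neg_distrib, ← Finset.mul_sum,
    ← Finset.smul_sum]
  simp only [
    sum_single_mul, sum_single_mul_swap, sum_single_apply, sum_single_apply_swap,
    sum_single_smul, sum_single_smul_swap, sum_single_lie, dgc_add, Nat.reduceAdd]
  simp only [
    single_dgc h, zero_le, le_refl, Nat.reduceLeDiff, Nat.one_le_ofNat, OfNat.ofNat_ne_zero,
    one_ne_zero, OfNat.ofNat_ne_one, and_true, and_false, true_and, false_and, if_false,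
    Nat.reduceEqDiff]
  split_ifs
  · ring
  · ring

theorem fB_brTop (h : ¬ dg011 i < γ) : fB i (G.brTop γ) = if γ = dg011 i then
      2 * (G.d0 (G.b i) - G.V i (G.p (i + 1)) + (G.p (i + 1) + G.p (i + 2)) * G.b i) else 0 := by
  rw [← dgc_011 i] at h ⊢
  simp only [brTop, series, map_sum, fB_bracketTop]
  simp only [
    part_p _ i, part_f _ i, part_d0 _ i, part_n _ i, part_n_add_one _ i, part_n_add_two _ i,
    part_w _ i, part_w_add_one _ i, part_w_add_two _ i, part_a _ i, part_a_add_one _ i,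
    part_a_add_two _ i, part_b _ i, part_b_add_one _ i, part_b_add_two _ i, part_q _ i,
    part_q_add_one _ i, part_q_add_two _ i, part_V _ i, part_V_add_one _ i, part_V_add_two _ i,
    Finset.sum_add_distrib, Finset.sum_sub_distrib, Finset.sum_neg_distrib, ← Finset.mul_sum,
    ← Finset.smul_sum]
  simp only [
    sum_single_mul, sum_single_mul_swap, sum_single_apply, sum_single_apply_swap,
    sum_single_smul, sum_single_smul_swap, sum_single_lie, dgc_add, Nat.reduceAdd]
  simp only [
    single_dgc h, zero_le, le_refl, Nat.reduceLeDiff, Nat.one_le_ofNat, OfNat.ofNat_ne_zero,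
    one_ne_zero, OfNat.ofNat_ne_one, and_true, and_false, true_and, false_and, if_false,
    Nat.reduceEqDiff]
  split_ifs
  · ring
  · ring

/-- The momentum equation. Each term pairs a coefficient of degree 0 with one of degree e_j + e_k,
so the truncation removes nothing. -/
theorem fT_brTop (h : ¬ dg011 i < γ) : fT i (G.brTop γ) = if γ = dg011 i then
      2 * (G.V i (G.p (i + 1)) + G.V i (G.p (i + 2)) - G.a i * (G.p i - G.p (i + 2))
      + G.b i * (G.p i - G.p (i + 1)) - 6 * G.f * G.q i + (G.p (i + 1) + G.p (i + 2)) * G.w i) else 0 := by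
  rw [← dgc_011 i] at h ⊢
  simp only [brTop, series, map_sum, fT_bracketTop]
  simp only [
    part_p _ i, part_f _ i, part_d0 _ i, part_n _ i, part_n_add_one _ i, part_n_add_two _ i,
    part_w _ i, part_w_add_one _ i, part_w_add_two _ i, part_a _ i, part_a_add_one _ i,
    part_a_add_two _ i, part_b _ i, part_b_add_one _ i, part_b_add_two _ i, part_q _ i,
    part_q_add_one _ i, part_q_add_two _ i, part_V _ i, part_V_add_one _ i, part_V_add_two _ i,
    Finset.sum_add_distrib, Finset.sum_sub_distrib, Finset.sum_neg_distrib, ← Finset.mul_sum,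
    ← Finset.smul_sum]
  simp only [
    sum_single_mul, sum_single_mul_swap, sum_single_apply, sum_single_apply_swap,
    sum_single_smul, sum_single_smul_swap, sum_single_lie, dgc_add, Nat.reduceAdd]
  simp only [
    single_dgc h, zero_le, le_refl, Nat.reduceLeDiff, Nat.one_le_ofNat, OfNat.ofNat_ne_zero,
    one_ne_zero, OfNat.ofNat_ne_one, and_true, and_false, true_and, false_and, if_false,
    Nat.reduceEqDiff]
  split_ifs
  · ring
  · ring

theorem fU_brTop (h : ¬ dg211 i < γ) : fU i (G.brTop γ) = if γ = dg211 i then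
      2 * (G.V (i + 1) (G.w (i + 2)) - G.V (i + 2) (G.w (i + 1)) + 2 * G.n i * G.w i
      - G.a (i + 2) * G.w (i + 1) - G.b (i + 1) * G.w (i + 2)) else 0 := by
  rw [← dgc_211 i] at h ⊢
  simp only [brTop, series, map_sum, fU_bracketTop]
  simp only [
    part_p _ i, part_f _ i, part_d0 _ i, part_n _ i, part_n_add_one _ i, part_n_add_two _ i,
    part_w _ i, part_w_add_one _ i, part_w_add_two _ i, part_a _ i, part_a_add_one _ i,
    part_a_add_two _ i, part_b _ i, part_b_add_one _ i, part_b_add_two _ i, part_q _ i,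
    part_q_add_one _ i, part_q_add_two _ i, part_V _ i, part_V_add_one _ i, part_V_add_two _ i,
    Finset.sum_add_distrib, Finset.sum_sub_distrib, Finset.sum_neg_distrib, ← Finset.mul_sum,
    ← Finset.smul_sum]
  simp only [
    sum_single_mul, sum_single_mul_swap, sum_single_apply, sum_single_apply_swap,
    sum_single_smul, sum_single_smul_swap, sum_single_lie, dgc_add, Nat.reduceAdd]
  simp only [
    single_dgc h, zero_le, le_refl, Nat.reduceLeDiff, Nat.one_le_ofNat, OfNat.ofNat_ne_zero,
    one_ne_zero, OfNat.ofNat_ne_one, and_true, and_false, true_and, false_and, if_false,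
    Nat.reduceEqDiff]
  split_ifs
  · ring
  · ring

/-- All terms have degree exactly 2e_i + e_j + e_k and survive. The resulting identity is recognized
in `LieV.jacobi` as a consequence of the Jacobi identity. -/
theorem fX_brTop (h : ¬ dg211 i < γ) : fX i (G.brTop γ) = if γ = dg211 i then
      2 * (G.V (i + 1) (G.b (i + 2)) + G.V (i + 2) (G.a (i + 1)) - 2 * G.V i (G.n i)
      + 2 * G.n i * (G.b i - G.a i - G.w i) + G.a (i + 1) * G.a (i + 2) - G.b (i + 1) * G.b (i + 2)
      + G.a (i + 1) * G.w (i + 2) + G.b (i + 2) * G.w (i + 1)) else 0 := by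
  rw [← dgc_211 i] at h ⊢
  simp only [brTop, series, map_sum, fX_bracketTop]
  simp only [
    part_p _ i, part_f _ i, part_d0 _ i, part_n _ i, part_n_add_one _ i, part_n_add_two _ i,
    part_w _ i, part_w_add_one _ i, part_w_add_two _ i, part_a _ i, part_a_add_one _ i,
    part_a_add_two _ i, part_b _ i, part_b_add_one _ i, part_b_add_two _ i, part_q _ i,
    part_q_add_one _ i, part_q_add_two _ i, part_V _ i, part_V_add_one _ i, part_V_add_two _ i,
    Finset.sum_add_distrib, Finset.sum_sub_distrib, Finset.sum_neg_distrib, ← Finset.mul_sum,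
    ← Finset.smul_sum]
  simp only [
    sum_single_mul, sum_single_mul_swap, sum_single_apply, sum_single_apply_swap,
    sum_single_smul, sum_single_smul_swap, sum_single_lie, dgc_add, Nat.reduceAdd]
  simp only [
    single_dgc h, zero_le, le_refl, Nat.reduceLeDiff, Nat.one_le_ofNat, OfNat.ofNat_ne_zero,
    one_ne_zero, OfNat.ofNat_ne_one, and_true, and_false, true_and, false_and, if_false,
    Nat.reduceEqDiff]
  split_ifs
  · ring
  · ring

theorem dC_eC_brTop (h : ¬ dg011 i < γ) : dC (eC R i (G.brTop γ)) = if γ = dg011 i then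
      (2 : R) • (⁅G.d0, G.V i⁆ + (G.p (i + 1) + G.p (i + 2)) • G.V i) else 0 := by
  rw [← dgc_011 i] at h ⊢
  simp only [brTop, series, map_sum, dC_eC_bracketTop]
  simp only [
    part_p _ i, part_f _ i, part_d0 _ i, part_n _ i, part_n_add_one _ i, part_n_add_two _ i,
    part_w _ i, part_w_add_one _ i, part_w_add_two _ i, part_a _ i, part_a_add_one _ i,
    part_a_add_two _ i, part_b _ i, part_b_add_one _ i, part_b_add_two _ i, part_q _ i,
    part_q_add_one _ i, part_q_add_two _ i, part_V _ i, part_V_add_one _ i, part_V_add_two _ i,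
    Finset.sum_add_distrib, Finset.sum_sub_distrib, Finset.sum_neg_distrib, ← Finset.mul_sum,
    ← Finset.smul_sum]
  simp only [
    sum_single_mul, sum_single_mul_swap, sum_single_apply, sum_single_apply_swap,
    sum_single_smul, sum_single_smul_swap, sum_single_lie, dgc_add, Nat.reduceAdd]
  simp only [
    single_dgc h, zero_le, le_refl, Nat.reduceLeDiff, Nat.one_le_ofNat, OfNat.ofNat_ne_zero,
    one_ne_zero, OfNat.ofNat_ne_one, and_true, and_false, true_and, false_and, if_false,
    Nat.reduceEqDiff]
  split_ifs
  · rw [← lie_skew G.d0]; module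
  · module

theorem dC_hC_brTop (h : ¬ dg211 i < γ) : dC (hC R i (G.brTop γ)) = if γ = dg211 i then
      (2 : R) • (⁅G.V (i + 1), G.V (i + 2)⁆
      + (2 * G.n i) • G.V i - (G.a (i + 2) + G.w (i + 2)) • G.V (i + 1)
      + (G.w (i + 1) - G.b (i + 1)) • G.V (i + 2)) else 0 := by
  rw [← dgc_211 i] at h ⊢
  simp only [brTop, series, map_sum, dC_hC_bracketTop]
  simp only [
    part_p _ i, part_f _ i, part_d0 _ i, part_n _ i, part_n_add_one _ i, part_n_add_two _ i,
    part_w _ i, part_w_add_one _ i, part_w_add_two _ i, part_a _ i, part_a_add_one _ i,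
    part_a_add_two _ i, part_b _ i, part_b_add_one _ i, part_b_add_two _ i, part_q _ i,
    part_q_add_one _ i, part_q_add_two _ i, part_V _ i, part_V_add_one _ i, part_V_add_two _ i,
    Finset.sum_add_distrib, Finset.sum_sub_distrib, Finset.sum_neg_distrib, ← Finset.mul_sum,
    ← Finset.smul_sum]
  simp only [
    sum_single_mul, sum_single_mul_swap, sum_single_apply, sum_single_apply_swap,
    sum_single_smul, sum_single_smul_swap, sum_single_lie, dgc_add, Nat.reduceAdd]
  simp only [
    single_dgc h, zero_le, le_refl, Nat.reduceLeDiff, Nat.one_le_ofNat, OfNat.ofNat_ne_zero,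
    one_ne_zero, OfNat.ofNat_ne_one, and_true, and_false, true_and, false_and, if_false,
    Nat.reduceEqDiff]
  split_ifs
  · rw [← lie_skew (G.V (i + 1))]; module
  · module

theorem phi_top_brPhi (h : ¬ 0 < γ) : (G.brPhi γ).2 = if γ = 0 then
      2 * G.d0 G.f else 0 := by
  rw [← dgc_zero 0] at h ⊢
  simp only [brPhi, series, Prod.snd_sum, Prod.snd_add, snd_bracketLPhi _ _ 0]
  simp only [
    part_p _ 0, part_f _ 0, part_d0 _ 0, part_n _ 0, part_n_add_one _ 0, part_n_add_two _ 0,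
    part_w _ 0, part_w_add_one _ 0, part_w_add_two _ 0, part_a _ 0, part_a_add_one _ 0,
    part_a_add_two _ 0, part_b _ 0, part_b_add_one _ 0, part_b_add_two _ 0, part_q _ 0,
    part_q_add_one _ 0, part_q_add_two _ 0, part_V _ 0, part_V_add_one _ 0, part_V_add_two _ 0,
    Finset.sum_add_distrib, Finset.sum_sub_distrib, Finset.sum_neg_distrib, ← Finset.mul_sum,
    ← Finset.smul_sum]
  simp only [
    sum_single_mul, sum_single_mul_swap, sum_single_apply, sum_single_apply_swap,
    sum_single_smul, sum_single_smul_swap, sum_single_lie, dgc_add, Nat.reduceAdd]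
  simp only [
    single_dgc h, zero_le, le_refl, Nat.reduceLeDiff, Nat.one_le_ofNat, OfNat.ofNat_ne_zero,
    one_ne_zero, OfNat.ofNat_ne_one, and_true, and_false, true_and, false_and, if_false,
    Nat.reduceEqDiff]
  split_ifs
  · ring
  · ring

theorem phi_e_brPhi (h : ¬ dg011 i < γ) : eC R i (G.brPhi γ).1 = if γ = dg011 i then
      2 * (G.d0 (G.q i) - G.V i G.f + (G.p (i + 1) + G.p (i + 2)) * G.q i) else 0 := by
  rw [← dgc_011 i] at h ⊢
  simp only [brPhi, series, Prod.fst_sum, Prod.fst_add, map_sum, map_add, eC_bracketLPhi]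
  simp only [
    part_p _ i, part_f _ i, part_d0 _ i, part_n _ i, part_n_add_one _ i, part_n_add_two _ i,
    part_w _ i, part_w_add_one _ i, part_w_add_two _ i, part_a _ i, part_a_add_one _ i,
    part_a_add_two _ i, part_b _ i, part_b_add_one _ i, part_b_add_two _ i, part_q _ i,
    part_q_add_one _ i, part_q_add_two _ i, part_V _ i, part_V_add_one _ i, part_V_add_two _ i,
    Finset.sum_add_distrib, Finset.sum_sub_distrib, Finset.sum_neg_distrib, ← Finset.mul_sum,
    ← Finset.smul_sum]
  simp only [
    sum_single_mul, sum_single_mul_swap, sum_single_apply, sum_single_apply_swap,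
    sum_single_smul, sum_single_smul_swap, sum_single_lie, dgc_add, Nat.reduceAdd]
  simp only [
    single_dgc h, zero_le, le_refl, Nat.reduceLeDiff, Nat.one_le_ofNat, OfNat.ofNat_ne_zero,
    one_ne_zero, OfNat.ofNat_ne_one, and_true, and_false, true_and, false_and, if_false,
    Nat.reduceEqDiff]
  split_ifs
  · ring
  · ring

theorem phi_h_brPhi (h : ¬ dg211 i < γ) : hC R i (G.brPhi γ).1 = if γ = dg211 i then
      2 * (G.V (i + 1) (G.q (i + 2)) - G.V (i + 2) (G.q (i + 1)) - G.a (i + 2) * G.q (i + 1)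
      - G.b (i + 1) * G.q (i + 2) + 2 * G.n i * G.q i - G.w (i + 2) * G.q (i + 1)
      + G.w (i + 1) * G.q (i + 2)) else 0 := by
  rw [← dgc_211 i] at h ⊢
  simp only [brPhi, series, Prod.fst_sum, Prod.fst_add, map_sum, map_add, hC_bracketLPhi]
  simp only [
    part_p _ i, part_f _ i, part_d0 _ i, part_n _ i, part_n_add_one _ i, part_n_add_two _ i,
    part_w _ i, part_w_add_one _ i, part_w_add_two _ i, part_a _ i, part_a_add_one _ i,
    part_a_add_two _ i, part_b _ i, part_b_add_one _ i, part_b_add_two _ i, part_q _ i,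
    part_q_add_one _ i, part_q_add_two _ i, part_V _ i, part_V_add_one _ i, part_V_add_two _ i,
    Finset.sum_add_distrib, Finset.sum_sub_distrib, Finset.sum_neg_distrib, ← Finset.mul_sum,
    ← Finset.smul_sum]
  simp only [
    sum_single_mul, sum_single_mul_swap, sum_single_apply, sum_single_apply_swap,
    sum_single_smul, sum_single_smul_swap, sum_single_lie, dgc_add, Nat.reduceAdd]
  simp only [
    single_dgc h, zero_le, le_refl, Nat.reduceLeDiff, Nat.one_le_ofNat, OfNat.ofNat_ne_zero,
    one_ne_zero, OfNat.ofNat_ne_one, and_true, and_false, true_and, false_and, if_false,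
    Nat.reduceEqDiff]
  split_ifs
  · ring
  · ring

theorem fK_brTop : fK i (G.brTop γ) = 0 := by
  simp only [brTop, series, map_sum, fK_bracketTop, Finset.sum_const_zero]

theorem fO_brTop : fO (G.brTop γ) = 0 := by
  simp only [brTop, series, map_sum, fO_bracketTop, Finset.sum_const_zero]

end Gauge

end Algebra

/-! ### The Maurer-Cartan equation as a system for the coefficients -/

section Algebra

set_option linter.unusedSectionVars false

variable {R : Type*} [CommRing R] [Algebra ℝ R]

theorem eq_zero_of_two_smul {X : Type*} [AddCommGroup X] [Module R X] {x : X}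
    (h : (2 : R) • x = 0) : x = 0 := by
  have : x ∈ (⊥ : Submodule R X) := by
    refine mem_of_two_smul 2 two_ne_zero ?_
    rw [map_ofNat, h]
    exact zero_mem _
  exact this

theorem eq_zero_of_two_mul {x : R} (h : 2 * x = 0) : x = 0 :=
  eq_zero_of_two_smul (R := R) h

namespace Gauge

/-- The Maurer-Cartan equations for the coefficients of a gauged element. -/
structure Equations (G : Gauge R) : Prop where
  hamiltonian : G.p 0 * G.p 1 + G.p 1 * G.p 2 + G.p 2 * G.p 0 - 3 * G.f ^ 2 = 0
  d0_p : ∀ i, G.d0 (G.p i) = 0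
  d0_f : G.d0 G.f = 0
  d0_n : ∀ i, G.d0 (G.n i) + 2 * G.p i * G.n i = 0
  d0_w : ∀ i, G.d0 (G.w i) - G.V i (G.p i) - G.V i (G.p (i + 1)) - G.V i (G.p (i + 2))
    + (G.p (i + 1) + G.p (i + 2)) * G.w i = 0
  d0_a : ∀ i, G.d0 (G.a i) + G.V i (G.p (i + 2)) + (G.p (i + 1) + G.p (i + 2)) * G.a i = 0
  d0_b : ∀ i, G.d0 (G.b i) - G.V i (G.p (i + 1)) + (G.p (i + 1) + G.p (i + 2)) * G.b i = 0
  d0_q : ∀ i, G.d0 (G.q i) - G.V i G.f + (G.p (i + 1) + G.p (i + 2)) * G.q i = 0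
  d0_V : ∀ i, ⁅G.d0, G.V i⁆ + (G.p (i + 1) + G.p (i + 2)) • G.V i = 0
  momentum : ∀ i, G.V i (G.p (i + 1)) + G.V i (G.p (i + 2)) - G.a i * (G.p i - G.p (i + 2))
    + G.b i * (G.p i - G.p (i + 1)) - 6 * G.f * G.q i + (G.p (i + 1) + G.p (i + 2)) * G.w i = 0
  lie_V : ∀ i, ⁅G.V (i + 1), G.V (i + 2)⁆ + (2 * G.n i) • G.V i
    - (G.a (i + 2) + G.w (i + 2)) • G.V (i + 1) + (G.w (i + 1) - G.b (i + 1)) • G.V (i + 2) = 0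
  curl_w : ∀ i, G.V (i + 1) (G.w (i + 2)) - G.V (i + 2) (G.w (i + 1)) + 2 * G.n i * G.w i
    - G.a (i + 2) * G.w (i + 1) - G.b (i + 1) * G.w (i + 2) = 0
  curl_q : ∀ i, G.V (i + 1) (G.q (i + 2)) - G.V (i + 2) (G.q (i + 1)) - G.a (i + 2) * G.q (i + 1)
    - G.b (i + 1) * G.q (i + 2) + 2 * G.n i * G.q i - G.w (i + 2) * G.q (i + 1)
    + G.w (i + 1) * G.q (i + 2) = 0
  jacobi : ∀ i, G.V (i + 1) (G.b (i + 2)) + G.V (i + 2) (G.a (i + 1)) - 2 * G.V i (G.n i)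
    + 2 * G.n i * (G.b i - G.a i - G.w i) + G.a (i + 1) * G.a (i + 2) - G.b (i + 1) * G.b (i + 2)
    + G.a (i + 1) * G.w (i + 2) + G.b (i + 2) * G.w (i + 1) = 0

variable (G : Gauge R)

theorem bracketA_eq_zero_iff_mem : bracketA G.series G.series = 0 ↔
    ∀ γ, ((Submodule.Quotient.mk (G.brTop γ), G.brPhi γ) : E2 R) ∈ lowerF2 R γ := by
  rw [bracketA, Submodule.Quotient.mk_eq_zero, mem_sRees2_iff]
  simp only [bracketSeries_eq]

/-- Each equation is read off in the degree γ of its own generator, where the functional is well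
defined and the truncated formula is nontrivial. -/
theorem equations_of_bracketA_eq_zero (h : bracketA G.series G.series = 0) : G.Equations := by
  rw [bracketA_eq_zero_iff_mem] at h
  have h0 := h 0
  have hn0 : ¬ (0 : Fin 3 → ℕ) < 0 := lt_irrefl _
  have h2 : ∀ i, ¬ dg200 i < dg200 i := fun i => lt_irrefl _
  have h11 : ∀ i, ¬ dg011 i < dg011 i := fun i => lt_irrefl _
  have h21 : ∀ i, ¬ dg211 i < dg211 i := fun i => lt_irrefl _
  constructor
  · have := fZ_eq_zero h0
    rw [fZ_brTop G 0 0 hn0, if_pos rfl] at this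
    exact eq_zero_of_two_mul this
  · intro i
    have := fE_eq_zero i h0
    rw [fE_brTop G i 0 hn0, if_pos rfl] at this
    exact eq_zero_of_two_mul this
  · have := phi_top_eq_zero h0
    rw [phi_top_brPhi G 0 hn0, if_pos rfl] at this
    exact eq_zero_of_two_mul this
  · intro i
    have := fN_eq_zero i (h (dg200 i))
    rw [fN_brTop G i _ (h2 i), if_pos rfl] at this
    -- The N coordinate carries the factor 4, removed by halving twice.
    exact eq_zero_of_two_mul (eq_zero_of_two_mul (by rw [← this]; ring))
  · intro i
    have := fW_eq_zero i (h (dg011 i))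
    rw [fW_brTop G i _ (h11 i), if_pos rfl] at this
    exact eq_zero_of_two_mul this
  · intro i
    have := fA_eq_zero i (h (dg011 i))
    rw [fA_brTop G i _ (h11 i), if_pos rfl] at this
    exact eq_zero_of_two_mul this
  · intro i
    have := fB_eq_zero i (h (dg011 i))
    rw [fB_brTop G i _ (h11 i), if_pos rfl] at this
    exact eq_zero_of_two_mul this
  · intro i
    have := phi_e_eq_zero i (h (dg011 i))
    rw [phi_e_brPhi G i _ (h11 i), if_pos rfl] at this
    exact eq_zero_of_two_mul this
  · intro i
    have := dC_eC_eq_zero i (h (dg011 i))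
    rw [dC_eC_brTop G i _ (h11 i), if_pos rfl] at this
    exact eq_zero_of_two_smul this
  · intro i
    have := fT_eq_zero i (h (dg011 i))
    rw [fT_brTop G i _ (h11 i), if_pos rfl] at this
    exact eq_zero_of_two_mul this
  · intro i
    have := dC_hC_eq_zero i (h (dg211 i))
    rw [dC_hC_brTop G i _ (h21 i), if_pos rfl] at this
    exact eq_zero_of_two_smul this
  · intro i
    have := fU_eq_zero i (h (dg211 i))
    rw [fU_brTop G i _ (h21 i), if_pos rfl] at this
    exact eq_zero_of_two_mul this
  · intro i
    have := phi_h_eq_zero i (h (dg211 i))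
    rw [phi_h_brPhi G i _ (h21 i), if_pos rfl] at this
    exact eq_zero_of_two_mul this
  · intro i
    have := fX_eq_zero i (h (dg211 i))
    rw [fX_brTop G i _ (h21 i), if_pos rfl] at this
    exact eq_zero_of_two_mul this

/-- For each of the infinitely many γ, a coordinate is irrelevant if its generator lies below γ,
zero by truncation if γ is another degree, and zero by the equations if γ is the degree of the
generator. -/
theorem Equations.bracketA_eq_zero {G : Gauge R} (h : G.Equations) :
    bracketA G.series G.series = 0 := by
  rw [bracketA_eq_zero_iff_mem]
  intro γ
  have e : ((Submodule.Quotient.mk (G.brTop γ), G.brPhi γ) : E2 R)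
      = (Submodule.Quotient.mk (G.brTop γ), 0) + (0, G.brPhi γ) :=
    Prod.ext (add_zero _).symm (zero_add _).symm
  rw [e]
  refine add_mem (mem_lowerF2_gauge (fun hγ => ⟨?_, fun i => ?_⟩) (fun i hγ => ?_)
    (fun i hγ => ⟨?_, fY_brTop G i γ hγ, ?_, ?_, ?_, ?_⟩)
    (fun i hγ => ⟨fK_brTop G i γ, ?_, ?_, ?_⟩) (fO_brTop G γ))
    (mem_lowerF2_phi (fun hγ => ?_) (fun i hγ => ?_) (fun i hγ => ?_))
  · rw [fZ_brTop G 0 γ hγ]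
    exact (congrArg (fun x => if γ = 0 then 2 * x else 0) h.hamiltonian).trans (by simp)
  · rw [fE_brTop G i γ hγ, h.d0_p, mul_zero, ite_self]
  · rw [fN_brTop G i γ hγ, h.d0_n, mul_zero, ite_self]
  · rw [fW_brTop G i γ hγ, h.d0_w, mul_zero, ite_self]
  · rw [fA_brTop G i γ hγ, h.d0_a, mul_zero, ite_self]
  · rw [fB_brTop G i γ hγ, h.d0_b, mul_zero, ite_self]
  · rw [fT_brTop G i γ hγ, h.momentum, mul_zero, ite_self]
  · rw [dC_eC_brTop G i γ hγ, h.d0_V, smul_zero, ite_self]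
  · rw [fU_brTop G i γ hγ, h.curl_w, mul_zero, ite_self]
  · rw [fX_brTop G i γ hγ, h.jacobi, mul_zero, ite_self]
  · rw [dC_hC_brTop G i γ hγ, h.lie_V, smul_zero, ite_self]
  · rw [phi_top_brPhi G γ hγ, h.d0_f, mul_zero, ite_self]
  · rw [phi_e_brPhi G i γ hγ, h.d0_q, mul_zero, ite_self]
  · rw [phi_h_brPhi G i γ hγ, h.curl_q, mul_zero, ite_self]

/-! ### Gauged elements as series -/

/-- Addition of coefficients. -/
def add (G H : Gauge R) : Gauge R :=
  ⟨G.p + H.p, G.n + H.n, G.w + H.w, G.a + H.a, G.b + H.b, G.q + H.q, G.f + H.f, G.d0 + H.d0,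
    G.V + H.V⟩

/-- Multiplication of coefficients by a function. -/
def smul (c : R) (G : Gauge R) : Gauge R :=
  ⟨c • G.p, c • G.n, c • G.w, c • G.a, c • G.b, c • G.q, c • G.f, c • G.d0, c • G.V⟩

theorem E1_ext {x y : E1 R} (h0 : x.1 0 = y.1 0) (h1 : ∀ i : Fin 3, x.1 i.succ = y.1 i.succ)
    (h2 : x.2 0 = y.2 0) (h3 : ∀ i : Fin 3, x.2 i.succ = y.2 i.succ) : x = y :=
  Prod.ext (funext (Fin.cases h0 h1)) (funext (Fin.cases h2 h3))

theorem elem_add (G H : Gauge R) : (G.add H).elem = G.elem + H.elem := by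
  refine E1_ext (CDer.ext_coord ?_ ?_ ?_ ?_)
    (fun i => CDer.ext_coord ?_ ?_ (fin3_forall_cyclic i ?_ ?_ ?_) ?_) rfl (fun _ => rfl)
  all_goals simp [add, elem, rotCoeff, Finset.sum_add_distrib, Pi.single_add]
  ring

theorem elem_smul (c : R) (G : Gauge R) : (G.smul c).elem = c • G.elem := by
  refine E1_ext (CDer.ext_coord ?_ ?_ ?_ ?_)
    (fun i => CDer.ext_coord ?_ ?_ (fin3_forall_cyclic i ?_ ?_ ?_) ?_) rfl (fun _ => rfl)
  all_goals simp [smul, elem, rotCoeff, Finset.mul_sum, Pi.single_apply]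
  ring

end Gauge

end Algebra

section Algebra

set_option linter.unusedSectionVars false

variable {R : Type*} [CommRing R] [Algebra ℝ R]

/-! ### The generators of the gauge subspace -/

variable (R) in
def gP (i : Fin 3) : E1 R := (th 0 sigma0 + th i.succ (boost i), 0)
variable (R) in
def gN (i : Fin 3) : E1 R :=
  (-th i.succ (rot i) + th (i + 1).succ (rot (i + 1)) + th (i + 2).succ (rot (i + 2)), 0)
def gV (i : Fin 3) (v : Derivation ℝ R R) : E1 R := (th i.succ (ofDer v), 0)
variable (R) in
def gW (i : Fin 3) : E1 R := (th 0 (boost i) + th i.succ sigma0, 0)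
variable (R) in
def gA (i : Fin 3) : E1 R := (th (i + 2).succ (rot (i + 1)), 0)
variable (R) in
def gB (i : Fin 3) : E1 R := (th (i + 1).succ (rot (i + 2)), 0)
variable (R) in
def gQ (a : Fin 4) : E1 R := (0, Pi.single a 1)
def gD (v : Derivation ℝ R R) : E1 R := (th 0 (ofDer v), 0)

theorem mem_G1 {α : Fin 3 → ℕ} {x : L1 R} (h : x ∈ tabE1 R α ∪ th 0 '' tabE0 R α) :
    ((x, 0) : E1 R) ∈ G1 R α := ⟨Submodule.subset_span h, zero_mem _⟩

theorem gD_mem_G1 (v : Derivation ℝ R R) : gD v ∈ G1 R 0 :=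
  mem_G1 (Or.inr ⟨_, Or.inl ⟨rfl, Or.inl ⟨v, rfl⟩⟩, rfl⟩)

theorem gV_mem_G1 (i : Fin 3) (v : Derivation ℝ R R) : gV i v ∈ G1 R (dg011 i) :=
  mem_G1 (Or.inl ⟨i, Or.inr (Or.inr (Or.inl ⟨rfl, Or.inl ⟨v, rfl⟩⟩))⟩)

theorem tabSpecial_subset_G1 (V : Fin 3 → Derivation ℝ R R) (α : Fin 3 → ℕ) :
    tabSpecial V α ⊆ G1 R α := by
  rintro x (⟨rfl, rfl⟩ | ⟨i, ⟨rfl, rfl⟩ | ⟨rfl, rfl⟩ | ⟨rfl, ⟨l, rfl⟩ | rfl | rfl | rfl | rfl⟩⟩)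
  · exact ⟨zero_mem _, Submodule.subset_span (Or.inl ⟨rfl, rfl⟩)⟩
  · exact mem_G1 (Or.inl ⟨i, Or.inl ⟨rfl, rfl⟩⟩)
  · exact mem_G1 (Or.inl ⟨i, Or.inr (Or.inl ⟨rfl, rfl⟩)⟩)
  · exact gV_mem_G1 i _
  · exact mem_G1 (Or.inl ⟨i, Or.inr (Or.inr (Or.inl ⟨rfl, Or.inr (Or.inl rfl)⟩))⟩)
  · exact mem_G1 (Or.inl ⟨i, Or.inr (Or.inr (Or.inl ⟨rfl, by simp⟩))⟩)
  · exact mem_G1 (Or.inl ⟨i, Or.inr (Or.inr (Or.inl ⟨rfl, by simp⟩))⟩)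
  · exact ⟨zero_mem _, Submodule.subset_span (Or.inr ⟨i, rfl, rfl⟩)⟩

/-- The gauge table is part of the table of G, so membership in 𝓐¹ comes for free from the gauge
condition. -/
theorem affineGauged_subset_A1 {d0 : Derivation ℝ R R} {V : Fin 3 → Derivation ℝ R R}
    {x : Series (E1 R)} (hx : x ∈ affineGauged d0 V) : x ∈ A1 R := by
  intro α _
  have h := (Submodule.span_le.2 (tabSpecial_subset_G1 V α)) (hx α)
  have h0 : (Pi.single 0 (gD d0) : Series (E1 R)) α ∈ G1 R α := by
    by_cases hα : α = 0
    · subst hα; rw [Pi.single_eq_same]; exact gD_mem_G1 d0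
    · rw [Pi.single_eq_of_ne hα]; exact zero_mem _
  have := add_mem h h0
  rwa [Pi.sub_apply, gD, sub_add_cancel] at this

namespace Gauge

/-- This justifies the index pattern of `rotCoeff`: in the θ_i component -n_i + n_j + n_k collects
the three N generators, and a_{i+1}, b_{i+2} are the ones whose generators contain θ_i. -/
theorem elem_eq_sum (G : Gauge R) : G.elem = gD G.d0 + G.f • gQ R 0 + ∑ i, G.p i • gP R i
    + ∑ i, (G.n i • gN R i + (gV i (G.V i) + G.w i • gW R i + G.a i • gA R i + G.b i • gB R i
      + G.q i • gQ R i.succ)) := by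
  have ofDer_zero : (ofDer 0 : CDer R) = 0 := rfl
  refine E1_ext (CDer.ext_coord ?_ (fun i => ?_) (fun i => ?_) ?_)
    (fun i => CDer.ext_coord ?_ (fin3_forall_cyclic i ?_ ?_ ?_) (fin3_forall_cyclic i ?_ ?_ ?_) ?_)
      ?_ (fun i => ?_)
  · simp [elem, gD, gQ, gP, gN, gV, gW, gA, gB, th, Prod.fst_sum]
  · rw [fin3_sum_cyclic _ i, fin3_sum_cyclic _ i]
    simp [elem, gD, gQ, gP, gN, gV, gW, gA, gB, th, bC_boost]
  · simp [elem, gD, gQ, gP, gN, gV, gW, gA, gB, th, Prod.fst_sum]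
  · simp [elem, gD, gQ, gP, gN, gV, gW, gA, gB, th, Prod.fst_sum]
  rotate_right 2
  · simp [elem, gD, gQ, gP, gN, gV, gW, gA, gB, Prod.snd_sum]
  all_goals
    rw [fin3_sum_cyclic _ i, fin3_sum_cyclic _ i]
    simp [elem, gD, gQ, gP, gN, gV, gW, gA, gB, th, bC_boost, rC_rot, rotCoeff]

/-- Sums of the terms of a gauged element, each in its degree. -/
theorem series_eq_sum (G : Gauge R) : G.series = (Pi.single 0 (gD G.d0) : Series (E1 R))
    + ((Pi.single 0 (G.f • gQ R 0) : Series (E1 R))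
    + ∑ i, (Pi.single 0 (G.p i • gP R i) : Series (E1 R))
    + ∑ i, ((Pi.single (dg200 i) (G.n i • gN R i) : Series (E1 R))
      + (Pi.single (dg011 i) (gV i (G.V i) + G.w i • gW R i
      + G.a i • gA R i + G.b i • gB R i + G.q i • gQ R i.succ) : Series (E1 R)))) := by
  ext1 α
  have h1 : ∀ (δ : Fin 3 → ℕ) (r : R) (e : E1 R),
      (Pi.single δ r : Series R) α • e = (Pi.single δ (r • e) : Series (E1 R)) α := by
    intro δ r e
    by_cases h : α = δ
    · subst h; simp
    · simp [h]
  have h2 : ∀ (δ : Fin 3 → ℕ) (v : Derivation ℝ R R) (i : Fin 3),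
      gV i ((Pi.single δ v : Series (Derivation ℝ R R)) α)
        = (Pi.single δ (gV i v) : Series (E1 R)) α := by
    intro δ v i
    by_cases h : α = δ
    · subst h; simp
    · rw [Pi.single_eq_of_ne h, Pi.single_eq_of_ne h]
      refine Prod.ext (Pi.single_eq_zero_iff.2 rfl) rfl
  have h3 : ∀ (δ : Fin 3 → ℕ) (v : Derivation ℝ R R),
      gD ((Pi.single δ v : Series (Derivation ℝ R R)) α)
        = (Pi.single δ (gD v) : Series (E1 R)) α := by
    intro δ v
    by_cases h : α = δ
    · subst h; simp
    · rw [Pi.single_eq_of_ne h, Pi.single_eq_of_ne h]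
      refine Prod.ext (Pi.single_eq_zero_iff.2 rfl) rfl
  rw [series, elem_eq_sum]
  simp only [part, h1, h2, h3, Pi.add_apply, Finset.sum_apply, Pi.single_add]
  abel

theorem setOne_series (G : Gauge R) : setOne G.series = G.elem := by
  have h : ∀ (δ : Fin 3 → ℕ) (e : E1 R), δ ≤ dg222 → setOne (Pi.single δ e : Series (E1 R)) = e := by
    intro δ e hδ
    rw [setOne, Finset.sum_eq_single_of_mem δ (Finset.mem_Iic.2 hδ), Pi.single_eq_same]
    intro α _ hα
    rw [Pi.single_eq_of_ne hα]
  have hadd : ∀ x y : Series (E1 R), setOne (x + y) = setOne x + setOne y := fun x y => by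
    simp [setOne, Finset.sum_add_distrib]
  have hsum : ∀ x : Fin 3 → Series (E1 R), setOne (∑ i, x i) = ∑ i, setOne (x i) := fun x => by
    simp only [setOne, Finset.sum_apply]
    exact Finset.sum_comm
  have d0 : (0 : Fin 3 → ℕ) ≤ dg222 := fun _ => Nat.zero_le _
  have d2 : ∀ i, dg200 i ≤ dg222 := fun i m => by simp only [dg200, dg222]; split_ifs <;> omega
  have d1 : ∀ i, dg011 i ≤ dg222 := fun i m => by simp only [dg011, dg222]; split_ifs <;> omega
  rw [series_eq_sum, elem_eq_sum]
  simp only [hadd, hsum, h _ _ d0, h _ _ (d2 _), h _ _ (d1 _)]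
  abel

theorem frameOf_zero (G : Gauge R) : frameOf (setOne G.series) 0 = G.d0 := by
  rw [setOne_series]; exact dC_elem_zero G

theorem frameOf_succ (G : Gauge R) (i : Fin 3) : frameOf (setOne G.series) i.succ = G.V i := by
  rw [setOne_series]; exact dC_elem_succ G i

theorem isExact_iff (G : Gauge R) : IsExact G.series ↔
    (∃ g : R, G.d0 g = G.p 0 + G.p 1 + G.p 2 ∧ ∀ i, G.V i g = G.w i) ∧
    (∃ g : R, G.d0 g = G.f ∧ ∀ i, G.V i g = G.q i) := by
  have hs : sigma0Coeff (setOne G.series) 0 = G.p 0 + G.p 1 + G.p 2 := by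
    rw [setOne_series]; exact sC_elem_zero G 0
  have hs' : ∀ i : Fin 3, sigma0Coeff (setOne G.series) i.succ = G.w i := fun i => by
    rw [setOne_series]; exact sC_elem_succ G i
  have hf : (setOne G.series).2 0 = G.f := by rw [setOne_series]; rfl
  have hf' : ∀ i : Fin 3, (setOne G.series).2 i.succ = G.q i := fun i => by
    rw [setOne_series]; rfl
  simp only [IsExact, IsExactVia, Fin.forall_fin_succ (n := 3), hs, hs', hf, hf', frameOf_zero,
    frameOf_succ]

/-- Setting s = 1 loses nothing on gauged elements. Every coefficient is a coordinate of `elem`,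
except that n_i is half the sum of the diagonal rotation coefficients in θ_j and θ_k. -/
theorem series_injective {G H : Gauge R} (h : G.series = H.series) : G = H := by
  have e : G.elem = H.elem := by rw [← setOne_series, h, setOne_series]
  have hn : ∀ i, -G.n i + G.n (i + 1) + G.n (i + 2) = -H.n i + H.n (i + 1) + H.n (i + 2) :=
    fun i => by rw [← rC_elem_self, e, rC_elem_self]
  obtain ⟨p, n, w, a, b, q, f, d0, V⟩ := G
  obtain ⟨p', n', w', a', b', q', f', d0', V'⟩ := H
  congr 1
  · funext i
    have := congrArg (fun x : E1 R => bC i (x.1 i.succ)) e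
    simpa only [bC_elem_self] using this
  · funext i
    have h1 := hn (i + 1)
    have h2 := hn (i + 2)
    simp only [fin3_add_one_add_one, fin3_add_one_add_two, fin3_add_two_add_one,
      fin3_add_two_add_two] at h1 h2
    refine sub_eq_zero.1 (eq_zero_of_two_mul ?_)
    linear_combination h1 + h2
  · funext i
    have := congrArg (fun x : E1 R => sC (x.1 i.succ)) e
    simpa only [sC_elem_succ] using this
  · funext i
    have := congrArg (fun x : E1 R => rC (i + 1) (x.1 (i + 2).succ)) e
    simpa [rC_elem_succ, rotCoeff] using this
  · funext i
    have := congrArg (fun x : E1 R => rC (i + 2) (x.1 (i + 1).succ)) e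
    simpa [rC_elem_succ, rotCoeff] using this
  · funext i
    exact congrArg (fun x : E1 R => x.2 i.succ) e
  · exact congrArg (fun x : E1 R => x.2 0) e
  · have := congrArg (fun x : E1 R => dC (x.1 0)) e
    simpa only [dC_elem_zero] using this
  · funext i
    have := congrArg (fun x : E1 R => dC (x.1 i.succ)) e
    simpa only [dC_elem_succ] using this

theorem gV_add (i : Fin 3) (u v : Derivation ℝ R R) : gV i (u + v) = gV i u + gV i v := by
  have h : (ofDer (u + v) : CDer R) = ofDer u + ofDer v :=
    Subtype.ext (Prod.ext (add_zero _).symm rfl)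
  refine Prod.ext ?_ (add_zero _).symm
  change (Pi.single i.succ (ofDer (u + v)) : L1 R) = _
  rw [h]
  exact Pi.single_add (f := fun _ : Fin 4 => CDer R) i.succ (ofDer u) (ofDer v)

theorem gV_smul (i : Fin 3) (c : R) (v : Derivation ℝ R R) : gV i (c • v) = c • gV i v := by
  have h : (ofDer (c • v) : CDer R) = c • ofDer v :=
    Subtype.ext (Prod.ext (smul_zero _).symm rfl)
  refine Prod.ext ?_ (smul_zero _).symm
  change (Pi.single i.succ (ofDer (c • v)) : L1 R) = _
  rw [h]
  exact Pi.single_smul (f := fun _ : Fin 4 => CDer R) i.succ c (ofDer v)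

theorem gD_zero : (gD 0 : E1 R) = 0 := by
  refine Prod.ext (Pi.single_eq_zero_iff.2 rfl) rfl

theorem gV_zero (i : Fin 3) : (gV i 0 : E1 R) = 0 := by
  refine Prod.ext (Pi.single_eq_zero_iff.2 rfl) rfl

theorem gV_mem_span {V : Fin 3 → Derivation ℝ R R} {v : Derivation ℝ R R} (i : Fin 3)
    (hv : v ∈ Submodule.span R (Set.range V)) :
    gV i v ∈ Submodule.span R (tabSpecial V (dg011 i)) := by
  induction hv using Submodule.span_induction with
  | mem v hv =>
    obtain ⟨l, rfl⟩ := hv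
    exact Submodule.subset_span (Or.inr ⟨i, Or.inr (Or.inr ⟨rfl, Or.inl ⟨l, rfl⟩⟩)⟩)
  | zero =>
    rw [gV_zero]; exact zero_mem _
  | add u v _ _ hu hv => rw [gV_add]; exact add_mem hu hv
  | smul c v _ hv => rw [gV_smul]; exact Submodule.smul_mem _ _ hv

theorem series_mem_affineGauged (G : Gauge R) {V : Fin 3 → Derivation ℝ R R}
    (hV : ∀ i, G.V i ∈ Submodule.span R (Set.range V)) : G.series ∈ affineGauged G.d0 V := by
  intro α
  have hs : ∀ (δ : Fin 3 → ℕ) (e : E1 R), e ∈ Submodule.span R (tabSpecial V δ) →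
      (Pi.single δ e : Series (E1 R)) α ∈ Submodule.span R (tabSpecial V α) := by
    intro δ e he
    by_cases h : α = δ
    · subst h; rwa [Pi.single_eq_same]
    · rw [Pi.single_eq_of_ne h]; exact zero_mem _
  rw [series_eq_sum]
  change ((Pi.single 0 (gD G.d0) : Series (E1 R)) + _ - (Pi.single 0 (gD G.d0) : Series (E1 R))) α ∈ _
  rw [add_sub_cancel_left]
  simp only [Pi.add_apply, Finset.sum_apply]
  refine add_mem (add_mem (hs _ _ ?_) (sum_mem fun i _ => hs _ _ ?_))
    (sum_mem fun i _ => add_mem (hs _ _ ?_) (hs _ _ ?_))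
  · exact Submodule.smul_mem _ _ (Submodule.subset_span (Or.inl ⟨rfl, rfl⟩))
  · exact Submodule.smul_mem _ _ (Submodule.subset_span (Or.inr ⟨i, Or.inl ⟨rfl, rfl⟩⟩))
  · exact Submodule.smul_mem _ _ (Submodule.subset_span (Or.inr ⟨i, Or.inr (Or.inl ⟨rfl, rfl⟩)⟩))
  · refine add_mem (add_mem (add_mem (add_mem (gV_mem_span i (hV i))
      (Submodule.smul_mem _ _ (Submodule.subset_span ?_)))
      (Submodule.smul_mem _ _ (Submodule.subset_span ?_)))
      (Submodule.smul_mem _ _ (Submodule.subset_span ?_)))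
      (Submodule.smul_mem _ _ (Submodule.subset_span ?_))
    · exact Or.inr ⟨i, Or.inr (Or.inr ⟨rfl, Or.inr (Or.inl rfl)⟩)⟩
    · exact Or.inr ⟨i, Or.inr (Or.inr ⟨rfl, Or.inr (Or.inr (Or.inl rfl))⟩)⟩
    · exact Or.inr ⟨i, Or.inr (Or.inr ⟨rfl, Or.inr (Or.inr (Or.inr (Or.inl rfl)))⟩)⟩
    · exact Or.inr ⟨i, Or.inr (Or.inr ⟨rfl, Or.inr (Or.inr (Or.inr (Or.inr rfl)))⟩)⟩

theorem part_add (G H : Gauge R) (α : Fin 3 → ℕ) :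
    (G.add H).part α = (G.part α).add (H.part α) := by
  simp only [part, add, mk.injEq]
  refine ⟨?_, ?_, ?_, ?_, ?_, ?_, ?_, ?_, ?_⟩ <;> first | (funext i; simp [Pi.single_add]) | simp [Pi.single_add]

theorem part_smul (c : R) (H : Gauge R) (α : Fin 3 → ℕ) :
    (H.smul c).part α = (H.part α).smul c := by
  have h1 : ∀ (δ : Fin 3 → ℕ) (r : R), (Pi.single δ (c * r) : Series R) α
      = c * (Pi.single δ r : Series R) α := by
    intro δ r
    by_cases h : α = δ
    · subst h; simp
    · simp [h]
  have h2 : ∀ (δ : Fin 3 → ℕ) (r : Derivation ℝ R R),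
      (Pi.single δ (c • r) : Series (Derivation ℝ R R)) α
      = c • (Pi.single δ r : Series (Derivation ℝ R R)) α := by
    intro δ r
    by_cases h : α = δ
    · subst h; simp
    · simp [h]
  simp only [part, smul, mk.injEq, Pi.smul_apply, smul_eq_mul, h1, h2]
  refine ⟨?_, ?_, ?_, ?_, ?_, ?_, ?_, ?_, ?_⟩ <;> trivial

end Gauge

end Algebra

/-! ### Every gauged element is given by a list of coefficients -/

section Algebra

set_option linter.unusedSectionVars false

variable {R : Type*} [CommRing R] [Algebra ℝ R]

namespace Gauge

/-- Lists supported at one index suffice to produce each generator; zeros are written as `Pi.single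
i 0` below so that this formula applies. -/
theorem series_single (i : Fin 3) (d : Derivation ℝ R R) (f p n w a b q : R)
    (v : Derivation ℝ R R) :
    series ⟨Pi.single i p, Pi.single i n, Pi.single i w, Pi.single i a, Pi.single i b,
      Pi.single i q, f, d, Pi.single i v⟩ = (Pi.single 0 (gD d) : Series (E1 R))
    + ((Pi.single 0 (f • gQ R 0) : Series (E1 R)) + (Pi.single 0 (p • gP R i) : Series (E1 R))
    + ((Pi.single (dg200 i) (n • gN R i) : Series (E1 R))
      + (Pi.single (dg011 i) (gV i v + w • gW R i + a • gA R i + b • gB R i + q • gQ R i.succ)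
        : Series (E1 R)))) := by
  rw [series_eq_sum, Finset.sum_eq_single_of_mem i (Finset.mem_univ i),
    Finset.sum_eq_single_of_mem i (Finset.mem_univ i)]
  · simp only [Pi.single_eq_same]
  · intro j _ hj
    simp only [Pi.single_eq_of_ne hj, zero_smul, gV_zero, add_zero, Pi.single_zero]
  · intro j _ hj
    simp only [Pi.single_eq_of_ne hj, zero_smul, Pi.single_zero]

/-- Induction over the span in one fixed degree α. Only the value in degree α is controlled, so the
list may depend on α. -/
theorem exists_part_elem {V : Fin 3 → Derivation ℝ R R} {α : Fin 3 → ℕ} {e : E1 R}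
    (he : e ∈ Submodule.span R (tabSpecial V α)) (d0 : Derivation ℝ R R) :
    ∃ H : Gauge R, H.d0 = d0 ∧ (∀ i, H.V i ∈ Submodule.span R (Set.range V)) ∧
      (Pi.single 0 (gD d0) : Series (E1 R)) α + e = H.series α := by
  -- Induction needs the linear statement; the affine term θ₀∂₀ is added at the end.
  suffices h : ∃ H : Gauge R, H.d0 = 0 ∧ (∀ i, H.V i ∈ Submodule.span R (Set.range V)) ∧
      e = H.series α by
    obtain ⟨H, hd, hV, rfl⟩ := h
    let D : Gauge R := ⟨Pi.single 0 0, Pi.single 0 0, Pi.single 0 0, Pi.single 0 0, Pi.single 0 0,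
      Pi.single 0 0, 0, d0, Pi.single 0 0⟩
    refine ⟨D.add H, ?_, fun i => ?_, ?_⟩
    · simp [add, hd, D]
    · simpa [add, D] using hV i
    · change _ = ((D.add H).part α).elem
      rw [part_add, elem_add]
      change _ = D.series α + H.series α
      rw [series_single]
      simp [gV_zero]
  induction he using Submodule.span_induction with
  | mem e he =>
    have h0 : ∀ i l : Fin 3, (Pi.single i 0 : Fin 3 → Derivation ℝ R R) l
        ∈ Submodule.span R (Set.range V) := fun i l => by simp
    rcases he with ⟨rfl, rfl⟩ | ⟨i, ⟨rfl, rfl⟩ | ⟨rfl, rfl⟩ | ⟨rfl, ⟨l, rfl⟩ | rfl | rfl | rfl | rfl⟩⟩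
    · refine ⟨⟨Pi.single 0 0, Pi.single 0 0, Pi.single 0 0, Pi.single 0 0, Pi.single 0 0,
        Pi.single 0 0, 1, 0, Pi.single 0 0⟩, rfl, h0 0, ?_⟩
      rw [series_single]; simp [gV_zero, gD_zero, gQ]
    · refine ⟨⟨Pi.single i 1, Pi.single i 0, Pi.single i 0, Pi.single i 0, Pi.single i 0,
        Pi.single i 0, 0, 0, Pi.single i 0⟩, rfl, h0 i, ?_⟩
      rw [series_single]; simp [gV_zero, gD_zero, gP]
    · refine ⟨⟨Pi.single i 0, Pi.single i 1, Pi.single i 0, Pi.single i 0, Pi.single i 0,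
        Pi.single i 0, 0, 0, Pi.single i 0⟩, rfl, h0 i, ?_⟩
      rw [series_single]; simp [gV_zero, gD_zero, gN]
    · refine ⟨⟨Pi.single i 0, Pi.single i 0, Pi.single i 0, Pi.single i 0, Pi.single i 0,
        Pi.single i 0, 0, 0, Pi.single i (V l)⟩, rfl, fun m => ?_, ?_⟩
      · by_cases h : m = i
        · subst h
          simpa using Submodule.subset_span (R := R) (Set.mem_range_self l)
        · simp [h]
      · rw [series_single]; simp [gD_zero, gV]
    · refine ⟨⟨Pi.single i 0, Pi.single i 0, Pi.single i 1, Pi.single i 0, Pi.single i 0,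
        Pi.single i 0, 0, 0, Pi.single i 0⟩, rfl, h0 i, ?_⟩
      rw [series_single]; simp [gV_zero, gD_zero, gW]
    · refine ⟨⟨Pi.single i 0, Pi.single i 0, Pi.single i 0, Pi.single i 1, Pi.single i 0,
        Pi.single i 0, 0, 0, Pi.single i 0⟩, rfl, h0 i, ?_⟩
      rw [series_single]; simp [gV_zero, gD_zero, gA]
    · refine ⟨⟨Pi.single i 0, Pi.single i 0, Pi.single i 0, Pi.single i 0, Pi.single i 1,
        Pi.single i 0, 0, 0, Pi.single i 0⟩, rfl, h0 i, ?_⟩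
      rw [series_single]; simp [gV_zero, gD_zero, gB]
    · refine ⟨⟨Pi.single i 0, Pi.single i 0, Pi.single i 0, Pi.single i 0, Pi.single i 0,
        Pi.single i 1, 0, 0, Pi.single i 0⟩, rfl, h0 i, ?_⟩
      rw [series_single]; simp [gV_zero, gD_zero, gQ]
  | zero =>
    refine ⟨⟨Pi.single 0 0, Pi.single 0 0, Pi.single 0 0, Pi.single 0 0, Pi.single 0 0,
        Pi.single 0 0, 0, 0, Pi.single 0 0⟩, rfl, fun l => by simp, ?_⟩
    rw [series_single]; simp [gV_zero, gD_zero]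
  | add e e' _ _ he he' =>
    obtain ⟨H, hd, hV, rfl⟩ := he
    obtain ⟨H', hd', hV', rfl⟩ := he'
    refine ⟨H.add H', by simp [add, hd, hd'], fun i => add_mem (hV i) (hV' i), ?_⟩
    change _ = ((H.add H').part α).elem
    rw [part_add, elem_add]; rfl
  | smul c e _ he =>
    obtain ⟨H, hd, hV, rfl⟩ := he
    refine ⟨H.smul c, by simp [smul, hd], fun i => Submodule.smul_mem _ c (hV i), ?_⟩
    change _ = ((H.smul c).part α).elem
    rw [part_smul, elem_smul]; rfl

theorem exists_series_eq {d0 : Derivation ℝ R R} {V : Fin 3 → Derivation ℝ R R}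
    {x : Series (E1 R)} (hx : x ∈ affineGauged d0 V) :
    ∃ G : Gauge R, G.d0 = d0 ∧ (∀ i, G.V i ∈ Submodule.span R (Set.range V)) ∧ G.series = x := by
  choose H hd hV hH using fun α => exists_part_elem (hx α) d0
  -- Take each coefficient from the list belonging to the degree in which it is supported. In any
  -- other degree it is multiplied out by `Pi.single`, so the pieces glue.
  refine ⟨⟨(H 0).p, fun i => (H (dg200 i)).n i, fun i => (H (dg011 i)).w i,
    fun i => (H (dg011 i)).a i, fun i => (H (dg011 i)).b i, fun i => (H (dg011 i)).q i, (H 0).f,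
    d0, fun i => (H (dg011 i)).V i⟩, rfl, fun i => hV _ i, ?_⟩
  have hs : ∀ {X : Type _} [Zero X] (δ α : Fin 3 → ℕ) (g : (Fin 3 → ℕ) → X),
      (Pi.single δ (g δ) : Series X) α = (Pi.single δ (g α) : Series X) α := by
    intro X _ δ α g
    by_cases h : α = δ
    · subst h; rfl
    · simp [h]
  ext1 α
  have h := hH α
  rw [show (Pi.single 0 (gD d0) : Series (E1 R)) α + (x - (Pi.single 0 (th 0 (ofDer d0), 0) :
    Series (E1 R))) α = x α from add_sub_cancel _ _] at h
  rw [h]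
  refine congrArg elem ?_
  simp only [part, mk.injEq]
  refine ⟨?_, ?_, ?_, ?_, ?_, ?_, ?_, ?_, ?_⟩
  · funext i; exact hs 0 α fun β => (H β).p i
  · funext i; exact hs (dg200 i) α fun β => (H β).n i
  · funext i; exact hs (dg011 i) α fun β => (H β).w i
  · funext i; exact hs (dg011 i) α fun β => (H β).a i
  · funext i; exact hs (dg011 i) α fun β => (H β).b i
  · funext i; exact hs (dg011 i) α fun β => (H β).q i
  · exact hs 0 α fun β => (H β).f
  · rw [hd]
  · funext i; exact hs (dg011 i) α fun β => (H β).V i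

end Gauge

/-- The explicit element is written with the negative of the N generator; this is the sign in
`coeffN`. -/
theorem smul_gN_aux (r : R) (i : Fin 3) :
    r • ((th i.succ (rot i) - th (i + 1).succ (rot (i + 1)) - th (i + 2).succ (rot (i + 2)), 0)
      : E1 R) = (-r) • gN R i := by
  have h : gN R i = -((th i.succ (rot i) - th (i + 1).succ (rot (i + 1))
      - th (i + 2).succ (rot (i + 2)), 0) : E1 R) := by
    refine Prod.ext ?_ neg_zero.symm
    simp only [gN, Prod.fst_neg]
    abel
  rw [h, neg_smul_neg]

theorem smul_gauge_aux (r : R) (i : Fin 3) (v : Derivation ℝ R R) (w a b q : R) :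
    r • (((th i.succ (ofDer v), 0) : E1 R) - w • ((th 0 (boost i) + th i.succ sigma0, 0) : E1 R)
      + a • ((th (i + 2).succ (rot (i + 1)), 0) : E1 R)
      - b • ((th (i + 1).succ (rot (i + 2)), 0) : E1 R)
      + q • ((0, Pi.single i.succ 1) : E1 R)) = gV i (r • v) + (-(r * w)) • gW R i
      + (r * a) • gA R i + (-(r * b)) • gB R i + (r * q) • gQ R i.succ := by
  rw [Gauge.gV_smul, ← gV, ← gW, ← gA, ← gB, ← gQ]
  module

theorem single_sum_aux (x y : E1 R) (z : Fin 3 → E1 R) (t : Series (E1 R)) :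
    (Pi.single 0 x : Series (E1 R)) + ((Pi.single 0 y : Series (E1 R))
      + ∑ i, (Pi.single 0 (z i) : Series (E1 R)) + t)
      = (Pi.single 0 (x + y + ∑ i, z i) : Series (E1 R)) + t := by
  simp only [Fin.sum_univ_three, Pi.single_add]
  abel

end Algebra

/-! ### The explicit element of a tuple as a gauged element -/

section Manifold

variable {M : Type*} [TopologicalSpace M] [ChartedSpace (EuclideanSpace ℝ (Fin 3)) M]
  [IsManifold (𝓡 3) ∞ M]

namespace Data

variable (T : Data M) (i : Fin 3)

/-- The factor `𝔰_j 𝔰_k`. -/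
def decay2 : COm M := T.decay (i + 1) * T.decay (i + 2)

/-- The coefficient of `-θ_i σ_jk + θ_j σ_ki + θ_k σ_ij`. -/
def coeffN : COm M := -((1 / 2 : ℝ) • (T.decay i ^ 2 * pull (T.c (i + 1) (i + 2) i)))

/-- The coefficient of `θ₀ σ_i + θ_i σ₀`. -/
def coeffW : COm M := -(T.decay2 i * (pull (lie (T.D i) T.zeta)
    - tau * pull (lie (T.D i) (T.p 0 + T.p 1 + T.p 2))))

/-- The coefficient of `θ_k σ_ki`. -/
def coeffA : COm M := T.decay2 i * (pull (lie (T.D i) T.zeta)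
    + pull (T.c (i + 2) i (i + 2)) - tau * pull (lie (T.D i) (T.p (i + 2))))

/-- The coefficient of `θ_j σ_ij`. -/
def coeffB : COm M := -(T.decay2 i * (pull (lie (T.D i) T.zeta)
    - pull (T.c i (i + 1) (i + 1)) - tau * pull (lie (T.D i) (T.p (i + 1)))))

/-- The coefficient of the spatial part of the scalar field. -/
def coeffQ : COm M := T.decay2 i * (pull (lie (T.D i) T.chi) + tau * pull (lie (T.D i) T.p0))

/-- The coefficients of the element associated to a tuple. -/
def gauge : Gauge (COm M) :=
  ⟨fun i => pull (T.p i), T.coeffN, T.coeffW, T.coeffA, T.coeffB, T.coeffQ, pull T.p0, del0,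
    fun i => T.decay2 i • lift (T.D i)⟩

theorem term200_eq : T.term200 i (i + 1) (i + 2) = T.coeffN i • gN (COm M) i :=
  smul_gN_aux _ i

theorem term011_eq : T.term011 i (i + 1) (i + 2) = gV i (T.decay2 i • lift (T.D i))
    + T.coeffW i • gW (COm M) i + T.coeffA i • gA (COm M) i + T.coeffB i • gB (COm M) i
    + T.coeffQ i • gQ (COm M) i.succ :=
  smul_gauge_aux _ i _ _ _ _ _

theorem gauge_series : T.gauge.series = T.element :=
  (Gauge.series_eq_sum _).trans (by
    refine (single_sum_aux _ _ _ _).trans ?_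
    refine congrArg₂ _ rfl (Finset.sum_congr rfl fun i _ => ?_)
    refine congrArg₂ _ (congrArg _ ?_) (congrArg _ ?_)
    · exact (T.term200_eq i).symm
    · exact (T.term011_eq i).symm)

end Data

end Manifold

set_option linter.unusedSectionVars false

/-! ### Calculus on Ω: exponentials, lifted fields and ∂₀ -/

section VectorFieldAction

variable {E H N : Type*} [NormedAddCommGroup E] [NormedSpace ℝ E] [TopologicalSpace H]
  (I : ModelWithCorners ℝ E H) [TopologicalSpace N] [ChartedSpace H N] [IsManifold I ∞ N]

theorem vfDerivation_apply (V : Cₛ^∞⟮I; E, (TangentSpace I : N → Type _)⟯) (f : C^∞⟮I, N; ℝ⟯)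
    (x : N) : vfDerivation I V f x = mfderiv I 𝓘(ℝ, ℝ) f x (V x) := rfl

theorem mdifferentiableAt_contMDiffMap (f : C^∞⟮I, N; ℝ⟯) (x : N) :
    MDifferentiableAt I 𝓘(ℝ, ℝ) f x := f.contMDiff.mdifferentiable (by simp) x

end VectorFieldAction

section Manifold

variable {M : Type*} [TopologicalSpace M] [ChartedSpace (EuclideanSpace ℝ (Fin 3)) M]

theorem COm_mul_apply (f g : COm M) (q : Om M) : (f * g) q = f q * g q := rfl

theorem pull_injective : Function.Injective (pull : CM M → COm M) := fun f g h => by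
  ext x
  exact congrArg (fun k : COm M => k (⟨0, le_rfl⟩, x)) h

theorem expOm_mul_expOm_neg (f : COm M) : expOm f * expOm (-f) = 1 := by
  ext q
  change Real.exp (f q) * Real.exp (-f q) = 1
  rw [← Real.exp_add, add_neg_cancel, Real.exp_zero]

/-- The restriction of a function on `Ω` to a time slice. -/
def slice (t : EuclideanHalfSpace 1) (f : COm M) : CM M :=
  f.comp ⟨fun x => (t, x), contMDiff_const.prodMk contMDiff_id⟩

variable [IsManifold (𝓡 3) ∞ M]

theorem derivation_expOm (V : VFOm M) (f : COm M) :
    vfDerivation IOm V (expOm f) = expOm f * vfDerivation IOm V f := by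
  ext q
  have h1 := (mdifferentiableAt_contMDiffMap IOm f q).hasMFDerivAt
  have h2 : HasMFDerivAt 𝓘(ℝ, ℝ) 𝓘(ℝ, ℝ) Real.exp (f q) _ :=
    (Real.hasDerivAt_exp (f q)).hasFDerivAt.hasMFDerivAt
  have h3 := (h2.comp q h1).mfderiv
  rw [COm_mul_apply, vfDerivation_apply, vfDerivation_apply]
  change mfderiv IOm 𝓘(ℝ, ℝ) (Real.exp ∘ f) q (V q) = _
  rw [h3]
  exact mul_comm (show ℝ from mfderiv IOm 𝓘(ℝ, ℝ) f q (V q)) (Real.exp (f q))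

/-- A lifted field is tangent to the slices τ = t, so the chain rule along y ↦ (t, y) reduces it to
a computation on M. -/
theorem lift_apply (X : VF M) (f : COm M) (t : EuclideanHalfSpace 1) (x : M) :
    lift X f (t, x) = lie X (slice t f) x := by
  have h1 := (mdifferentiableAt_contMDiffMap IOm f (t, x)).hasMFDerivAt
  have h2 : HasMFDerivAt (𝓡 3) IOm (fun y : M => (t, y)) x
      ((0 : TangentSpace (𝓡 3) x →L[ℝ] TangentSpace (𝓡∂ 1) t).prod
        (ContinuousLinearMap.id ℝ (TangentSpace (𝓡 3) x))) :=
    (hasMFDerivAt_const t x).prodMk (hasMFDerivAt_id x)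
  have h3 := (h1.comp x h2).mfderiv
  change mfderiv IOm 𝓘(ℝ, ℝ) f (t, x) _ = mfderiv (𝓡 3) 𝓘(ℝ, ℝ) (f ∘ fun y => (t, y)) x (X x)
  rw [h3]
  rfl

theorem lift_pull (X : VF M) (f : CM M) : lift X (pull f) = pull (lie X f) := by
  ext ⟨t, x⟩
  rw [lift_apply]; rfl

theorem lift_tau (X : VF M) : lift X tau = 0 := by
  ext ⟨t, x⟩
  rw [lift_apply]
  have : slice t (tau : COm M) = algebraMap ℝ (CM M) (t.1 0) := by ext; rfl
  rw [this, lie, Derivation.map_algebraMap]; rfl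

/-- The point of `Ω` with coordinates `s` and `x`, for `s ≥ 0`. -/
def ptOm (s : ℝ) (x : M) : Om M := ((𝓡∂ 1).symm (EuclideanSpace.single 0 s), x)

theorem ptOm_coord (q : Om M) : ptOm (q.1.1 0) q.2 = q := by
  refine Prod.ext ?_ rfl
  have : (EuclideanSpace.single 0 (q.1.1 0) : EuclideanSpace ℝ (Fin 1)) = (𝓡∂ 1) q.1 := by
    ext i; fin_cases i; simp
  simp only [ptOm]
  rw [this, ModelWithCorners.left_inv]

theorem hasMFDerivWithinAt_ptOm (x : M) {s : ℝ} (hs : 0 ≤ s) :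
    HasMFDerivWithinAt 𝓘(ℝ, ℝ) IOm (fun s => ptOm s x) (Set.Ici 0) s
      (((ContinuousLinearMap.id ℝ ℝ).smulRight
        (EuclideanSpace.single 0 1 : EuclideanSpace ℝ (Fin 1))).prod
        (0 : ℝ →L[ℝ] TangentSpace (𝓡 3) x)) := by
  have hm : ∀ s : ℝ, 0 ≤ s → EuclideanSpace.single 0 s ∈ Set.range (𝓡∂ 1) := by
    intro s hs
    rw [range_modelWithCornersEuclideanHalfSpace]
    simpa using hs
  have h1 := (𝓡∂ 1).hasMFDerivWithinAt_symm (hm s hs)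
  have h2 : HasFDerivAt (fun s : ℝ => (EuclideanSpace.single 0 s : EuclideanSpace ℝ (Fin 1)))
      ((ContinuousLinearMap.id ℝ ℝ).smulRight (EuclideanSpace.single 0 1)) s := by
    have := ((ContinuousLinearMap.id ℝ ℝ).smulRight
      (EuclideanSpace.single 0 1 : EuclideanSpace ℝ (Fin 1))).hasFDerivAt (x := s)
    convert this using 1
    ext s i
    fin_cases i; simp
  exact (h1.comp s (h2.hasFDerivWithinAt.hasMFDerivWithinAt (s := Set.Ici 0))
    fun s hs => hm s hs).prodMk (hasMFDerivAt_const x s).hasMFDerivWithinAt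

/-- Reduces ∂₀ to an ordinary derivative within [0,∞), one-sided at τ = 0, where derivatives are
still unique. -/
theorem hasDerivWithinAt_del0 (f : COm M) (x : M) {s : ℝ} (hs : 0 ≤ s) :
    HasDerivWithinAt (fun s => f (ptOm s x)) (del0 f (ptOm s x)) (Set.Ici 0) s := by
  have h1 := (mdifferentiableAt_contMDiffMap IOm f (ptOm s x)).hasMFDerivAt
  have h2 : HasFDerivWithinAt (fun s => f (ptOm s x)) (_ : ℝ →L[ℝ] ℝ) (Set.Ici 0) s :=
    (h1.comp_hasMFDerivWithinAt s (hasMFDerivWithinAt_ptOm x hs)).hasFDerivWithinAt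
  refine h2.hasDerivWithinAt.congr_deriv ?_
  change mfderiv IOm 𝓘(ℝ, ℝ) f (ptOm s x) _ = mfderiv IOm 𝓘(ℝ, ℝ) f (ptOm s x) _
  congr 1
  exact Prod.ext (one_smul ℝ _) rfl

theorem del0_pull (f : CM M) : del0 (pull f) = 0 := by
  ext q
  rw [← ptOm_coord q]
  have h := hasDerivWithinAt_del0 (pull f) q.2 q.1.2
  have h' : HasDerivWithinAt (fun s => pull f (ptOm s q.2)) 0 (Set.Ici 0) (q.1.1 0) :=
    hasDerivWithinAt_const _ _ (f q.2)
  exact (uniqueDiffOn_Ici 0 _ q.1.2).eq_deriv _ h h'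

theorem ptOm_fst {s : ℝ} (hs : 0 ≤ s) (x : M) : (ptOm s x).1.1 0 = s := by
  change ((𝓡∂ 1) ((𝓡∂ 1).symm (EuclideanSpace.single 0 s))) 0 = s
  rw [ModelWithCorners.right_inv]
  · simp
  · rw [range_modelWithCornersEuclideanHalfSpace]
    simpa using hs

theorem del0_tau : del0 (tau : COm M) = 1 := by
  ext q
  rw [← ptOm_coord q]
  have h := hasDerivWithinAt_del0 tau q.2 q.1.2
  have h' : HasDerivWithinAt (fun s => tau (ptOm s q.2)) 1 (Set.Ici 0) (q.1.1 0) :=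
    (hasDerivWithinAt_id _ _).congr (fun s hs => ptOm_fst hs q.2) (ptOm_fst q.1.2 q.2)
  exact (uniqueDiffOn_Ici 0 _ q.1.2).eq_deriv _ h h'

/-- Along each half line the derivative vanishes, so g equals its restriction to τ = 0. This solves
all evolution equations in the classification. -/
theorem exists_pull_of_del0_eq_zero {g : COm M} (hg : del0 g = 0) : ∃ f, g = pull f := by
  refine ⟨slice ((𝓡∂ 1).symm (EuclideanSpace.single 0 0)) g, ?_⟩
  ext q
  rw [← ptOm_coord q]
  have hd : ∀ s : ℝ, 0 ≤ s → HasDerivWithinAt (fun s => g (ptOm s q.2)) 0 (Set.Ici 0) s :=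
    fun s hs => by simpa [hg] using hasDerivWithinAt_del0 g q.2 hs
  exact constant_of_has_deriv_right_zero (f := fun s => g (ptOm s q.2)) (a := 0) (b := q.1.1 0)
    (fun s hs => (hd s hs.1).continuousWithinAt.mono fun r hr => hr.1)
    (fun s hs => (hd s hs.1).mono fun r hr => hs.1.trans hr) _ (Set.right_mem_Icc.2 q.1.2)

end Manifold

/-! ### Symmetry of mixed derivatives and commutation of ∂₀ with lifted fields -/

set_option linter.unusedSectionVars false

theorem hasDerivWithinAt_apply_comp {E : Type*} [NormedAddCommGroup E] [NormedSpace ℝ E]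
    {g : E → E →L[ℝ] ℝ} {D : E →L[ℝ] E →L[ℝ] ℝ} {S : Set E} {T : Set ℝ} {l : ℝ → E} {t : ℝ} {u : E}
    (hD : HasFDerivWithinAt g D S (l t)) (hl : HasDerivWithinAt l u T t) (hm : Set.MapsTo l T S)
    (v : E) : HasDerivWithinAt (fun s => g (l s) v) (D u v) T t :=
  HasFDerivAt.comp_hasDerivWithinAt (f := g ∘ l) t
    ((ContinuousLinearMap.apply ℝ ℝ v).hasFDerivAt (x := g (l t)))
    (hD.comp_hasDerivWithinAt t hl hm)

/-- Schwarz's theorem on a half strip up to its boundary. The functions a and b are the first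
partial derivatives along the two lines through (t, 0), and x, y are the values of the second
derivative in the two orders. -/
theorem mixed_partials {h : ℝ × ℝ → ℝ} {U : Set ℝ} (hU : IsOpen U) (h0U : (0 : ℝ) ∈ U)
    (hh : ContDiffOn ℝ ∞ h (Set.Ici 0 ×ˢ U)) {a b : ℝ → ℝ} {t x y : ℝ} (ht : 0 ≤ t)
    (ha : ∀ s, 0 ≤ s → HasDerivWithinAt (fun r => h (s, r)) (a s) U 0)
    (hb : ∀ r ∈ U, HasDerivWithinAt (fun s => h (s, r)) (b r) (Set.Ici 0) t)
    (hx : HasDerivWithinAt a x (Set.Ici 0) t) (hy : HasDerivWithinAt b y U 0) : x = y := by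
  set S : Set (ℝ × ℝ) := Set.Ici 0 ×ˢ U with hSdef
  have hS : UniqueDiffOn ℝ S := (uniqueDiffOn_Ici 0).prod hU.uniqueDiffOn
  have hmem : ∀ s r : ℝ, 0 ≤ s → r ∈ U → (s, r) ∈ S := fun s r hs hr => ⟨hs, hr⟩
  have hd : ∀ p ∈ S, HasFDerivWithinAt h (fderivWithin ℝ h S p) S p := fun p hp =>
    ((hh p hp).differentiableWithinAt (by simp)).hasFDerivWithinAt
  have hg : ContDiffOn ℝ ∞ (fderivWithin ℝ h S) S := hh.fderivWithin hS (by simp)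
  have hD : HasFDerivWithinAt (fderivWithin ℝ h S) (fderivWithin ℝ (fderivWithin ℝ h S) S (t, 0))
      S (t, 0) :=
    ((hg _ (hmem t 0 ht h0U)).differentiableWithinAt (by simp)).hasFDerivWithinAt
  have l1 : ∀ s r : ℝ, HasDerivWithinAt (fun s : ℝ => (s, r)) ((1 : ℝ), (0 : ℝ)) (Set.Ici 0) s :=
    fun s r => ((hasDerivAt_id s).prodMk (hasDerivAt_const s r)).hasDerivWithinAt
  have l2 : ∀ s r : ℝ, HasDerivWithinAt (fun r : ℝ => (s, r)) ((0 : ℝ), (1 : ℝ)) U r :=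
    fun s r => ((hasDerivAt_const r s).prodMk (hasDerivAt_id r)).hasDerivWithinAt
  have hb' : ∀ r ∈ U, b r = fderivWithin ℝ h S (t, r) (1, 0) := fun r hr =>
    (uniqueDiffOn_Ici 0 t ht).eq_deriv _ (hb r hr)
      ((hd (t, r) (hmem t r ht hr)).comp_hasDerivWithinAt t (l1 t r) fun s hs => hmem s r hs hr)
  have ha' : ∀ s : ℝ, 0 ≤ s → a s = fderivWithin ℝ h S (s, 0) (0, 1) := fun s hs =>
    (hU.uniqueDiffOn 0 h0U).eq_deriv _ (ha s hs)
      ((hd _ (hmem s 0 hs h0U)).comp_hasDerivWithinAt 0 (l2 s 0) fun r hr => hmem s r hs hr)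
  have e1 : x = fderivWithin ℝ (fderivWithin ℝ h S) S (t, 0) (1, 0) (0, 1) := by
    refine (uniqueDiffOn_Ici 0 t ht).eq_deriv _ hx ?_
    exact (hasDerivWithinAt_apply_comp (l := fun s => (s, 0)) hD (l1 t 0) (fun s hs => hmem s 0 hs h0U) (0, 1)).congr
      (fun s hs => ha' s hs) (ha' t ht)
  have e2 : y = fderivWithin ℝ (fderivWithin ℝ h S) S (t, 0) (0, 1) (1, 0) := by
    refine (hU.uniqueDiffOn 0 h0U).eq_deriv _ hy ?_
    exact (hasDerivWithinAt_apply_comp (l := fun r => (t, r)) hD (l2 t 0) (fun r hr => hmem t r ht hr) (1, 0)).congr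
      (fun r hr => hb' r hr) (hb' 0 h0U)
  -- At t = 0 this is a boundary point, but it lies in the closure of the interior of the strip,
  -- which suffices for symmetry.
  have hsym : IsSymmSndFDerivWithinAt ℝ h S (t, 0) := by
    refine (hh _ (hmem t 0 ht h0U)).isSymmSndFDerivWithinAt
      (by simpa using WithTop.coe_le_coe.2 (le_top : (2 : ℕ∞) ≤ ⊤)) hS ?_ (hmem t 0 ht h0U)
    rw [hSdef, interior_prod_eq, hU.interior_eq, interior_Ici, closure_prod_eq, closure_Ioi]
    exact ⟨ht, subset_closure h0U⟩
  rw [e1, e2, hsym.eq]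

section Manifold

variable {M : Type*} [TopologicalSpace M] [ChartedSpace (EuclideanSpace ℝ (Fin 3)) M]
  [IsManifold (𝓡 3) ∞ M]

/-- A straight line in the chart at x. It need not be an integral curve, since only its velocity at
0 is used. -/
theorem exists_curve (x : M) (v : TangentSpace (𝓡 3) x) : ∃ (c : ℝ → M) (U : Set ℝ), IsOpen U ∧
    0 ∈ U ∧ c 0 = x ∧ ContMDiffOn 𝓘(ℝ, ℝ) (𝓡 3) ∞ c U ∧
    ∀ k : CM M, HasDerivAt (fun r => k (c r)) (mfderiv (𝓡 3) 𝓘(ℝ, ℝ) k x v) 0 := by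
  let φ := extChartAt (𝓡 3) x
  let w : EuclideanSpace ℝ (Fin 3) := v
  let l : ℝ → EuclideanSpace ℝ (Fin 3) := fun r => φ x + r • w
  have hl : ContDiff ℝ ∞ l := contDiff_const.add (contDiff_id.smul contDiff_const)
  have hl0 : l 0 = φ x := by simp [l]
  have hl' : HasFDerivAt l ((ContinuousLinearMap.id ℝ ℝ).smulRight w) 0 :=
    ((ContinuousLinearMap.id ℝ ℝ).smulRight w).hasFDerivAt.const_add (φ x)
  have hφ : MDifferentiableWithinAt 𝓘(ℝ, EuclideanSpace ℝ (Fin 3)) (𝓡 3) φ.symm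
      (Set.range (𝓡 3)) (φ x) := mdifferentiableWithinAt_extChartAt_symm (mem_extChartAt_target x)
  -- The tangent space at x is identified with the model space by this very chart, so the derivative
  -- at the base point is the identity.
  have hφ' : HasMFDerivWithinAt 𝓘(ℝ, EuclideanSpace ℝ (Fin 3)) (𝓡 3) φ.symm
      (Set.range (𝓡 3)) (φ x) (ContinuousLinearMap.id ℝ (EuclideanSpace ℝ (Fin 3))) := by
    have := hφ.hasMFDerivWithinAt
    rwa [mfderivWithin_range_extChartAt_symm] at this
  refine ⟨φ.symm ∘ l, l ⁻¹' φ.target, (isOpen_extChartAt_target x).preimage hl.continuous,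
    ?_, ?_, ?_, fun k => ?_⟩
  · rw [Set.mem_preimage, hl0]; exact mem_extChartAt_target x
  · rw [Function.comp_apply, hl0]; exact extChartAt_to_inv x
  · exact (contMDiffOn_extChartAt_symm x).comp hl.contMDiff.contMDiffOn fun _ h => h
  · rw [← hl0] at hφ'
    have h1 := hφ'.comp 0 (hl'.hasMFDerivAt.hasMFDerivWithinAt (s := Set.univ)) (by simp)
    have hx : (φ.symm ∘ l) 0 = x := by
      rw [Function.comp_apply, hl0]; exact extChartAt_to_inv x
    have h2 := (mdifferentiableAt_contMDiffMap (𝓡 3) k ((φ.symm ∘ l) 0)).hasMFDerivAt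
    have h3 : HasFDerivAt (fun r => k ((φ.symm ∘ l) r)) (_ : ℝ →L[ℝ] ℝ) 0 :=
      ((h2.comp_hasMFDerivWithinAt 0 h1).hasMFDerivAt Filter.univ_mem).hasFDerivAt
    refine h3.hasDerivAt.congr_deriv ?_
    change mfderiv (𝓡 3) 𝓘(ℝ, ℝ) k ((φ.symm ∘ l) 0) ((1 : ℝ) • w) = _
    rw [one_smul, hx]

theorem contMDiffOn_ptOm {c : ℝ → M} {U : Set ℝ} (hc : ContMDiffOn 𝓘(ℝ, ℝ) (𝓡 3) ∞ c U) :
    ContMDiffOn 𝓘(ℝ, ℝ × ℝ) IOm ∞ (fun p : ℝ × ℝ => ptOm p.1 (c p.2)) (Set.Ici 0 ×ˢ U) := by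
  have h0 : ContMDiff 𝓘(ℝ, ℝ × ℝ) 𝓘(ℝ, EuclideanSpace ℝ (Fin 1)) ∞
      (fun p : ℝ × ℝ => (EuclideanSpace.single 0 p.1 : EuclideanSpace ℝ (Fin 1))) := by
    rw [contMDiff_iff_contDiff]
    refine (contDiff_piLp 2).2 fun i => ?_
    fin_cases i
    simpa using contDiff_fst
  have h1 : ContMDiffOn 𝓘(ℝ, ℝ × ℝ) (𝓡∂ 1) ∞
      (fun p : ℝ × ℝ => (𝓡∂ 1).symm (EuclideanSpace.single 0 p.1)) (Set.Ici 0 ×ˢ U) := by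
    refine (ModelWithCorners.contMDiffOn_symm (𝓡∂ 1)).comp (t := Set.range (𝓡∂ 1))
      h0.contMDiffOn fun p hp => ?_
    rw [range_modelWithCornersEuclideanHalfSpace]
    simpa using hp.1
  exact h1.prodMk (hc.comp contDiff_snd.contMDiff.contMDiffOn fun p hp => hp.2)

/-- With c a curve of velocity X at the given point, both sides are mixed partial derivatives of (s,
r) ↦ f(s, c(r)). -/
theorem del0_lift_apply (X : VF M) (f : COm M) : del0 (lift X f) = lift X (del0 f) := by
  ext q
  obtain ⟨c, U, hU, h0U, hc0, hc, hck⟩ := exists_curve q.2 (X q.2)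
  have ht : 0 ≤ q.1.1 0 := q.1.2
  have hB : ∀ (k : COm M) (s : ℝ),
      HasDerivAt (fun r => k (ptOm s (c r))) (lift X k (ptOm s q.2)) 0 := by
    intro k s
    rw [ptOm, lift_apply]
    exact hck (slice _ k)
  rw [← ptOm_coord q]
  refine mixed_partials (h := fun p => f (ptOm p.1 (c p.2))) (a := fun s => lift X f (ptOm s q.2))
    (b := fun r => del0 f (ptOm (q.1.1 0) (c r))) hU h0U ?_ ht
    (fun s _ => (hB f s).hasDerivWithinAt) (fun r _ => hasDerivWithinAt_del0 f (c r) ht)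
    (hasDerivWithinAt_del0 (lift X f) q.2 ht) (hB (del0 f) _).hasDerivWithinAt
  rw [← contMDiffOn_iff_contDiffOn]
  exact f.contMDiff.comp_contMDiffOn (contMDiffOn_ptOm hc)

theorem del0_lift_commutator (X : VF M) :
    ⁅(del0 : Derivation ℝ (COm M) (COm M)), lift X⁆ = 0 := by
  ext1 f
  rw [Derivation.commutator_apply, del0_lift_apply, sub_self]
  rfl

end Manifold

/-! ### The Lie bracket of vector fields as a commutator -/

set_option linter.unusedSectionVars false

section Manifold

variable {M : Type*} [TopologicalSpace M] [ChartedSpace (EuclideanSpace ℝ (Fin 3)) M]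
  [IsManifold (𝓡 3) ∞ M]

/-- A vector field in the chart at `x`. -/
def chartField (x : M) (V : VF M) : EuclideanSpace ℝ (Fin 3) → EuclideanSpace ℝ (Fin 3) :=
  VectorField.mpullbackWithin 𝓘(ℝ, EuclideanSpace ℝ (Fin 3)) (𝓡 3) (extChartAt (𝓡 3) x).symm V
    (Set.range (𝓡 3))

theorem hasFDerivAt_chart (x : M) (k : CM M) {y : EuclideanSpace ℝ (Fin 3)}
    (hy : y ∈ (extChartAt (𝓡 3) x).target) : ∃ D : EuclideanSpace ℝ (Fin 3) →L[ℝ] ℝ,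
    HasFDerivAt (k ∘ (extChartAt (𝓡 3) x).symm) D y ∧
      ∀ v, D v = mfderiv (𝓡 3) 𝓘(ℝ, ℝ) k ((extChartAt (𝓡 3) x).symm y)
        (mfderivWithin 𝓘(ℝ, EuclideanSpace ℝ (Fin 3)) (𝓡 3) (extChartAt (𝓡 3) x).symm
          (Set.range (𝓡 3)) y v) := by
  have h1 := (mdifferentiableAt_contMDiffMap (𝓡 3) k ((extChartAt (𝓡 3) x).symm y)).hasMFDerivAt
  have h2 := (mdifferentiableWithinAt_extChartAt_symm hy).hasMFDerivWithinAt
  exact ⟨_, ((h1.comp_hasMFDerivWithinAt y h2).hasMFDerivAt (by simp)).hasFDerivAt, fun v => rfl⟩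

theorem fderiv_chart_apply (x : M) (k : CM M) {y : EuclideanSpace ℝ (Fin 3)}
    (hy : y ∈ (extChartAt (𝓡 3) x).target) (v : EuclideanSpace ℝ (Fin 3)) :
    fderiv ℝ (k ∘ (extChartAt (𝓡 3) x).symm) y v
      = mfderiv (𝓡 3) 𝓘(ℝ, ℝ) k ((extChartAt (𝓡 3) x).symm y)
        (mfderivWithin 𝓘(ℝ, EuclideanSpace ℝ (Fin 3)) (𝓡 3) (extChartAt (𝓡 3) x).symm
          (Set.range (𝓡 3)) y v) := by
  obtain ⟨D, hD, h⟩ := hasFDerivAt_chart x k hy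
  rw [hD.fderiv, h]

theorem fderiv_chart_self (x : M) (k : CM M) (v : EuclideanSpace ℝ (Fin 3)) :
    fderiv ℝ (k ∘ (extChartAt (𝓡 3) x).symm) (extChartAt (𝓡 3) x x) v
      = mfderiv (𝓡 3) 𝓘(ℝ, ℝ) k x v := by
  rw [fderiv_chart_apply x k (mem_extChartAt_target x), mfderivWithin_range_extChartAt_symm,
    extChartAt_to_inv]
  rfl

theorem fderiv_chart_chartField (x : M) (V : VF M) (k : CM M) {y : EuclideanSpace ℝ (Fin 3)}
    (hy : y ∈ (extChartAt (𝓡 3) x).target) :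
    fderiv ℝ (k ∘ (extChartAt (𝓡 3) x).symm) y (chartField x V y)
      = lie V k ((extChartAt (𝓡 3) x).symm y) := by
  rw [fderiv_chart_apply x k hy]
  have h := (isInvertible_mfderivWithin_extChartAt_symm hy).self_apply_inverse
    (V ((extChartAt (𝓡 3) x).symm y))
  exact congrArg (mfderiv (𝓡 3) 𝓘(ℝ, ℝ) k ((extChartAt (𝓡 3) x).symm y)) h

theorem differentiableAt_chartField (x : M) (V : VF M) :
    DifferentiableAt ℝ (chartField x V) (extChartAt (𝓡 3) x x) := by
  have : IsManifold (𝓡 3) 2 M :=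
    IsManifold.of_le (n := ∞) (WithTop.coe_le_coe.2 (le_top : (2 : ℕ∞) ≤ ⊤))
  have hV : MDifferentiableWithinAt (𝓡 3) (𝓡 3).tangent
      (fun x => (⟨x, V x⟩ : TangentBundle (𝓡 3) M)) Set.univ x :=
    (V.contMDiff.mdifferentiable (by simp) x).mdifferentiableWithinAt
  exact hV.differentiableWithinAt_mpullbackWithin_vectorField.differentiableAt (by simp)

theorem contDiffAt_chart (x : M) (f : CM M) :
    ContDiffAt ℝ ∞ (f ∘ (extChartAt (𝓡 3) x).symm) (extChartAt (𝓡 3) x x) := by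
  rw [← contMDiffAt_iff_contDiffAt]
  exact f.contMDiff.contMDiffAt.comp _ ((contMDiffOn_extChartAt_symm x).contMDiffAt
    (extChartAt_target_mem_nhds x))

/-- In the chart, W(f) is Df applied to the field near the base point, and the product rule splits
its derivative into a second derivative of f and a derivative of the field. -/
theorem fderiv_chart_lie (x : M) (W : VF M) (f : CM M) (v : EuclideanSpace ℝ (Fin 3)) :
    fderiv ℝ (lie W f ∘ (extChartAt (𝓡 3) x).symm) (extChartAt (𝓡 3) x x) v
      = fderiv ℝ (fderiv ℝ (f ∘ (extChartAt (𝓡 3) x).symm)) (extChartAt (𝓡 3) x x) v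
          (chartField x W (extChartAt (𝓡 3) x x))
        + fderiv ℝ (f ∘ (extChartAt (𝓡 3) x).symm) (extChartAt (𝓡 3) x x)
          (fderiv ℝ (chartField x W) (extChartAt (𝓡 3) x x) v) := by
  have h1 : (lie W f ∘ (extChartAt (𝓡 3) x).symm) =ᶠ[nhds (extChartAt (𝓡 3) x x)]
      fun y => fderiv ℝ (f ∘ (extChartAt (𝓡 3) x).symm) y (chartField x W y) := by
    filter_upwards [extChartAt_target_mem_nhds x] with y hy
    exact (fderiv_chart_chartField x W f hy).symm
  have h2 : DifferentiableAt ℝ (fderiv ℝ (f ∘ (extChartAt (𝓡 3) x).symm)) (extChartAt (𝓡 3) x x) :=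
    ((contDiffAt_chart x f).fderiv_right (m := ∞) (by simp)).differentiableAt (by simp)
  rw [h1.fderiv_eq, (h2.hasFDerivAt.clm_apply (differentiableAt_chartField x W).hasFDerivAt).fderiv]
  simp [add_comm]

/-- The derivative of the chart at its own base point is the identity, so the pullback that defines
the bracket does nothing there. -/
theorem mlieBracket_eq_chart (X Y : VF M) (x : M) :
    (VectorField.mlieBracket (𝓡 3) X Y x : EuclideanSpace ℝ (Fin 3))
      = VectorField.lieBracket ℝ (chartField x X) (chartField x Y) (extChartAt (𝓡 3) x x) := by
  have hS : (extChartAt (𝓡 3) x).symm ⁻¹' Set.univ ∩ Set.range (𝓡 3) = Set.univ := by simp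
  have h1 : VectorField.lieBracketWithin ℝ (chartField x X) (chartField x Y)
      ((extChartAt (𝓡 3) x).symm ⁻¹' Set.univ ∩ Set.range (𝓡 3)) (extChartAt (𝓡 3) x x)
      = VectorField.lieBracket ℝ (chartField x X) (chartField x Y) (extChartAt (𝓡 3) x x) := by
    rw [hS, VectorField.lieBracketWithin_univ]
  have h2 : ∀ (D : EuclideanSpace ℝ (Fin 3) →L[ℝ] EuclideanSpace ℝ (Fin 3))
      (v : EuclideanSpace ℝ (Fin 3)), D = ContinuousLinearMap.id ℝ _ → D.inverse v = v := by
    rintro D v rfl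
    rw [ContinuousLinearMap.inverse_id]; rfl
  have h3 := VectorField.mlieBracketWithin_apply (I := 𝓡 3) (V := X) (W := Y) (s := Set.univ)
    (x₀ := x)
  rw [VectorField.mlieBracketWithin_univ] at h3
  exact h3.trans ((h2 _ _ mfderiv_extChartAt_self).trans h1)

/-- The second derivatives of f cancel by symmetry; the first order terms form Df of the bracket in
the chart. -/
theorem lie_lie_sub (X Y : VF M) (f : CM M) (x : M) : lie X (lie Y f) x - lie Y (lie X f) x
    = (mfderiv (𝓡 3) 𝓘(ℝ, ℝ) f x (VectorField.mlieBracket (𝓡 3) X Y x) : ℝ) := by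
  set y := extChartAt (𝓡 3) x x with hy
  have hyt : y ∈ (extChartAt (𝓡 3) x).target := mem_extChartAt_target x
  have hxy : (extChartAt (𝓡 3) x).symm y = x := extChartAt_to_inv x
  have h1 := fderiv_chart_chartField x X (lie Y f) hyt
  have h2 := fderiv_chart_chartField x Y (lie X f) hyt
  rw [hxy, fderiv_chart_lie] at h1 h2
  have hsym : IsSymmSndFDerivAt ℝ (f ∘ (extChartAt (𝓡 3) x).symm) y :=
    (contDiffAt_chart x f).isSymmSndFDerivAt
      (by simpa using WithTop.coe_le_coe.2 (le_top : (2 : ℕ∞) ≤ ⊤))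
  rw [← h1, ← h2, hsym.eq, add_sub_add_left_eq_sub, ← map_sub]
  rw [fderiv_chart_self]
  exact congrArg (mfderiv (𝓡 3) 𝓘(ℝ, ℝ) f x) (mlieBracket_eq_chart X Y x).symm

end Manifold

/-! ### Frames: structure functions, independence and constants -/

set_option linter.unusedSectionVars false

section Manifold

variable {M : Type*} [TopologicalSpace M] [ChartedSpace (EuclideanSpace ℝ (Fin 3)) M]
  [IsManifold (𝓡 3) ∞ M]

theorem lie_apply (X : VF M) (f : CM M) (x : M) :
    lie X f x = mfderiv (𝓡 3) 𝓘(ℝ, ℝ) f x (X x) := rfl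

theorem lie_eq_sum {D : Fin 3 → VF M} (hD : IsFrame D) (v : ∀ x : M, TangentSpace (𝓡 3) x)
    (f : CM M) (x : M) : (mfderiv (𝓡 3) 𝓘(ℝ, ℝ) f x (v x) : ℝ)
      = ∑ k, (frameBasis hD x).repr (v x) k * lie (D k) f x := by
  conv_lhs => rw [← (frameBasis hD x).sum_repr (v x)]
  rw [map_sum]
  refine Finset.sum_congr rfl fun k _ => ?_
  rw [map_smul, frameBasis_apply]
  rfl

/-- The coefficients of a vector field in a frame. -/
def frameCoeff {D : Fin 3 → VF M} (hD : IsFrame D) (X : VF M) (k : Fin 3) : CM M :=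
  ⟨fun x => (frameBasis hD x).repr (X x) k, contMDiff_frameCoeff hD X.contMDiff k⟩

theorem COm_sum_smul_apply (a : Fin 3 → COm M) (v : Fin 3 → Derivation ℝ (COm M) (COm M))
    (f : COm M) (q : Om M) : (∑ k, a k • v k) f q = ∑ k, a k q * v k f q := by
  simp only [Fin.sum_univ_three]
  rfl

theorem lift_eq_sum {D : Fin 3 → VF M} (hD : IsFrame D) (X : VF M) :
    lift X = ∑ k, pull (frameCoeff hD X k) • lift (D k) := by
  ext f ⟨t, x⟩
  rw [COm_sum_smul_apply, lift_apply, lie_apply, lie_eq_sum hD (fun x => X x)]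
  simp only [lift_apply]
  rfl

theorem lift_commutator {D : Fin 3 → VF M} (hD : IsFrame D) (i j : Fin 3) :
    ⁅(lift (D i) : Derivation ℝ (COm M) (COm M)), lift (D j)⁆
      = ∑ k, pull (structureFun hD i j k) • lift (D k) := by
  ext f ⟨t, x⟩
  have hs : ∀ X : VF M, slice t (lift X f) = lie X (slice t f) := fun X => by
    ext y; exact lift_apply X f t y
  rw [COm_sum_smul_apply, Derivation.commutator_apply]
  change lift (D i) (lift (D j) f) (t, x) - lift (D j) (lift (D i) f) (t, x) = _
  rw [lift_apply, lift_apply, hs, hs, lie_lie_sub]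
  refine (lie_eq_sum hD (fun x => VectorField.mlieBracket (𝓡 3) (D i) (D j) x) _ x).trans ?_
  simp only [lift_apply]
  rfl

/-- A linear function in the chart times a bump function that is 1 near x. The Hausdorff property
makes its extension by zero smooth. -/
theorem exists_bump_mfderiv [T2Space M] (x : M) (l : EuclideanSpace ℝ (Fin 3) →L[ℝ] ℝ) :
    ∃ k : CM M, ∀ v : TangentSpace (𝓡 3) x, (mfderiv (𝓡 3) 𝓘(ℝ, ℝ) k x v : ℝ) = l v := by
  obtain ⟨b⟩ := (inferInstance : Nonempty (SmoothBumpFunction (𝓡 3) x))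
  have hg : ContMDiffOn (𝓡 3) 𝓘(ℝ, ℝ) ∞ (l ∘ extChartAt (𝓡 3) x)
      (chartAt (EuclideanSpace ℝ (Fin 3)) x).source :=
    l.contMDiff.comp_contMDiffOn contMDiffOn_extChartAt
  refine ⟨⟨_, b.contMDiff_smul hg⟩, fun v => ?_⟩
  have he : (fun y => b y • (l ∘ extChartAt (𝓡 3) x) y) =ᶠ[nhds x] l ∘ extChartAt (𝓡 3) x := by
    filter_upwards [b.eventuallyEq_one] with y hy
    rw [hy]; exact one_smul ℝ _
  have h1 : HasMFDerivAt (𝓡 3) 𝓘(ℝ, EuclideanSpace ℝ (Fin 3)) (extChartAt (𝓡 3) x) x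
      (ContinuousLinearMap.id ℝ (EuclideanSpace ℝ (Fin 3))) := by
    have := (mdifferentiableAt_extChartAt (I := 𝓡 3) (mem_chart_source
      (EuclideanSpace ℝ (Fin 3)) x)).hasMFDerivAt
    rwa [mfderiv_extChartAt_self] at this
  have h2 := (l.hasFDerivAt.hasMFDerivAt.comp x h1).mfderiv
  change mfderiv (𝓡 3) 𝓘(ℝ, ℝ) (fun y => b y • (l ∘ extChartAt (𝓡 3) x) y) x v = _
  rw [he.mfderiv_eq, h2]
  rfl

/-- Global functions separate tangent vectors. Independence of lifted derivations and the recovery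
of a field from its derivation rest on this. -/
theorem eq_zero_of_mfderiv [T2Space M] {x : M} {v : TangentSpace (𝓡 3) x}
    (h : ∀ k : CM M, (mfderiv (𝓡 3) 𝓘(ℝ, ℝ) k x v : ℝ) = 0) : v = 0 := by
  have : ∀ i, (show EuclideanSpace ℝ (Fin 3) from v) i = 0 := fun i => by
    obtain ⟨k, hk⟩ := exists_bump_mfderiv x (EuclideanSpace.proj i)
    exact (hk v).symm.trans (h k)
  exact PiLp.ext this

theorem frame_eq_zero [T2Space M] {D : Fin 3 → VF M} (hD : IsFrame D) {x : M} {g : Fin 3 → ℝ}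
    (h : ∀ k : CM M, ∑ i, g i * lie (D i) k x = 0) : g = 0 := by
  have : ∑ i, g i • D i x = 0 := by
    refine eq_zero_of_mfderiv fun k => ?_
    rw [map_sum]
    refine Eq.trans ?_ (h k)
    refine Finset.sum_congr rfl fun i _ => ?_
    rw [map_smul]
    rfl
  exact funext (Fintype.linearIndependent_iff.1 (hD x) g this)

theorem lift_independent [T2Space M] {D : Fin 3 → VF M} (hD : IsFrame D) {a : Fin 3 → COm M}
    (h : ∑ i, a i • lift (D i) = 0) (i : Fin 3) : a i = 0 := by
  ext ⟨t, x⟩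
  refine congrFun (frame_eq_zero hD (x := x) (g := fun i => a i (t, x)) fun k => ?_) i
  have := congrArg (fun v : Derivation ℝ (COm M) (COm M) => v (pull k) (t, x)) h
  simp only [COm_sum_smul_apply, lift_pull] at this
  exact this

theorem lift_injective [T2Space M] {X Y : VF M} (h : (lift X : Derivation ℝ (COm M) (COm M)) = lift Y) :
    X = Y := by
  ext x : 1
  rw [← sub_eq_zero]
  refine eq_zero_of_mfderiv fun k => ?_
  have := congrArg (fun v : Derivation ℝ (COm M) (COm M) => v (pull k) (⟨0, le_rfl⟩, x)) h
  simp only [lift_pull] at this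
  rw [map_sub]
  exact sub_eq_zero.2 this

/-- The frame condition makes the whole differential vanish, hence f is constant on balls in charts,
and connectedness does the rest. -/
theorem exists_const_of_lie_eq_zero [ConnectedSpace M] {D : Fin 3 → VF M} (hD : IsFrame D)
    {f : CM M} (h : ∀ i, lie (D i) f = 0) : ∃ r : ℝ, ∀ x, f x = r := by
  have h0 : ∀ x (v : EuclideanSpace ℝ (Fin 3)), (mfderiv (𝓡 3) 𝓘(ℝ, ℝ) f x v : ℝ) = 0 := by
    intro x v
    refine (lie_eq_sum hD (fun _ => v) f x).trans ?_
    simp only [h]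
    exact Finset.sum_eq_zero fun k _ => mul_zero ((frameBasis hD x).repr v k)
  have hloc : IsLocallyConstant f := by
    rw [IsLocallyConstant.iff_eventually_eq]
    intro x
    obtain ⟨r, hr, hb⟩ := Metric.mem_nhds_iff.1 (extChartAt_target_mem_nhds (I := 𝓡 3) x)
    have hx : extChartAt (𝓡 3) x x ∈ Metric.ball (extChartAt (𝓡 3) x x) r := Metric.mem_ball_self hr
    have hev : ∀ᶠ y in nhds x, y ∈ (extChartAt (𝓡 3) x).source ∧
        extChartAt (𝓡 3) x y ∈ Metric.ball (extChartAt (𝓡 3) x x) r :=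
      Filter.Eventually.and (extChartAt_source_mem_nhds x)
        ((continuousAt_extChartAt x).preimage_mem_nhds (Metric.ball_mem_nhds _ hr))
    filter_upwards [hev] with y hy
    have hc := Metric.isOpen_ball.is_const_of_fderiv_eq_zero (𝕜 := ℝ)
      (f := f ∘ (extChartAt (𝓡 3) x).symm) (convex_ball _ r).isPreconnected
      (fun z hz => by
        obtain ⟨A, hA, -⟩ := hasFDerivAt_chart x f (hb hz)
        exact hA.differentiableAt.differentiableWithinAt)
      (fun z hz => by
        ext v
        rw [fderiv_chart_apply x f (hb hz)]
        exact h0 _ _) hy.2 hx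
    simpa only [Function.comp_apply, (extChartAt (𝓡 3) x).left_inv hy.1, extChartAt_to_inv] using hc
  obtain ⟨x⟩ := (inferInstance : Nonempty M)
  exact ⟨f x, fun y => hloc.apply_eq_of_isPreconnected isPreconnected_univ trivial trivial⟩

theorem lie_add_const (X : VF M) {f g : CM M} {r : ℝ} (h : ∀ x, g x = f x + r) :
    lie X g = lie X f := by
  have : g = f + algebraMap ℝ (CM M) r := by ext x; exact h x
  rw [this, lie, map_add, Derivation.map_algebraMap, add_zero]; rfl

/-- The linear combination of vector fields with the given coefficients. -/
def combination (m : Fin 3 → CM M) (L : Fin 3 → VF M) : VF M :=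
  ⟨fun x => ∑ l, m l x • L l x,
    .sum_section fun l _ => (m l).contMDiff.smul_section (L l).contMDiff⟩

theorem lift_combination (m : Fin 3 → CM M) (L : Fin 3 → VF M) :
    lift (combination m L) = ∑ l, pull (m l) • lift (L l) := by
  ext f ⟨t, x⟩
  rw [COm_sum_smul_apply, lift_apply, lie_apply]
  change mfderiv (𝓡 3) 𝓘(ℝ, ℝ) (slice t f) x (∑ l, m l x • L l x) = _
  rw [map_sum]
  refine Finset.sum_congr rfl fun l _ => ?_
  rw [map_smul, lift_apply]
  rfl

end Manifold

/-! ### Consequences of the torsion equation -/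

section Algebra

set_option linter.unusedSectionVars false

variable {R : Type*} [CommRing R] [Algebra ℝ R]

theorem lie_smul_derivation (u v : Derivation ℝ R R) (r : R) :
    ⁅u, r • v⁆ = u r • v + r • ⁅u, v⁆ := by
  ext g
  simp only [Derivation.commutator_apply, Derivation.smul_apply, Derivation.add_apply, smul_eq_mul,
    Derivation.leibniz]
  ring

theorem smul_lie_smul (u v : Derivation ℝ R R) (r s : R) :
    ⁅r • u, s • v⁆ = (r * u s) • v - (s * v r) • u + (r * s) • ⁅u, v⁆ := by
  ext g
  simp only [Derivation.commutator_apply, Derivation.smul_apply, Derivation.add_apply,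
    Derivation.sub_apply, smul_eq_mul, Derivation.leibniz]
  ring

/-- Linear independence of three derivations. -/
def Independent (V : Fin 3 → Derivation ℝ R R) : Prop :=
  ∀ a : Fin 3 → R, ∑ i, a i • V i = 0 → ∀ i, a i = 0

theorem Independent.eq_zero {V : Fin 3 → Derivation ℝ R R} (h : Independent V) (i : Fin 3)
    {x y z : R} (e : x • V i + y • V (i + 1) + z • V (i + 2) = 0) : x = 0 ∧ y = 0 ∧ z = 0 := by
  have h' := h (fun m => if m = i then x else if m = i + 1 then y else z)
    (by rw [fin3_sum_cyclic _ i]; simpa using e)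
  exact ⟨by simpa using h' i, by simpa using h' (i + 1), by simpa using h' (i + 2)⟩

namespace Gauge

variable {G : Gauge R}

/-- The equation `[V_j, V_k] = -2n_i V_i + (a_k + w_k) V_j - (w_j - b_j) V_k`. -/
def LieV (G : Gauge R) : Prop := ∀ i, ⁅G.V (i + 1), G.V (i + 2)⁆ + (2 * G.n i) • G.V i
    - (G.a (i + 2) + G.w (i + 2)) • G.V (i + 1) + (G.w (i + 1) - G.b (i + 1)) • G.V (i + 2) = 0

theorem LieV.eq (h : G.LieV) (i : Fin 3) : ⁅G.V (i + 1), G.V (i + 2)⁆ = (-(2 * G.n i)) • G.V i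
    + (G.a (i + 2) + G.w (i + 2)) • G.V (i + 1) - (G.w (i + 1) - G.b (i + 1)) • G.V (i + 2) := by
  rw [← sub_eq_zero, ← h i]
  module

/-- Apply the commutator of V_j and V_k to the potential g: an exact form is closed. -/
theorem LieV.curl (h : G.LieV) {g : R} {u : Fin 3 → R} (hg : ∀ i, G.V i g = u i) (i : Fin 3) :
    G.V (i + 1) (u (i + 2)) - G.V (i + 2) (u (i + 1)) = -(2 * G.n i) * u i
      + (G.a (i + 2) + G.w (i + 2)) * u (i + 1) - (G.w (i + 1) - G.b (i + 1)) * u (i + 2) := by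
  have := congrArg (fun v : Derivation ℝ R R => v g) (h.eq i)
  simpa only [Derivation.commutator_apply, Derivation.add_apply, Derivation.sub_apply,
    Derivation.smul_apply, smul_eq_mul, hg] using this

/-- The V_i component of the Jacobi identity for V, expanded by inserting the torsion equation
twice. It contains derivatives of w, which occur as the curl of w and are eliminated by `LieV.curl`.
-/
theorem LieV.jacobi (h : G.LieV) (hV : Independent G.V) {g : R} (hg : ∀ i, G.V i g = G.w i)
    (i : Fin 3) : G.V (i + 1) (G.b (i + 2)) + G.V (i + 2) (G.a (i + 1)) - 2 * G.V i (G.n i)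
      + 2 * G.n i * (G.b i - G.a i - G.w i) + G.a (i + 1) * G.a (i + 2) - G.b (i + 1) * G.b (i + 2)
      + G.a (i + 1) * G.w (i + 2) + G.b (i + 2) * G.w (i + 1) = 0 := by
  have h0 := h.eq i
  have h1 := h.eq (i + 1)
  have h2 := h.eq (i + 2)
  simp only [fin3_add_one_add_one, fin3_add_one_add_two, fin3_add_two_add_one,
    fin3_add_two_add_two] at h1 h2
  have hc := h.curl hg i
  have hneg : ∀ u v : Derivation ℝ R R, ⁅u, v⁆ = -⁅v, u⁆ := fun u v => (lie_skew u v).symm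
  have hj := lie_jacobi (G.V i) (G.V (i + 1)) (G.V (i + 2))
  rw [h0, h1, h2] at hj
  simp only [lie_add, lie_sub, lie_smul_derivation, lie_self] at hj
  rw [hneg (G.V i) (G.V (i + 2)), hneg (G.V (i + 1)) (G.V i), hneg (G.V (i + 2)) (G.V (i + 1)),
    h0, h1, h2] at hj
  have htwo : ∀ (v : Derivation ℝ R R) (r : R), v (2 * r) = 2 * v r := fun v r => by
    rw [two_mul, map_add, two_mul]
  simp only [map_neg, map_add, map_sub, htwo] at hj
  -- The coefficient of V_i in the expanded Jacobi identity; by cyclic symmetry those of V_j and V_k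
  -- are e_{i+1} and e_{i+2}.
  obtain ⟨e, he⟩ : ∃ e : Fin 3 → R, ∀ i, e i = -2 * G.V i (G.n i)
    + (G.a (i + 1) + G.w (i + 1)) * (G.a (i + 2) + G.w (i + 2))
    - (G.w (i + 1) - G.b (i + 1)) * (G.w (i + 2) - G.b (i + 2))
    - 2 * G.n i * (G.a i + G.w i) - (G.V (i + 1) (G.w (i + 2)) - G.V (i + 1) (G.b (i + 2)))
    + (G.V (i + 2) (G.a (i + 1)) + G.V (i + 2) (G.w (i + 1))) - 2 * G.n i * (G.w i - G.b i) :=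
    ⟨_, fun _ => rfl⟩
  have hei : e i = 0 := by
    refine (hV.eq_zero i (x := e i) (y := e (i + 1)) (z := e (i + 2)) (Eq.trans ?_ hj)).1
    simp only [he, fin3_add_one_add_one, fin3_add_one_add_two, fin3_add_two_add_one,
      fin3_add_two_add_two]
    module
  rw [he] at hei
  linear_combination hei + hc

/-- Uniqueness of the torsion-free connection within the gauge: the difference of the two torsion
equations is a linear relation between the V_i. -/
theorem eq_of_lieV {H : Gauge R} (hG : G.LieV) (hH : H.LieV) (hV : Independent G.V)
    (hVV : G.V = H.V) (hw : G.w = H.w) : G.n = H.n ∧ G.a = H.a ∧ G.b = H.b := by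
  have key : ∀ i, 2 * (G.n i - H.n i) = 0 ∧ H.a (i + 2) - G.a (i + 2) = 0
      ∧ H.b (i + 1) - G.b (i + 1) = 0 := fun i => by
    refine hV.eq_zero i ?_
    have h1 := hG i
    have h2 := hH i
    rw [← hVV, ← hw] at h2
    rw [← sub_eq_zero.2 (h1.trans h2.symm)]
    module
  refine ⟨funext fun i => sub_eq_zero.1 (eq_zero_of_two_mul (key i).1), funext fun i => ?_,
    funext fun i => ?_⟩
  · have := (key (i + 1)).2.1
    rw [fin3_add_one_add_two] at this
    exact (sub_eq_zero.1 this).symm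
  · have := (key (i + 2)).2.2
    rw [fin3_add_two_add_one] at this
    exact (sub_eq_zero.1 this).symm

end Gauge

end Algebra

/-! ### Tuples over an abstract ring: reduction to the constraints -/

section Algebra

set_option linter.unusedSectionVars false

variable {R : Type*} [CommRing R] [Algebra ℝ R]

variable (R) in
/-- A tuple `(D₁, D₂, D₃, p₁, p₂, p₃, p₀, ζ, χ)` together with the time coordinate, the structure
functions and the functions `e^{-p_i τ}`, over an abstract ring. -/
structure Tuple where
  d0 : Derivation ℝ R R
  X : Fin 3 → Derivation ℝ R R
  tau : R
  f : R
  zeta : R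
  chi : R
  p : Fin 3 → R
  c : Fin 3 → Fin 3 → Fin 3 → R
  E : Fin 3 → R

namespace Tuple

/-- The calculus rules that hold on `[0,∞) × M³`. -/
structure Rules (T : Tuple R) : Prop where
  d0_tau : T.d0 T.tau = 1
  X_tau : ∀ i, T.X i T.tau = 0
  d0_f : T.d0 T.f = 0
  d0_zeta : T.d0 T.zeta = 0
  d0_chi : T.d0 T.chi = 0
  d0_p : ∀ i, T.d0 (T.p i) = 0
  d0_c : ∀ i j k, T.d0 (T.c i j k) = 0
  d0_E : ∀ i, T.d0 (T.E i) = -(T.p i * T.E i)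
  X_E : ∀ l i, T.X l (T.E i) = -(T.tau * T.X l (T.p i) * T.E i)
  d0_X : ∀ i, ⁅T.d0, T.X i⁆ = 0
  lie_X : ∀ i j, ⁅T.X i, T.X j⁆ = ∑ k, T.c i j k • T.X k
  isUnit_E : ∀ i, IsUnit (T.E i)

variable (T : Tuple R)

/-- The factor `𝔰_j 𝔰_k`. -/
def E2 (i : Fin 3) : R := T.E (i + 1) * T.E (i + 2)

/-- The coefficients of the associated gauged element. -/
def gauge : Gauge R where
  p := T.p
  n i := -((1 / 2 : ℝ) • (T.E i ^ 2 * T.c (i + 1) (i + 2) i))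
  w i := -(T.E2 i * (T.X i T.zeta - T.tau * T.X i (T.p 0 + T.p 1 + T.p 2)))
  a i := T.E2 i * (T.X i T.zeta + T.c (i + 2) i (i + 2) - T.tau * T.X i (T.p (i + 2)))
  b i := -(T.E2 i * (T.X i T.zeta - T.c i (i + 1) (i + 1) - T.tau * T.X i (T.p (i + 1))))
  q i := T.E2 i * (T.X i T.chi + T.tau * T.X i T.f)
  f := T.f
  d0 := T.d0
  V i := T.E2 i • T.X i

/-- The right hand side of the first constraint equation. -/
def hamiltonian : R := 3 * T.f ^ 2 - T.p 1 * T.p 2 - T.p 2 * T.p 0 - T.p 0 * T.p 1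

/-- The right hand side of the momentum constraint equation. -/
def momentum (i : Fin 3) : R := -((1 / 2 : ℝ) • T.X i (T.p (i + 1) + T.p (i + 2)))
  - (1 / 2 : ℝ) • (T.c i (i + 1) (i + 1) * (T.p i - T.p (i + 1)))
  + (1 / 2 : ℝ) • (T.c (i + 2) i (i + 2) * (T.p i - T.p (i + 2)))
  + T.p i * T.X i T.zeta + 3 * T.f * T.X i T.chi

theorem two_mul_half (r : R) : 2 * ((1 / 2 : ℝ) • r) = r := by
  rw [two_mul, ← add_smul]; norm_num

variable {T}

theorem two_mul_n (i : Fin 3) : 2 * T.gauge.n i = -(T.E i ^ 2 * T.c (i + 1) (i + 2) i) := by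
  rw [gauge, mul_neg, two_mul_half]

theorem sum_p (i : Fin 3) : T.p 0 + T.p 1 + T.p 2 = T.p i + T.p (i + 1) + T.p (i + 2) := by
  rw [← fin3_sum_cyclic T.p i, Fin.sum_univ_three]

namespace Rules

theorem d0_X_apply (h : T.Rules) (i : Fin 3) (g : R) : T.d0 (T.X i g) = T.X i (T.d0 g) := by
  have := congrArg (fun v : Derivation ℝ R R => v g) (h.d0_X i)
  simpa [Derivation.commutator_apply, sub_eq_zero] using this

theorem d0_E2 (h : T.Rules) (i : Fin 3) : T.d0 (T.E2 i) = -((T.p (i + 1) + T.p (i + 2)) * T.E2 i) := by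
  rw [E2, Derivation.leibniz, h.d0_E, h.d0_E, smul_eq_mul, smul_eq_mul]; ring

theorem X_E2 (h : T.Rules) (l i : Fin 3) :
    T.X l (T.E2 i) = -(T.tau * (T.X l (T.p (i + 1)) + T.X l (T.p (i + 2))) * T.E2 i) := by
  rw [E2, Derivation.leibniz, h.X_E, h.X_E, smul_eq_mul, smul_eq_mul]; ring

theorem X_c (h : T.Rules) (i j : Fin 3) : T.d0 (T.X i (T.p j)) = 0 := by
  rw [h.d0_X_apply, h.d0_p, map_zero]

/-- The factors in [E_kE_iX_j, E_iE_jX_k] multiply to E_i² · E_jE_k, which explains the 𝔰_i² in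
front of c_{jk}^i. Derivatives of the exponentials give the terms linear in τ, and ζ cancels in a_k
+ w_k and w_j - b_j. -/
theorem lieV (h : T.Rules) : T.gauge.LieV := by
  intro i
  have e1 := h.X_E2 (i + 1) (i + 2)
  have e2 := h.X_E2 (i + 2) (i + 1)
  have hl := h.lie_X (i + 1) (i + 2)
  rw [fin3_sum_cyclic _ i] at hl
  simp only [fin3_add_one_add_one, fin3_add_one_add_two, fin3_add_two_add_one,
    fin3_add_two_add_two] at e1 e2
  rw [two_mul_n]
  simp only [gauge, sum_p i, smul_lie_smul, fin3_add_one_add_one, fin3_add_two_add_two, e1, e2, hl, map_add]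
  have hE : T.E2 i = T.E (i + 1) * T.E (i + 2) := rfl
  have hE1 : T.E2 (i + 1) = T.E (i + 2) * T.E i := by simp [E2]
  have hE2 : T.E2 (i + 2) = T.E i * T.E (i + 1) := by simp [E2]
  rw [hE, hE1, hE2]
  module

/-- Propagation of the constraints: the momentum equation is affine in τ up to the exponential
factor, and its τ coefficient is the spatial derivative of the Hamiltonian constraint. -/
theorem momentum_eq (i : Fin 3) :
    T.gauge.V i (T.gauge.p (i + 1)) + T.gauge.V i (T.gauge.p (i + 2))
      - T.gauge.a i * (T.gauge.p i - T.gauge.p (i + 2))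
      + T.gauge.b i * (T.gauge.p i - T.gauge.p (i + 1)) - 6 * T.gauge.f * T.gauge.q i
      + (T.gauge.p (i + 1) + T.gauge.p (i + 2)) * T.gauge.w i
    = -(2 * T.momentum i * T.E2 i) - T.tau * T.X i T.hamiltonian * T.E2 i := by
  have hH : T.hamiltonian
      = 3 * T.f ^ 2 - T.p (i + 1) * T.p (i + 2) - T.p (i + 2) * T.p i - T.p i * T.p (i + 1) := by
    match i with
    | 0 => rfl
    | 1 =>
      change 3 * T.f ^ 2 - _ - _ - _ = 3 * T.f ^ 2 - T.p 2 * T.p 0 - T.p 0 * T.p 1 - T.p 1 * T.p 2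
      ring
    | 2 =>
      change 3 * T.f ^ 2 - _ - _ - _ = 3 * T.f ^ 2 - T.p 0 * T.p 1 - T.p 1 * T.p 2 - T.p 2 * T.p 0
      ring
  have e : ∀ r : R, 2 * ((1 / 2 : ℝ) • r) = r := two_mul_half
  have h3 : ∀ r : R, T.X i (3 * r) = 3 * T.X i r := fun r => by
    simpa [nsmul_eq_mul] using map_nsmul (T.X i) 3 r
  have hm : 2 * T.momentum i = -T.X i (T.p (i + 1) + T.p (i + 2))
      - T.c i (i + 1) (i + 1) * (T.p i - T.p (i + 1))
      + T.c (i + 2) i (i + 2) * (T.p i - T.p (i + 2))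
      + 2 * (T.p i * T.X i T.zeta + 3 * T.f * T.X i T.chi) := by
    rw [momentum]
    linear_combination -e (T.X i (T.p (i + 1) + T.p (i + 2)))
      - e (T.c i (i + 1) (i + 1) * (T.p i - T.p (i + 1)))
      + e (T.c (i + 2) i (i + 2) * (T.p i - T.p (i + 2)))
  rw [hm, hH]
  simp only [gauge, sum_p i, map_add, map_sub, h3, Derivation.smul_apply, smul_eq_mul, Derivation.leibniz,
    Derivation.leibniz_pow]
  simp
  ring

/-- The function τ(p₁+p₂+p₃) - ζ is the potential of the σ₀ part, and τp₀ + χ that of the scalar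
field. They give exactness as well as the curl equations. -/
theorem potential_w (h : T.Rules) (i : Fin 3) :
    T.gauge.V i (T.tau * (T.p 0 + T.p 1 + T.p 2) - T.zeta) = T.gauge.w i := by
  simp only [gauge, Derivation.smul_apply, smul_eq_mul, map_sub, Derivation.leibniz, h.X_tau]
  ring

theorem d0_potential_w (h : T.Rules) : T.d0 (T.tau * (T.p 0 + T.p 1 + T.p 2) - T.zeta)
    = T.p 0 + T.p 1 + T.p 2 := by
  simp only [smul_eq_mul, map_sub, map_add, Derivation.leibniz, h.d0_tau, h.d0_p, h.d0_zeta]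
  ring

theorem potential_q (h : T.Rules) (i : Fin 3) : T.gauge.V i (T.tau * T.f + T.chi) = T.gauge.q i := by
  simp only [gauge, Derivation.smul_apply, smul_eq_mul, map_add, Derivation.leibniz, h.X_tau]
  ring

theorem d0_potential_q (h : T.Rules) : T.d0 (T.tau * T.f + T.chi) = T.f := by
  simp only [smul_eq_mul, map_add, Derivation.leibniz, h.d0_tau, h.d0_f, h.d0_chi]
  ring

theorem isUnit_E2 (h : T.Rules) (i : Fin 3) : IsUnit (T.E2 i) := (h.isUnit_E _).mul (h.isUnit_E _)

theorem independent (h : T.Rules) (hX : Independent T.X) : Independent T.gauge.V := by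
  intro a ha i
  have := hX (fun i => a i * T.E2 i) (by simpa [gauge, mul_smul] using ha) i
  exact (h.isUnit_E2 i).mul_left_eq_zero.1 this

/-- For a tuple all equations except the Hamiltonian and momentum ones hold identically. Once the
Hamiltonian constraint holds, its derivative drops out of the momentum equation, and the unit E_jE_k
can be cancelled. -/
theorem equations_iff (h : T.Rules) (hX : Independent T.X) :
    T.gauge.Equations ↔ T.hamiltonian = 0 ∧ ∀ i, T.momentum i = 0 := by
  constructor
  · intro e
    have h0 : T.hamiltonian = 0 := by
      have : T.p 0 * T.p 1 + T.p 1 * T.p 2 + T.p 2 * T.p 0 - 3 * T.f ^ 2 = 0 := e.hamiltonian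
      rw [hamiltonian]
      linear_combination -this
    refine ⟨h0, fun i => ?_⟩
    have := e.momentum i
    rw [momentum_eq, h0, map_zero, mul_zero, zero_mul, sub_zero, neg_eq_zero] at this
    exact eq_zero_of_two_mul ((h.isUnit_E2 i).mul_left_eq_zero.1 this)
  · rintro ⟨h0, hm⟩
    have hn : T.gauge.LieV := h.lieV
    have d2 : ∀ r : R, T.d0 (2 * r) = 2 * T.d0 r := fun r => by
      rw [two_mul, map_add, two_mul]
    have hp := fun i j => h.X_c i j
    have hz := fun i => h.d0_X_apply i T.zeta
    have hc := fun i => h.d0_X_apply i T.chi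
    have hf := fun i => h.d0_X_apply i T.f
    simp only [h.d0_zeta, h.d0_chi, h.d0_f, map_zero] at hz hc hf
    refine ⟨?_, h.d0_p, h.d0_f, fun i => ?_, fun i => ?_, fun i => ?_, fun i => ?_, fun i => ?_,
      fun i => ?_, fun i => ?_, hn, fun i => ?_, fun i => ?_,
      hn.jacobi (h.independent hX) h.potential_w⟩
    · rw [hamiltonian] at h0
      change T.p 0 * T.p 1 + T.p 1 * T.p 2 + T.p 2 * T.p 0 - 3 * T.f ^ 2 = 0
      linear_combination -h0
    -- Doubling removes the real scalar 1/2 in the definition of n.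
    · refine eq_zero_of_two_mul ?_
      have e1 : 2 * T.d0 (T.gauge.n i) = T.d0 (-(T.E i ^ 2 * T.c (i + 1) (i + 2) i)) := by
        rw [← d2, two_mul_n]
      rw [map_neg, Derivation.leibniz, h.d0_c, smul_zero, zero_add, sq, Derivation.leibniz,
        h.d0_E] at e1
      simp only [smul_eq_mul] at e1
      change 2 * (T.d0 (T.gauge.n i) + 2 * T.p i * T.gauge.n i) = 0
      linear_combination e1 + 2 * T.p i * two_mul_n (T := T) i
    · simp only [gauge, sum_p i, Derivation.smul_apply, smul_eq_mul, map_neg, map_sub, map_add,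
        Derivation.leibniz, h.d0_E2, h.d0_tau, hp, hz]
      ring
    · simp only [gauge, Derivation.smul_apply, smul_eq_mul, map_sub, map_add,
        Derivation.leibniz, h.d0_E2, h.d0_tau, h.d0_c, hp, hz]
      ring
    · simp only [gauge, Derivation.smul_apply, smul_eq_mul, map_neg, map_sub, map_add,
        Derivation.leibniz, h.d0_E2, h.d0_tau, h.d0_c, hp, hz]
      ring
    · simp only [gauge, Derivation.smul_apply, smul_eq_mul, map_add,
        Derivation.leibniz, h.d0_E2, h.d0_tau, hc, hf]
      ring
    · change ⁅T.d0, T.E2 i • T.X i⁆ + (T.p (i + 1) + T.p (i + 2)) • (T.E2 i • T.X i) = 0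
      rw [lie_smul_derivation, h.d0_X, h.d0_E2]
      module
    · rw [momentum_eq, h0, hm]
      simp
    · have := hn.curl h.potential_w i
      linear_combination this
    · have := hn.curl h.potential_q i
      linear_combination this

end Rules

end Tuple

end Algebra

/-! ### Cancellation of the exponential factors -/

section Algebra

set_option linter.unusedSectionVars false

variable {R : Type*} [CommRing R] [Algebra ℝ R]

theorem mul_sub_cancel_of_isUnit {e x y z : R} (he : IsUnit e) (h : -(e * (x - z)) = -(e * (y - z))) :
    x = y := by
  have := he.mul_left_cancel (neg_injective h)
  linear_combination this

theorem mul_add_cancel_of_isUnit {e x y z : R} (he : IsUnit e) (h : e * (x + z) = e * (y + z)) :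
    x = y := add_right_cancel (he.mul_left_cancel h)

theorem smul_cancel_of_isUnit {e : R} {u v : Derivation ℝ R R} (he : IsUnit e)
    (h : e • u = e • v) : u = v := he.smul_left_cancel.1 h

theorem mul_sum_smul {e f : R} (he : e * f = 1) (b : Fin 3 → R) (v : Fin 3 → Derivation ℝ R R) :
    ∑ l, b l • v l = e • ∑ l, (f * b l) • v l := by
  rw [Finset.smul_sum]
  refine Finset.sum_congr rfl fun l _ => ?_
  rw [smul_smul, ← mul_assoc, he, one_mul]

/-- A scaled frame with `[∂₀, V] + rV = 0` has constant coefficients. -/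
theorem derivation_scaled_coeff {d0 : Derivation ℝ R R} {v : Fin 3 → Derivation ℝ R R}
    (hv : Independent v) (hd : ∀ l, ⁅d0, v l⁆ = 0) {b : Fin 3 → R} {r f : R}
    (h : ⁅d0, ∑ l, b l • v l⁆ + r • ∑ l, b l • v l = 0) (hf : d0 f = r * f) (l : Fin 3) :
    d0 (f * b l) = 0 := by
  have h0 : ∑ l, (d0 (b l) + r * b l) • v l = 0 := by
    rw [← h]
    simp only [Fin.sum_univ_three, lie_add, lie_smul_derivation, hd]
    module
  have := hv _ h0 l
  rw [Derivation.leibniz, hf, smul_eq_mul, smul_eq_mul]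
  linear_combination f * this

end Algebra

/-! ### From the abstract ring back to Ω: both directions of the correspondence -/

section Manifold

set_option linter.unusedSectionVars false

variable {M : Type*} [TopologicalSpace M] [ChartedSpace (EuclideanSpace ℝ (Fin 3)) M]
  [IsManifold (𝓡 3) ∞ M]

theorem pull_neg (f : CM M) : pull (-f) = -pull f := rfl

theorem pull_add (f g : CM M) : pull (f + g) = pull f + pull g := rfl

theorem expOm_ne_zero (f : COm M) (q : Om M) : expOm f q ≠ 0 := (Real.exp_pos _).ne'

theorem expOm_add (f g : COm M) : expOm (f + g) = expOm f * expOm g := by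
  ext q
  exact Real.exp_add _ _

theorem isUnit_expOm (f : COm M) : IsUnit (expOm f) :=
  IsUnit.of_mul_eq_one _ (expOm_mul_expOm_neg f)

theorem del0_expOm_mul_tau (f : CM M) :
    del0 (expOm (pull f * tau)) = pull f * expOm (pull f * tau) := by
  rw [del0, derivation_expOm]
  change _ * del0 (pull f * tau) = _
  rw [Derivation.leibniz, del0_tau, del0_pull, smul_zero, add_zero, smul_eq_mul, mul_one, mul_comm]

theorem independent_lift [T2Space M] {D : Fin 3 → VF M} (hD : IsFrame D) :
    Independent fun i => (lift (D i) : Derivation ℝ (COm M) (COm M)) :=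
  fun _ h i => lift_independent hD h i

/-- The field ∂₀ is transversal to the slices and the factors E_i never vanish, so nondegeneracy on
Ω is the frame condition on M. -/
theorem isNondegenerate_iff [T2Space M] {G : Gauge (COm M)} {E : Fin 3 → COm M} {D : Fin 3 → VF M}
    (hd : G.d0 = del0) (hV : ∀ i, G.V i = E i • lift (D i)) (hE : ∀ i q, E i q ≠ 0) :
    IsNondegenerate G.series ↔ IsFrame D := by
  have key : ∀ (q : Om M) (g : Fin 4 → ℝ) (f : COm M),
      (∑ a, g a • Derivation.evalAt q (frameOf (setOne G.series) a)) f
        = g 0 * del0 f q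
          + ∑ i : Fin 3, g i.succ * E i q * lie (D i) (slice q.1 f) q.2 := by
    intro q g f
    rw [Fin.sum_univ_succ, G.frameOf_zero, hd]
    simp only [G.frameOf_succ, hV, Fin.sum_univ_three, mul_assoc]
    simp only [← lift_apply]
    rfl
  constructor
  · intro h x
    rw [Fintype.linearIndependent_iff]
    intro g hg i
    have h0 := Fintype.linearIndependent_iff.1 (h (ptOm 0 x))
      -- Transport a linear relation on M to τ = 0, with no ∂₀ component and the factors E_i divided
      -- out.
      (Fin.cons 0 fun i => g i / E i (ptOm 0 x)) (by
        ext f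
        refine (key _ _ f).trans ?_
        simp only [Fin.cons_zero, Fin.cons_succ, zero_mul, zero_add]
        have hk := congrArg (fun v => (mfderiv (𝓡 3) 𝓘(ℝ, ℝ) (slice (ptOm 0 x).1 f) x v : ℝ)) hg
        simp only [map_sum, map_smul, map_zero] at hk
        refine Eq.trans (Finset.sum_congr rfl fun i _ => ?_) hk
        rw [div_mul_cancel₀ _ (hE _ _)]
        rfl) i.succ
    simp only [Fin.cons_succ] at h0
    exact (div_eq_zero_iff.1 h0).resolve_right (hE _ _)
  · intro h q
    rw [Fintype.linearIndependent_iff]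
    intro g hg
    have hk := fun f => (key q g f).symm.trans (congrArg (fun v => v f) hg)
    -- Test on τ, which the lifted fields annihilate; functions from M then detect the spatial
    -- coefficients.
    have h0 : g 0 = 0 := by
      have : _ = (0 : ℝ) := hk tau
      simp only [← lift_apply, lift_tau, del0_tau] at this
      simpa using this
    have h1 : (fun i : Fin 3 => g i.succ * E i q) = 0 := by
      refine frame_eq_zero h (x := q.2) fun k => ?_
      have := hk (pull k)
      rw [h0, zero_mul, zero_add] at this
      exact this
    refine Fin.cases h0 fun i => ?_
    exact (mul_eq_zero.1 (congrFun h1 i)).resolve_right (hE i q)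

namespace Data

variable (T : Data M)

/-- The tuple over the ring of smooth functions. -/
def tuple : Tuple (COm M) :=
  ⟨del0, fun i => lift (T.D i), tau, pull T.p0, pull T.zeta, pull T.chi, fun i => pull (T.p i),
    fun i j k => pull (T.c i j k), T.decay⟩

theorem gauge_eq : T.gauge = T.tuple.gauge := by
  have hw : T.coeffW = T.tuple.gauge.w := funext fun i => by
    rw [coeffW, ← lift_pull, ← lift_pull]; rfl
  have ha : T.coeffA = T.tuple.gauge.a := funext fun i => by
    rw [coeffA, ← lift_pull, ← lift_pull]; rfl
  have hb : T.coeffB = T.tuple.gauge.b := funext fun i => by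
    rw [coeffB, ← lift_pull, ← lift_pull]; rfl
  have hq : T.coeffQ = T.tuple.gauge.q := funext fun i => by
    rw [coeffQ, ← lift_pull, ← lift_pull]; rfl
  rw [gauge, hw, ha, hb, hq]
  rfl

theorem rules : T.tuple.Rules where
  d0_tau := del0_tau
  X_tau i := lift_tau (T.D i)
  d0_f := del0_pull _
  d0_zeta := del0_pull _
  d0_chi := del0_pull _
  d0_p _ := del0_pull _
  d0_c _ _ _ := del0_pull _
  d0_E i := by
    have := del0_expOm_mul_tau (-T.p i)
    have hE : T.tuple.E i = expOm (pull (-T.p i) * tau) :=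
      congrArg expOm (neg_mul (pull (T.p i)) tau).symm
    rw [hE]
    rw [pull_neg] at this ⊢
    exact this.trans (neg_mul (pull (T.p i)) (expOm _))
  X_E l i := by
    change vfDerivation IOm _ (expOm _) = _
    rw [derivation_expOm]
    change T.decay i * lift (T.D l) (-(pull (T.p i) * tau)) = -(tau * lift (T.D l) (pull (T.p i)) * T.decay i)
    rw [map_neg, Derivation.leibniz, lift_tau, smul_zero, zero_add, smul_eq_mul]
    ring
  d0_X i := del0_lift_commutator _
  lie_X i j := lift_commutator T.frame i j
  isUnit_E i := isUnit_expOm _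

theorem tuple_hamiltonian : T.tuple.hamiltonian
    = pull (3 * T.p0 ^ 2 - T.p 1 * T.p 2 - T.p 2 * T.p 0 - T.p 0 * T.p 1) := rfl

theorem tuple_momentum (i : Fin 3) : T.tuple.momentum i
    = pull (-((1 / 2 : ℝ) • lie (T.D i) (T.p (i + 1) + T.p (i + 2)))
      - (1 / 2 : ℝ) • (T.c i (i + 1) (i + 1) * (T.p i - T.p (i + 1)))
      + (1 / 2 : ℝ) • (T.c (i + 2) i (i + 2) * (T.p i - T.p (i + 2)))
      + T.p i * lie (T.D i) T.zeta + 3 * T.p0 * lie (T.D i) T.chi) := by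
  have h1 : T.tuple.X i (T.tuple.p (i + 1) + T.tuple.p (i + 2))
      = pull (lie (T.D i) (T.p (i + 1) + T.p (i + 2))) :=
    lift_pull (T.D i) (T.p (i + 1) + T.p (i + 2))
  have h2 : T.tuple.X i T.tuple.zeta = pull (lie (T.D i) T.zeta) := lift_pull _ _
  have h3 : T.tuple.X i T.tuple.chi = pull (lie (T.D i) T.chi) := lift_pull _ _
  rw [Tuple.momentum, h1, h2, h3]
  rfl

theorem pull_eq_zero_iff {f : CM M} : pull f = 0 ↔ 0 = f :=
  ⟨fun h => (pull_injective (h.trans rfl : pull f = pull 0)).symm, fun h => h ▸ rfl⟩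

theorem constraints_iff : T.Constraints ↔
    T.tuple.hamiltonian = 0 ∧ ∀ i, T.tuple.momentum i = 0 := by
  simp only [tuple_hamiltonian, tuple_momentum, pull_eq_zero_iff]
  refine and_congr_right fun _ => ⟨fun h i => h i _ _ rfl rfl, ?_⟩
  rintro h i _ _ rfl rfl
  exact h i

theorem decay2_ne_zero (i : Fin 3) (q : Om M) : T.decay2 i q ≠ 0 :=
  mul_ne_zero (expOm_ne_zero _ _) (expOm_ne_zero _ _)

/-- Gauge condition, nondegeneracy and exactness hold for every tuple, so the Maurer-Cartan equation
is the only condition. The frame L matters only through its span over C^∞(Ω), which contains the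
lift of each D_i. -/
theorem element_mem_iff [T2Space M] {L : Fin 3 → VF M} (hL : IsFrame L) :
    T.element ∈ MCgauged L ↔ T.Constraints := by
  have hX : Independent T.tuple.X := independent_lift T.frame
  rw [constraints_iff, ← T.rules.equations_iff hX, ← gauge_eq, ← gauge_series]
  constructor
  · intro h
    exact Gauge.equations_of_bracketA_eq_zero _ h.1.2
  · intro h
    have hG : T.gauge.series ∈ affineGauged del0 fun l => lift (L l) := by
      refine Gauge.series_mem_affineGauged T.gauge fun i => Submodule.smul_mem _ _ ?_
      rw [lift_eq_sum hL]
      exact sum_mem fun l _ => Submodule.smul_mem _ _ (Submodule.subset_span ⟨l, rfl⟩)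
    refine ⟨⟨affineGauged_subset_A1 hG, h.bracketA_eq_zero⟩, hG,
      (isNondegenerate_iff rfl (fun i => rfl) T.decay2_ne_zero).2 T.frame,
      (Gauge.isExact_iff _).2 ?_⟩
    rw [gauge_eq]
    exact ⟨⟨_, T.rules.d0_potential_w, T.rules.potential_w⟩,
      ⟨_, T.rules.d0_potential_q, T.rules.potential_q⟩⟩

/-- The coefficients in degree 0 show p and p₀, hence the exponentials. These are units, so V gives
D, and then w and q give the derivatives of ζ and χ along D. -/
theorem gauge_eq_iff [T2Space M] [ConnectedSpace M] (T T' : Data M) :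
    T'.gauge = T.gauge ↔ T.SameUpToConstants T' := by
  constructor
  · intro h
    have hp : T'.p = T.p := funext fun i => pull_injective (congrArg (fun G => G.p i) h)
    have hf : T'.p0 = T.p0 := pull_injective (congrArg Gauge.f h)
    have hdecay : T'.decay = T.decay := by unfold decay; rw [hp]
    have hdecay2 : T'.decay2 = T.decay2 := by unfold decay2; rw [hdecay]
    have hunit : ∀ i, IsUnit (T.decay2 i) := fun i => (isUnit_expOm _).mul (isUnit_expOm _)
    have hD : T'.D = T.D := funext fun i => by
      have : T'.decay2 i • lift (T'.D i) = T.decay2 i • lift (T.D i) :=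
        congrArg (fun G => G.V i) h
      rw [hdecay2] at this
      exact lift_injective (smul_cancel_of_isUnit (hunit i) this)
    have hz : ∀ i, lie (T.D i) (T'.zeta - T.zeta) = 0 := fun i => by
      have : T'.coeffW i = T.coeffW i := congrArg (fun G => G.w i) h
      rw [coeffW, coeffW, hdecay2, hp, hD] at this
      rw [lie, map_sub]
      exact sub_eq_zero.2 (pull_injective (mul_sub_cancel_of_isUnit (hunit i) this))
    have hc : ∀ i, lie (T.D i) (T'.chi - T.chi) = 0 := fun i => by
      have : T'.coeffQ i = T.coeffQ i := congrArg (fun G => G.q i) h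
      rw [coeffQ, coeffQ, hdecay2, hf, hD] at this
      rw [lie, map_sub]
      exact sub_eq_zero.2 (pull_injective (mul_add_cancel_of_isUnit (hunit i) this))
    obtain ⟨r, hr⟩ := exists_const_of_lie_eq_zero T.frame hz
    obtain ⟨s, hs⟩ := exists_const_of_lie_eq_zero T.frame hc
    exact ⟨hD, hp, hf, ⟨r, fun x => sub_eq_iff_eq_add'.1 (hr x)⟩,
      ⟨s, fun x => sub_eq_iff_eq_add'.1 (hs x)⟩⟩
  · obtain ⟨D, hD, p, p0, z, k⟩ := T
    obtain ⟨D', hD', p', p0', z', k'⟩ := T'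
    rintro ⟨h1, h2, h3, ⟨r, hr⟩, ⟨s, hs⟩⟩
    dsimp only at h1 h2 h3 hr hs
    subst h1 h2 h3
    have hz : ∀ i, lie (D' i) z' = lie (D' i) z := fun i => lie_add_const _ hr
    have hk : ∀ i, lie (D' i) k' = lie (D' i) k := fun i => lie_add_const _ hs
    unfold gauge
    congr 1
    · funext i; simp only [coeffW, hz]; rfl
    · funext i; simp only [coeffA, hz]; rfl
    · funext i; simp only [coeffB, hz]; rfl
    · funext i; simp only [coeffQ, hk]; rfl

end Data

/-- Of the equations, only ∂₀p = 0, ∂₀f = 0, the scaling of V and the torsion equation are used;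
exactness supplies w and q. The constraints of the tuple then follow from `element_mem_iff`. -/
theorem exists_data [T2Space M] {L : Fin 3 → VF M} (hL : IsFrame L) {u : Series (E1 (COm M))}
    (hu : u ∈ MCgauged L) : ∃ T : Data M, T.gauge.series = u := by
  obtain ⟨⟨-, hmc⟩, haff, hnd, hex⟩ := hu
  obtain ⟨G, hd, hV, rfl⟩ := Gauge.exists_series_eq haff
  have e := Gauge.equations_of_bracketA_eq_zero G hmc
  obtain ⟨⟨g, hg0, hg⟩, ⟨g', hg0', hg'⟩⟩ := (Gauge.isExact_iff G).1 hex
  rw [hd] at hg0 hg0'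
  have hp : ∀ i, ∃ P, G.p i = pull P := fun i =>
    exists_pull_of_del0_eq_zero (by rw [← hd]; exact e.d0_p i)
  choose P hP using hp
  obtain ⟨F, hF⟩ : ∃ F, G.f = pull F :=
    exists_pull_of_del0_eq_zero (by rw [← hd]; exact e.d0_f)
  let E : Fin 3 → COm M := fun i => expOm (-(pull (P (i + 1)) * tau)) * expOm (-(pull (P (i + 2)) * tau))
  have hEF : ∀ i, E i * expOm (pull (P (i + 1) + P (i + 2)) * tau) = 1 := fun i => by
    have : pull (P (i + 1) + P (i + 2)) * tau = pull (P (i + 1)) * tau + pull (P (i + 2)) * tau := by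
      rw [pull_add, add_mul]
    rw [this, expOm_add, mul_mul_mul_comm, mul_comm (expOm _) (expOm (pull _ * tau)),
      expOm_mul_expOm_neg, one_mul, mul_comm, expOm_mul_expOm_neg]
  -- Expand V_i in L. The coefficients decay like e^{-(p_j+p_k)τ}, so after multiplication by the
  -- inverse exponential they are functions on M, the coefficients of D_i in L.
  have hD : ∀ i, ∃ X : VF M, G.V i = E i • lift X := fun i => by
    obtain ⟨b, hb⟩ := (Submodule.mem_span_range_iff_exists_fun _).1 (hV i)
    have hdV := e.d0_V i
    rw [hd, ← hb, hP, hP] at hdV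
    have hm : ∀ l, ∃ m, expOm (pull (P (i + 1) + P (i + 2)) * tau) * b l = pull m := fun l =>
      exists_pull_of_del0_eq_zero (derivation_scaled_coeff (independent_lift hL)
        (fun l => del0_lift_commutator (L l)) hdV (del0_expOm_mul_tau _) l)
    choose m hm using hm
    refine ⟨combination m L, ?_⟩
    rw [lift_combination, ← hb, mul_sum_smul (hEF i)]
    simp only [hm]
  choose D hD using hD
  have hframe : IsFrame D := (isNondegenerate_iff hd hD
    fun i q => mul_ne_zero (expOm_ne_zero _ _) (expOm_ne_zero _ _)).1 hnd
  -- The potential g grows linearly, with ∂₀g = p₁+p₂+p₃; subtracting this growth leaves a function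
  -- on M, and -g rather than g matches the sign of ζ.
  obtain ⟨z, hz⟩ : ∃ z, tau * (pull (P 0) + pull (P 1) + pull (P 2)) - g = pull z := by
    refine exists_pull_of_del0_eq_zero ?_
    rw [map_sub, Derivation.leibniz, del0_tau, hg0, hP, hP, hP, map_add, map_add, del0_pull,
      del0_pull, del0_pull, smul_eq_mul, smul_eq_mul]
    ring
  obtain ⟨k, hk⟩ : ∃ k, g' - tau * pull F = pull k := by
    refine exists_pull_of_del0_eq_zero ?_
    rw [map_sub, Derivation.leibniz, del0_tau, hg0', hF, del0_pull, smul_eq_mul, smul_eq_mul]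
    ring
  let T : Data M := ⟨D, hframe, P, F, z, k⟩
  refine ⟨T, congrArg _ ?_⟩
  have hTV : T.gauge.V = G.V := funext fun i => (hD i).symm
  have hTw : T.gauge.w = G.w := funext fun i => by
    have h1 := T.rules.potential_w i
    have h2 : T.tuple.tau * (T.tuple.p 0 + T.tuple.p 1 + T.tuple.p 2) - T.tuple.zeta = g := by
      change tau * (pull (P 0) + pull (P 1) + pull (P 2)) - pull z = g
      rw [← hz, sub_sub_cancel]
    rw [h2, ← Data.gauge_eq, hTV, hg] at h1
    exact h1.symm
  have hTq : T.gauge.q = G.q := funext fun i => by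
    have h1 := T.rules.potential_q i
    have h2 : T.tuple.tau * T.tuple.f + T.tuple.chi = g' := by
      change tau * pull F + pull k = g'
      rw [← hk, add_sub_cancel]
    rw [h2, ← Data.gauge_eq, hTV, hg'] at h1
    exact h1.symm
  have hTl : T.gauge.LieV := by rw [Data.gauge_eq]; exact T.rules.lieV
  have hTi : Independent T.gauge.V := by
    rw [Data.gauge_eq]; exact T.rules.independent (independent_lift hframe)
  -- With V and w known to agree, vanishing torsion identifies n, a, b without their evolution
  -- equations.
  obtain ⟨hn, ha, hb⟩ := Gauge.eq_of_lieV hTl e.lie_V hTi hTV hTw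
  have hTp : T.gauge.p = G.p := funext fun i => (hP i).symm
  have hTf : T.gauge.f = G.f := hF.symm
  have hTd : T.gauge.d0 = G.d0 := hd.symm
  generalize T.gauge = H at *
  obtain ⟨p, n, w, a, b, q, f, d0, V⟩ := G
  obtain ⟨p', n', w', a', b', q', f', d0', V'⟩ := H
  dsimp only at *
  subst hn ha hb hTp hTf hTd hTV hTw hTq
  rfl

end Manifold

end BKL

end

/-- The equivalence for all T' holds existence, uniqueness up to constants and invariance under
constants at once. That T satisfies the constraints follows from the first part, as its element is
u. -/
theorem lemma4 {M : Type*} [TopologicalSpace M] [ChartedSpace (EuclideanSpace ℝ (Fin 3)) M]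
    [IsManifold (𝓡 3) ∞ M] [CompactSpace M] [T2Space M] [ConnectedSpace M]
    (L : Fin 3 → BKL.VF M) (hL : BKL.IsFrame L) :
    (∀ T : BKL.Data M, T.element ∈ BKL.MCgauged L ↔ T.Constraints) ∧
    (∀ u ∈ BKL.MCgauged L, ∃ T : BKL.Data M, ∀ T' : BKL.Data M,
      T'.element = u ↔ T.SameUpToConstants T') := by
  refine ⟨fun T => T.element_mem_iff hL, fun u hu => ?_⟩
  obtain ⟨T, rfl⟩ := BKL.exists_data hL hu
  refine ⟨T, fun T' => ?_⟩
  rw [← BKL.Data.gauge_eq_iff, ← BKL.Data.gauge_series]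
  exact ⟨BKL.Gauge.series_injective, fun h => congrArg _ h⟩
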